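/- Let $m\ge 1$ and $N\geq 1$ be integers, let $\Omega\subsetneq\mathbf{R}^N$ be a convex domain (a non-empty convex open set, $\Omega\ne\mathbf{R}^N$) and let $d(x)=\mathrm{dist}(x,\partial\Omega)$. For $s\in(0,1]$ let $X_1(s)=(1-\log s)^{-1}$ and $X_i(s)=X_1(X_{i-1}(s))$ for $i\geq 2$, and put \[ A(m)=\frac{1^2\cdot 3^2\cdots(2m-1)^2}{4^m},\qquad B(m)=\frac{1}{4^m}\sum_{i=1}^m\ \prod_{1\le k\le m,\ k\neq i}(2k-1)^2, \] with the convention that empty sums are $0$ and empty products are $1$. For $D\ge\sup_\Omega d$ (so $d$ is bounded on $\Omega$), $r\ge 0$ and real-valued $u\in C_c^\infty(\Omega)$ let \[ I_r[u]=\int_\Omega(\Delta^{m/2}u)^2dx-A(m)\int_\Omega\frac{u^2}{d^{2m}}dx -B(m)\sum_{i=1}^r\int_\Omega\frac{u^2}{d^{2m}}X_1^2(d/D)\cdots X_i^2(d/D)\,dx , \] where $(\Delta^{m/2}u)^2$ stands for $|\nabla\Delta^{(m-1)/2}u|^2$ when $m$ is odd. Let $r\geq 1$ and suppose that for some constants $C>0$,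 $\theta\in\mathbf{R}$ and $D\geq\sup_\Omega d$ the inequality \[ I_{r-1}[u]\ \geq\ C\int_\Omega\frac{u^2}{d^{2m}}X_1^2(d/D)\cdots X_{r-1}^2(d/D)\,X_r^\theta(d/D)\,dx \] holds for all $u\in C_c^\infty(\Omega)$. Then (i) $\theta\geq 2$; (ii) if $\theta=2$, then $C\leq B(m)$. -/

import Mathlib

open MeasureTheory
open scoped ContDiff

noncomputable section

namespace HardyRellich

/-- The iterated logarithmic functions: `X 1 s = 1 / (1 - log s)` and
`X (i + 1) s = X 1 (X i s)`. The index `0` is only the seed of the recursion. -/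
def X : ℕ → ℝ → ℝ
  | 0, s => s
  | i + 1, s => (1 - Real.log (X i s))⁻¹

/-- The distance to the boundary of `Ω`. -/
def d {N : ℕ} (Ω : Set (EuclideanSpace ℝ (Fin N))) (x : EuclideanSpace ℝ (Fin N)) : ℝ :=
  Metric.infDist x (frontier Ω)

/-- `A(m) = 1² 3² ⋯ (2m-1)² / 4^m`. -/
def A (m : ℕ) : ℝ :=
  (∏ k ∈ Finset.Icc 1 m, (2 * (k : ℝ) - 1) ^ 2) / 4 ^ m

/-- `B(m) = 4^{-m} ∑_{i=1}^m ∏_{1 ≤ k ≤ m, k ≠ i} (2k-1)²`. -/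
def B (m : ℕ) : ℝ :=
  (1 / 4 ^ m) * ∑ i ∈ Finset.Icc 1 m, ∏ k ∈ (Finset.Icc 1 m).erase i, (2 * (k : ℝ) - 1) ^ 2

/-- The iterated Laplacian `Δ^j u`. -/
def iterLaplacian {N : ℕ} (j : ℕ) (u : EuclideanSpace ℝ (Fin N) → ℝ) :
    EuclideanSpace ℝ (Fin N) → ℝ :=
  (fun v : EuclideanSpace ℝ (Fin N) → ℝ => Laplacian.laplacian v)^[j] u

/-- The density `(Δ^{m/2} u)²`, read as `|∇ Δ^{(m-1)/2} u|²` when `m` is odd. -/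
def energyDensity {N : ℕ} (m : ℕ) (u : EuclideanSpace ℝ (Fin N) → ℝ)
    (x : EuclideanSpace ℝ (Fin N)) : ℝ :=
  if Even m then (iterLaplacian (m / 2) u x) ^ 2
  else ‖gradient (iterLaplacian ((m - 1) / 2) u) x‖ ^ 2

/-- The space `C_c^∞(Ω)` of real test functions. -/
def IsTestFunction {N : ℕ} (Ω : Set (EuclideanSpace ℝ (Fin N)))
    (u : EuclideanSpace ℝ (Fin N) → ℝ) : Prop :=
  ContDiff ℝ ∞ u ∧ HasCompactSupport u ∧ tsupport u ⊆ Ω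

/-- The functional `I_r[u]` (for given `m`, `Ω` and `D`). -/
def I {N : ℕ} (m : ℕ) (Ω : Set (EuclideanSpace ℝ (Fin N))) (D : ℝ) (r : ℕ)
    (u : EuclideanSpace ℝ (Fin N) → ℝ) : ℝ :=
  (∫ x in Ω, energyDensity m u x)
    - A m * (∫ x in Ω, u x ^ 2 / d Ω x ^ (2 * m))
    - B m * ∑ i ∈ Finset.Icc 1 r,
        ∫ x in Ω, u x ^ 2 / d Ω x ^ (2 * m) * ∏ j ∈ Finset.Icc 1 i, X j (d Ω x / D) ^ 2

end HardyRellich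

end

/-! Everything is tested near a single boundary point. If the conclusion fails, then `C X_r^θ ≥
(B(m) + κ) X_r²` near `0` for some `κ > 0` (`exists_rpow_X_ge`), so the assumed inequality is a
Hardy–Rellich inequality with `r` logarithmic terms and an excess `κ` in the last one. On suitable
test functions all other terms cancel up to a bounded amount. This bounds `κ ∫ X_1⋯X_r(h/D) / h`
over regions that exhaust a boundary collar, whereas this integral diverges, because `log X_r` is a
primitive of `X_1⋯X_r / s`.

One dimension. Write `Y_j = X_1⋯X_j` and `t = -log (s/D)`. The test function is `s^(m-1/2) v(t)`
with `v = Y_r^(-1/2)` times a smooth step in `-log X_r - M`, where `M → ∞`. Its `m`-th derivative is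
`s^(-1/2) ∏ (β_k - d/dt) v` with `β_k = m - 1/2 - k`. If `Q_j` are the coefficients of this
polynomial, then `Q_0² = A(m)` and `Q_1² - 2 Q_0 Q_2 = 4 B(m)`. Hence the square is `A v² + 4B v'²`
up to a derivative and up to products with at least three derivatives, which are `O(Y_r⁻¹ (1+t)⁻³)`
and integrable. The logarithmic derivative `σ = ½ ∑ Y_j` of `Y_r^(-1/2)` solves the Riccati equation
`σ' = -σ² - ¼ ∑ Y_j²`, so `4B v'²` is `B ∑ Y_j² v²` up to a derivative. The contribution of the
cut-off is itself the derivative of a bounded function. All bounds are uniform in `M`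
(`exists_profile_flux`, `exists_testFlux`).

Several dimensions. The boundary is merely convex and `d` need not be smooth. Near a boundary point
`Ω` is `{0 < g}` with `g` concave and Lipschitz (`exists_graphFunction`). The distance is replaced
by `h`, a negative power of the Riesz potential of `{g ≤ 0}`, which is exact for a half-space.
Splitting the potential along a supporting hyperplane shows that `|∇h|² - 1`, `g D²h` and the excess
in `d ≤ h (1 + Lθ)` are `O(θ)`, where `θ` (`nonflat`) is a scale-invariant mean of second
differences of `g` (`exists_regularDistance`). By concavity these differences have a sign, so their
size on average can be computed by moving them onto a smooth weight. This makes `g^(-3/2) θ`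
integrable up to the boundary (`setLIntegral_nonflat_lt_top`), which is what is needed, since the
errors in the energy are of size `g^(-3/2) (θ + g)`.

Transfer. For any chain of derivatives `f`, the polyharmonic energy density of `f(h) φ` is at most
`(f^(m)(h) φ)²` plus such errors (`exists_energyDensity_le`). The one-dimensional derivative becomes
the divergence of `P(h) φ² ∇h`, which has integral zero. As the Hardy weight is almost decreasing in
`d`, only upper bounds for `d` are used (`weight_comparison`). A calculus of symbol estimates for
families of germs, indexed by the base point and by `M`, makes every constant uniform. -/

noncomputable section

namespace HardyRellich

/-! ### Symbol calculus for families of germs -/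

section Symbols

variable {ι : Type} {E : Type} [NormedAddCommGroup E] [NormedSpace ℝ E]

/-- Symbol estimates up to order `n` for a family of germs: the `k`-th derivative of `a i` at
`pt i` is bounded by a constant multiple of `W i / ρ i ^ k`, uniformly in `i`. -/
def SymbolBound (pt : ι → E) (ρ : ι → ℝ) : ℕ → (F : Type) → [NormedAddCommGroup F] →
    [NormedSpace ℝ F] → (ι → ℝ) → (ι → E → F) → Prop
  | 0, _, _, _, W, a => ∃ C, ∀ i, ‖a i (pt i)‖ ≤ C * W i
  | n + 1, F, _, _, W, a => (∃ C, ∀ i, ‖a i (pt i)‖ ≤ C * W i) ∧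
      SymbolBound pt ρ n (E →L[ℝ] F) (fun i => W i / ρ i) (fun i => fderiv ℝ (a i))

/-- A family of smooth germs satisfying symbol estimates of every order. -/
structure IsSymbol (pt : ι → E) (ρ : ι → ℝ) {F : Type} [NormedAddCommGroup F] [NormedSpace ℝ F]
    (W : ι → ℝ) (a : ι → E → F) : Prop where
  smooth : ∀ i, ContDiffAt ℝ ∞ (a i) (pt i)
  bound : ∀ n, SymbolBound pt ρ n F W a

variable {pt : ι → E} {ρ : ι → ℝ}

theorem SymbolBound.value {F : Type} [NormedAddCommGroup F] [NormedSpace ℝ F] {n : ℕ}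
    {W : ι → ℝ} {a : ι → E → F} (h : SymbolBound pt ρ n F W a) :
    ∃ C, ∀ i, ‖a i (pt i)‖ ≤ C * W i := by
  cases n with
  | zero => exact h
  | succ n => exact h.1

theorem SymbolBound.congr {n : ℕ} : ∀ {F : Type} [NormedAddCommGroup F] [NormedSpace ℝ F]
    {W : ι → ℝ} {a b : ι → E → F}, (∀ i, a i =ᶠ[nhds (pt i)] b i) →
    SymbolBound pt ρ n F W a → SymbolBound pt ρ n F W b := by
  induction n with
  | zero =>
    rintro F _ _ W a b hab ⟨C, hC⟩
    exact ⟨C, fun i => by rw [← (hab i).eq_of_nhds]; exact hC i⟩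
  | succ n ih =>
    rintro F _ _ W a b hab ⟨⟨C, hC⟩, h⟩
    exact ⟨⟨C, fun i => by rw [← (hab i).eq_of_nhds]; exact hC i⟩,
      ih (fun i => (hab i).fderiv) h⟩

theorem SymbolBound.mono (hρ : ∀ i, 0 < ρ i) {n : ℕ} : ∀ {F : Type} [NormedAddCommGroup F]
    [NormedSpace ℝ F] {W W' : ι → ℝ} {a : ι → E → F} {K : ℝ}, (∀ i, 0 ≤ W i) →
    (∀ i, W i ≤ K * W' i) →
    SymbolBound pt ρ n F W a → SymbolBound pt ρ n F W' a := by
  have aux : ∀ {F : Type} [NormedAddCommGroup F] [NormedSpace ℝ F] {W W' : ι → ℝ}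
      {a : ι → E → F} {K : ℝ}, (∀ i, 0 ≤ W i) → (∀ i, W i ≤ K * W' i) →
      (∃ C, ∀ i, ‖a i (pt i)‖ ≤ C * W i) → ∃ C, ∀ i, ‖a i (pt i)‖ ≤ C * W' i := by
    rintro F _ _ W W' a K h0 hW ⟨C, hC⟩
    refine ⟨|C| * K, fun i => (hC i).trans ?_⟩
    calc C * W i ≤ |C| * W i := mul_le_mul_of_nonneg_right (le_abs_self C) (h0 i)
      _ ≤ |C| * (K * W' i) := mul_le_mul_of_nonneg_left (hW i) (abs_nonneg C)
      _ = _ := by ring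
  induction n with
  | zero => intro F _ _ W W' a K h0 hW h; exact aux h0 hW h
  | succ n ih =>
    rintro F _ _ W W' a K h0 hW ⟨h, h'⟩
    refine ⟨aux h0 hW h, ih (K := K) (fun i => div_nonneg (h0 i) (hρ i).le) (fun i => ?_) h'⟩
    rw [← mul_div_assoc]
    exact div_le_div_of_nonneg_right (hW i) (hρ i).le

theorem SymbolBound.reindex {κ : Type} (g : κ → ι) {n : ℕ} : ∀ {F : Type} [NormedAddCommGroup F]
    [NormedSpace ℝ F] {W : ι → ℝ} {a : ι → E → F},
    SymbolBound pt ρ n F W a →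
      SymbolBound (pt ∘ g) (ρ ∘ g) n F (W ∘ g) (fun k => a (g k)) := by
  induction n with
  | zero => rintro F _ _ W a ⟨C, h⟩; exact ⟨C, fun k => h (g k)⟩
  | succ n ih =>
    rintro F _ _ W a ⟨⟨C, h⟩, h'⟩
    exact ⟨⟨C, fun k => h (g k)⟩, ih h'⟩

theorem SymbolBound.zero {n : ℕ} : ∀ {F : Type} [NormedAddCommGroup F] [NormedSpace ℝ F]
    {W : ι → ℝ}, SymbolBound pt ρ n F W (fun _ _ => 0) := by
  induction n with
  | zero => intro F _ _ W; exact ⟨0, fun i => by simp⟩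
  | succ n ih =>
    intro F _ _ W
    refine ⟨⟨0, fun i => by simp⟩, ?_⟩
    have : (fun i : ι => fderiv ℝ (fun _ : E => (0 : F))) = fun _ _ => 0 := by
      funext i x; simp
    rw [this]; exact ih

theorem SymbolBound.add {n : ℕ} : ∀ {F : Type} [NormedAddCommGroup F] [NormedSpace ℝ F]
    {W : ι → ℝ} {a b : ι → E → F}, (∀ i, ContDiffAt ℝ ∞ (a i) (pt i)) →
    (∀ i, ContDiffAt ℝ ∞ (b i) (pt i)) → SymbolBound pt ρ n F W a → SymbolBound pt ρ n F W b →
    SymbolBound pt ρ n F W (fun i x => a i x + b i x) := by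
  have aux : ∀ {F : Type} [NormedAddCommGroup F] [NormedSpace ℝ F] {W : ι → ℝ}
      {a b : ι → E → F}, (∃ C, ∀ i, ‖a i (pt i)‖ ≤ C * W i) →
      (∃ C, ∀ i, ‖b i (pt i)‖ ≤ C * W i) → ∃ C, ∀ i, ‖a i (pt i) + b i (pt i)‖ ≤ C * W i := by
    rintro F _ _ W a b ⟨C, hC⟩ ⟨C', hC'⟩
    exact ⟨C + C', fun i => (norm_add_le _ _).trans (by linarith [hC i, hC' i])⟩
  induction n with
  | zero => intro F _ _ W a b _ _ h h'; exact aux h h'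
  | succ n ih =>
    rintro F _ _ W a b ha hb ⟨h1, h2⟩ ⟨h1', h2'⟩
    refine ⟨aux h1 h1', ?_⟩
    refine (ih (fun i => (ha i).fderiv_right (by simp)) (fun i => (hb i).fderiv_right (by simp))
      h2 h2').congr fun i => ?_
    filter_upwards [((ha i).of_le (by simp : (1 : WithTop ℕ∞) ≤ ∞)).eventually (by simp),
      ((hb i).of_le (by simp : (1 : WithTop ℕ∞) ≤ ∞)).eventually (by simp)] with x hx hx'
    rw [fderiv_fun_add (hx.differentiableAt (by simp)) (hx'.differentiableAt (by simp))]

theorem SymbolBound.of_succ {n : ℕ} : ∀ {F : Type} [NormedAddCommGroup F] [NormedSpace ℝ F]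
    {W : ι → ℝ} {a : ι → E → F}, SymbolBound pt ρ (n + 1) F W a → SymbolBound pt ρ n F W a := by
  induction n with
  | zero => intro F _ _ W a h; exact h.1
  | succ n ih => intro F _ _ W a h; exact ⟨h.1, ih h.2⟩

/-- Leibniz rule: the derivative of `B a b` is a sum of two bilinear expressions of the same kind,
in `(a, Db)` through `B.precompR` and in `(Da, b)` through `B.precompL`. The target spaces change,
so the induction ranges over all of them. -/
theorem SymbolBound.bilin {n : ℕ} : ∀ {F G H : Type} [NormedAddCommGroup F] [NormedSpace ℝ F]
    [NormedAddCommGroup G] [NormedSpace ℝ G] [NormedAddCommGroup H] [NormedSpace ℝ H]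
    (B : F →L[ℝ] G →L[ℝ] H) {W W' : ι → ℝ} {a : ι → E → F} {b : ι → E → G},
    (∀ i, ContDiffAt ℝ ∞ (a i) (pt i)) → (∀ i, ContDiffAt ℝ ∞ (b i) (pt i)) →
    SymbolBound pt ρ n F W a → SymbolBound pt ρ n G W' b →
    SymbolBound pt ρ n H (fun i => W i * W' i) (fun i x => B (a i x) (b i x)) := by
  have aux : ∀ {F G H : Type} [NormedAddCommGroup F] [NormedSpace ℝ F]
      [NormedAddCommGroup G] [NormedSpace ℝ G] [NormedAddCommGroup H] [NormedSpace ℝ H]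
      (B : F →L[ℝ] G →L[ℝ] H) {W W' : ι → ℝ} {a : ι → E → F} {b : ι → E → G},
      (∃ C, ∀ i, ‖a i (pt i)‖ ≤ C * W i) → (∃ C, ∀ i, ‖b i (pt i)‖ ≤ C * W' i) →
      ∃ C, ∀ i, ‖B (a i (pt i)) (b i (pt i))‖ ≤ C * (W i * W' i) := by
    rintro F G H _ _ _ _ _ _ B W W' a b ⟨C, hC⟩ ⟨C', hC'⟩
    refine ⟨‖B‖ * C * C', fun i => (B.le_opNorm₂ _ _).trans ?_⟩
    have := mul_le_mul (hC i) (hC' i) (norm_nonneg _) ((norm_nonneg _).trans (hC i))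
    calc ‖B‖ * ‖a i (pt i)‖ * ‖b i (pt i)‖ = ‖B‖ * (‖a i (pt i)‖ * ‖b i (pt i)‖) := by ring
      _ ≤ ‖B‖ * (C * W i * (C' * W' i)) := mul_le_mul_of_nonneg_left this (norm_nonneg B)
      _ = _ := by ring
  induction n with
  | zero => intro F G H _ _ _ _ _ _ B W W' a b _ _ h h'; exact aux B h h'
  | succ n ih =>
    intro F G H _ _ _ _ _ _ B W W' a b ha hb h h'
    refine ⟨aux B h.1 h'.1, ?_⟩
    have hda : ∀ i, ContDiffAt ℝ ∞ (fderiv ℝ (a i)) (pt i) :=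
      fun i => (ha i).fderiv_right (by simp)
    have hdb : ∀ i, ContDiffAt ℝ ∞ (fderiv ℝ (b i)) (pt i) :=
      fun i => (hb i).fderiv_right (by simp)
    have e1 := ih (B.precompR E) ha hdb h.of_succ h'.2
    have e2 := ih (B.precompL E) hda hb h.2 h'.of_succ
    have c1 : ∀ i, ContDiffAt ℝ ∞ (fun x => B.precompR E (a i x) (fderiv ℝ (b i) x)) (pt i) :=
      fun i => (contDiffAt_const.clm_apply (ha i)).clm_apply (hdb i)
    have c2 : ∀ i, ContDiffAt ℝ ∞ (fun x => B.precompL E (fderiv ℝ (a i) x) (b i x)) (pt i) :=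
      fun i => (contDiffAt_const.clm_apply (hda i)).clm_apply (hb i)
    have w1 : (fun i => W i * (W' i / ρ i)) = fun i => W i * W' i / ρ i := by
      funext i; ring
    have w2 : (fun i => W i / ρ i * W' i) = fun i => W i * W' i / ρ i := by
      funext i; ring
    rw [w1] at e1
    rw [w2] at e2
    refine (e1.add c1 c2 e2).congr fun i => ?_
    filter_upwards [((ha i).of_le (by simp : (1 : WithTop ℕ∞) ≤ ∞)).eventually (by simp),
      ((hb i).of_le (by simp : (1 : WithTop ℕ∞) ≤ ∞)).eventually (by simp)] with x hx hx'
    exact (B.hasFDerivAt_of_bilinear (hx.differentiableAt (by simp)).hasFDerivAt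
      (hx'.differentiableAt (by simp)).hasFDerivAt).fderiv.symm

namespace IsSymbol

variable {F G H : Type} [NormedAddCommGroup F] [NormedSpace ℝ F]
  [NormedAddCommGroup G] [NormedSpace ℝ G] [NormedAddCommGroup H] [NormedSpace ℝ H]
  {W W' : ι → ℝ}

theorem value {a : ι → E → F} (h : IsSymbol pt ρ W a) : ∃ C, ∀ i, ‖a i (pt i)‖ ≤ C * W i :=
  (h.bound 0).value

theorem congr {a b : ι → E → F} (h : IsSymbol pt ρ W a) (hab : ∀ i, a i =ᶠ[nhds (pt i)] b i) :
    IsSymbol pt ρ W b :=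
  ⟨fun i => (h.smooth i).congr_of_eventuallyEq (hab i).symm, fun n => (h.bound n).congr hab⟩

theorem mono {a : ι → E → F} (h : IsSymbol pt ρ W a) (hρ : ∀ i, 0 < ρ i) (h0 : ∀ i, 0 ≤ W i)
    (K : ℝ) (hW : ∀ i, W i ≤ K * W' i) : IsSymbol pt ρ W' a :=
  ⟨h.smooth, fun n => (h.bound n).mono hρ h0 hW⟩

theorem reindex {κ : Type} (g : κ → ι) {a : ι → E → F} (h : IsSymbol pt ρ W a) :
    IsSymbol (pt ∘ g) (ρ ∘ g) (W ∘ g) (fun k => a (g k)) :=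
  ⟨fun k => h.smooth (g k), fun n => (h.bound n).reindex g⟩

theorem fderiv {a : ι → E → F} (h : IsSymbol pt ρ W a) :
    IsSymbol pt ρ (fun i => W i / ρ i) (fun i => fderiv ℝ (a i)) :=
  ⟨fun i => (h.smooth i).fderiv_right (by simp), fun n => (h.bound (n + 1)).2⟩

/-- The usual way to produce a symbol: the value is bounded by hand, and the derivative is
recognised as an expression in symbols already known. -/
theorem of_fderiv {a : ι → E → F} (hs : ∀ i, ContDiffAt ℝ ∞ (a i) (pt i)) (C : ℝ)
    (hC : ∀ i, ‖a i (pt i)‖ ≤ C * W i)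
    (h : IsSymbol pt ρ (fun i => W i / ρ i) (fun i => _root_.fderiv ℝ (a i))) :
    IsSymbol pt ρ W a :=
  ⟨hs, fun n => by
    cases n with
    | zero => exact ⟨C, hC⟩
    | succ n => exact ⟨⟨C, hC⟩, h.bound n⟩⟩

theorem zero : IsSymbol pt ρ W (fun _ _ => (0 : F)) :=
  ⟨fun _ => contDiffAt_const, fun _ => SymbolBound.zero⟩

theorem const (c : ι → F) (C : ℝ) (hC : ∀ i, ‖c i‖ ≤ C * W i) :
    IsSymbol pt ρ W (fun i _ => c i) := by
  refine of_fderiv (fun _ => contDiffAt_const) C hC ?_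
  have : (fun i : ι => _root_.fderiv ℝ (fun _ : E => c i)) = fun _ _ => 0 := by
    funext i x; simp
  rw [this]
  exact zero

theorem add {a b : ι → E → F} (ha : IsSymbol pt ρ W a) (hb : IsSymbol pt ρ W b) :
    IsSymbol pt ρ W (fun i x => a i x + b i x) :=
  ⟨fun i => (ha.smooth i).add (hb.smooth i),
    fun n => (ha.bound n).add ha.smooth hb.smooth (hb.bound n)⟩

theorem sum {κ : Type} (s : Finset κ) {a : κ → ι → E → F} (h : ∀ k ∈ s, IsSymbol pt ρ W (a k)) :
    IsSymbol pt ρ W (fun i x => ∑ k ∈ s, a k i x) := by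
  classical
  induction s using Finset.induction_on with
  | empty => simpa using zero
  | insert k s hk ih =>
    simp only [Finset.sum_insert hk]
    exact (h k (Finset.mem_insert_self _ _)).add
      (ih fun j hj => h j (Finset.mem_insert_of_mem hj))

theorem bilin (B : F →L[ℝ] G →L[ℝ] H) {a : ι → E → F} {b : ι → E → G}
    (ha : IsSymbol pt ρ W a) (hb : IsSymbol pt ρ W' b) :
    IsSymbol pt ρ (fun i => W i * W' i) (fun i x => B (a i x) (b i x)) :=
  ⟨fun i => (B.contDiff.comp_contDiffAt _ (ha.smooth i)).clm_apply (hb.smooth i),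
    fun n => (ha.bound n).bilin B ha.smooth hb.smooth (hb.bound n)⟩

theorem mul {a b : ι → E → ℝ} (ha : IsSymbol pt ρ W a) (hb : IsSymbol pt ρ W' b) :
    IsSymbol pt ρ (fun i => W i * W' i) (fun i x => a i x * b i x) :=
  ha.bilin (ContinuousLinearMap.mul ℝ ℝ) hb

theorem smul {a : ι → E → ℝ} {b : ι → E → F} (ha : IsSymbol pt ρ W a) (hb : IsSymbol pt ρ W' b) :
    IsSymbol pt ρ (fun i => W i * W' i) (fun i x => a i x • b i x) :=
  ha.bilin (ContinuousLinearMap.lsmul ℝ ℝ) hb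

theorem const_mul {a : ι → E → ℝ} (ha : IsSymbol pt ρ W a) (c : ℝ) :
    IsSymbol pt ρ W (fun i x => c * a i x) := by
  have := (const (pt := pt) (ρ := ρ) (W := fun _ => 1) (fun _ => c) |c| (by simp)).mul ha
  simpa using this

theorem clm (L : F →L[ℝ] G) {a : ι → E → F} (ha : IsSymbol pt ρ W a) :
    IsSymbol pt ρ W (fun i x => L (a i x)) := by
  have := (const (pt := pt) (ρ := ρ) (W := fun _ => 1) (fun _ => L) ‖L‖ (by simp)).bilin
    (ContinuousLinearMap.id ℝ (F →L[ℝ] G)) ha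
  simpa using this

theorem partialDeriv {a : ι → E → F} (ha : IsSymbol pt ρ W a) (v : E) :
    IsSymbol pt ρ (fun i => W i / ρ i) (fun i x => _root_.fderiv ℝ (a i) x v) :=
  ha.fderiv.clm (ContinuousLinearMap.apply ℝ F v)

theorem pow {a : ι → E → ℝ} (ha : IsSymbol pt ρ W a) (k : ℕ) :
    IsSymbol pt ρ (fun i => W i ^ k) (fun i x => a i x ^ k) := by
  induction k with
  | zero => simpa using const (pt := pt) (ρ := ρ) (W := fun _ => 1) (fun _ => (1 : ℝ)) 1 (by simp)
  | succ k ih => simpa only [pow_succ] using ih.mul ha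

theorem prod {κ : Type} (s : Finset κ) {V : κ → ι → ℝ} {a : κ → ι → E → ℝ}
    (h : ∀ k ∈ s, IsSymbol pt ρ (V k) (a k)) :
    IsSymbol pt ρ (fun i => ∏ k ∈ s, V k i) (fun i x => ∏ k ∈ s, a k i x) := by
  classical
  induction s using Finset.induction_on with
  | empty =>
    simpa using const (pt := pt) (ρ := ρ) (W := fun _ => 1) (fun _ => (1 : ℝ)) 1 (by simp)
  | insert k s hk ih =>
    simp only [Finset.prod_insert hk]
    exact (h k (Finset.mem_insert_self _ _)).mul
      (ih fun j hj => h j (Finset.mem_insert_of_mem hj))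

/-- Real powers of an elliptic positive symbol. -/
theorem rpow {a : ι → E → ℝ} (ha : IsSymbol pt ρ W a) (hW : ∀ i, 0 < W i) (c : ℝ) (hc : 0 < c)
    (hl : ∀ i, c * W i ≤ a i (pt i)) (β : ℝ) :
    IsSymbol pt ρ (fun i => W i ^ β) (fun i x => a i x ^ β) := by
  have hpos : ∀ i, 0 < a i (pt i) := fun i => (mul_pos hc (hW i)).trans_le (hl i)
  have hsm : ∀ (β : ℝ) i, ContDiffAt ℝ ∞ (fun x => a i x ^ β) (pt i) := fun β i =>
    (ha.smooth i).rpow_const_of_ne (hpos i).ne'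
  obtain ⟨C, hC⟩ := ha.value
  have hval : ∀ β : ℝ, ∃ K, ∀ i, ‖a i (pt i) ^ β‖ ≤ K * W i ^ β := by
    intro β
    refine ⟨|C| ^ β + c ^ β, fun i => ?_⟩
    have h1 : a i (pt i) ≤ |C| * W i := (le_abs_self _).trans ((hC i).trans
      (mul_le_mul_of_nonneg_right (le_abs_self C) (hW i).le))
    have hC0 : 0 ≤ |C| := abs_nonneg C
    rw [Real.norm_of_nonneg (Real.rpow_nonneg (hpos i).le _)]
    rcases le_total 0 β with hβ | hβ
    · calc a i (pt i) ^ β ≤ (|C| * W i) ^ β := Real.rpow_le_rpow (hpos i).le h1 hβ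
        _ = |C| ^ β * W i ^ β := Real.mul_rpow hC0 (hW i).le
        _ ≤ _ := by
          have := Real.rpow_nonneg hc.le β
          have := Real.rpow_nonneg (hW i).le β
          nlinarith
    · calc a i (pt i) ^ β ≤ (c * W i) ^ β :=
            Real.rpow_le_rpow_of_nonpos (mul_pos hc (hW i)) (hl i) hβ
        _ = c ^ β * W i ^ β := Real.mul_rpow hc.le (hW i).le
        _ ≤ _ := by
          have := Real.rpow_nonneg hC0 β
          have := Real.rpow_nonneg (hW i).le β
          nlinarith
  refine ⟨hsm β, fun n => ?_⟩
  induction n generalizing β with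
  | zero => exact hval β
  | succ n ih =>
    refine ⟨hval β, ?_⟩
    -- The derivative `β a^(β-1) Da` has weight `W^(β-1) W / ρ = W^β / ρ`. It involves another
    -- exponent, so the induction runs over all `β` at once.
    have h1 := (const (pt := pt) (ρ := ρ) (W := fun _ => 1) (fun _ => β) |β| (by simp))
    have h2 := ((h1.bound n).bilin (ContinuousLinearMap.mul ℝ ℝ) h1.smooth (hsm (β - 1))
      (ih (β - 1)))
    have h3 := h2.bilin (ContinuousLinearMap.lsmul ℝ ℝ)
      (fun i => contDiffAt_const.mul (hsm (β - 1) i)) ha.fderiv.smooth (ha.fderiv.bound n)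
    have hw : (fun i => 1 * W i ^ (β - 1) * (W i / ρ i)) = fun i => W i ^ β / ρ i := by
      funext i
      rw [Real.rpow_sub_one (hW i).ne']
      field_simp [(hW i).ne']
    rw [hw] at h3
    refine h3.congr fun i => ?_
    filter_upwards [((ha.smooth i).of_le (by simp : (1 : WithTop ℕ∞) ≤ ∞)).eventually (by simp),
      (ha.smooth i).continuousAt.eventually (lt_mem_nhds (hpos i))] with x hx hx'
    have := (hx.differentiableAt (by simp)).hasFDerivAt.rpow_const (p := β) (Or.inl hx'.ne')
    exact this.fderiv.symm

/-- Composition with functions all of whose derivatives are uniformly bounded. -/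
theorem comp_bounded {a : ι → E → ℝ}
    (hs : ∀ i, ContDiffAt ℝ ∞ (a i) (pt i))
    (ha : IsSymbol pt ρ (fun i => 1 / ρ i) (fun i => _root_.fderiv ℝ (a i)))
    {χ : ℕ → ι → ℝ → ℝ} (hχ : ∀ k i s, HasDerivAt (χ k i) (χ (k + 1) i s) s)
    (hb : ∀ k, ∃ C, ∀ i s, |χ k i s| ≤ C) (k : ℕ) :
    IsSymbol pt ρ (fun _ => 1) (fun i x => χ k i (a i x)) := by
  have hχs : ∀ k i, ContDiff ℝ ∞ (χ k i) := by
    intro k i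
    refine contDiff_infty.2 fun n => ?_
    induction n generalizing k with
    | zero =>
      exact contDiff_zero.2 (continuous_iff_continuousAt.2 fun s => (hχ k i s).continuousAt)
    | succ n ih =>
      refine (contDiff_succ_iff_deriv (n := n)).2 ⟨fun s => (hχ k i s).differentiableAt, by simp,
        ?_⟩
      rw [show deriv (χ k i) = χ (k + 1) i from funext fun s => (hχ k i s).deriv]
      exact ih (k + 1)
  have hsm : ∀ k i, ContDiffAt ℝ ∞ (fun x => χ k i (a i x)) (pt i) :=
    fun k i => (hχs k i).contDiffAt.comp _ (hs i)
  have hval : ∀ k, ∃ C, ∀ i, ‖χ k i (a i (pt i))‖ ≤ C * 1 := fun k => by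
    obtain ⟨C, hC⟩ := hb k
    exact ⟨C, fun i => by simpa using hC i _⟩
  refine ⟨hsm k, fun n => ?_⟩
  induction n generalizing k with
  | zero => exact hval k
  | succ n ih =>
    refine ⟨hval k, ?_⟩
    have h3 := (ih (k + 1)).bilin (ContinuousLinearMap.lsmul ℝ ℝ) (hsm (k + 1)) ha.smooth
      (ha.bound n)
    simp only [one_mul] at h3
    refine h3.congr fun i => ?_
    filter_upwards [((hs i).of_le (by simp : (1 : WithTop ℕ∞) ≤ ∞)).eventually (by simp)]
      with x hx
    exact ((hχ k i (a i x)).comp_hasFDerivAt x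
      (hx.differentiableAt (by simp)).hasFDerivAt).fderiv.symm

end IsSymbol

end Symbols

/-! ### The iterated logarithms and their derivatives -/

section LogFunctions

/-- The product `X_1 ⋯ X_i`. -/
def Xprod (i : ℕ) (s : ℝ) : ℝ := ∏ j ∈ Finset.Icc 1 i, X j s

theorem X_succ (i : ℕ) (s : ℝ) : X (i + 1) s = (1 - Real.log (X i s))⁻¹ := rfl

theorem X_pos_and_le_one (i : ℕ) {s : ℝ} (h0 : 0 < s) (h1 : s ≤ 1) : 0 < X i s ∧ X i s ≤ 1 := by
  induction i with
  | zero => exact ⟨h0, h1⟩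
  | succ i ih =>
    have : Real.log (X i s) ≤ 0 := Real.log_nonpos ih.1.le ih.2
    rw [X_succ]
    exact ⟨by apply inv_pos.2; linarith, inv_le_one_of_one_le₀ (by linarith)⟩

theorem X_pos (i : ℕ) {s : ℝ} (h0 : 0 < s) (h1 : s ≤ 1) : 0 < X i s := (X_pos_and_le_one i h0 h1).1

theorem X_le_one (i : ℕ) {s : ℝ} (h0 : 0 < s) (h1 : s ≤ 1) : X i s ≤ 1 :=
  (X_pos_and_le_one i h0 h1).2

theorem one_sub_log_X_ge_one (i : ℕ) {s : ℝ} (h0 : 0 < s) (h1 : s ≤ 1) :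
    1 ≤ 1 - Real.log (X i s) := by
  have := Real.log_nonpos (X_pos i h0 h1).le (X_le_one i h0 h1)
  linarith

theorem X_mono (i : ℕ) {s s' : ℝ} (h0 : 0 < s) (h : s ≤ s') (h1 : s' ≤ 1) : X i s ≤ X i s' := by
  induction i with
  | zero => exact h
  | succ i ih =>
    have := one_sub_log_X_ge_one i (h0.trans_le h) h1
    have := Real.log_le_log (X_pos i h0 (h.trans h1)) ih
    rw [X_succ, X_succ]
    exact inv_anti₀ (by linarith) (by linarith)

theorem X_le_X_succ (i : ℕ) {s : ℝ} (h0 : 0 < s) (h1 : s ≤ 1) : X i s ≤ X (i + 1) s := by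
  have hp := X_pos i h0 h1
  have h2 := one_sub_log_X_ge_one i h0 h1
  have h3 := Real.one_sub_inv_le_log_of_pos hp
  rw [X_succ, le_inv_comm₀ hp (by linarith)]
  linarith

theorem X_le_X {i j : ℕ} (hij : i ≤ j) {s : ℝ} (h0 : 0 < s) (h1 : s ≤ 1) : X i s ≤ X j s := by
  induction hij with
  | refl => exact le_rfl
  | step _ ih => exact ih.trans (X_le_X_succ _ h0 h1)

theorem Xprod_zero (s : ℝ) : Xprod 0 s = 1 := by simp [Xprod]

theorem Xprod_succ (i : ℕ) (s : ℝ) : Xprod (i + 1) s = Xprod i s * X (i + 1) s := by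
  rw [Xprod, Xprod, Finset.prod_Icc_succ_top (by omega)]

theorem Xprod_pos (i : ℕ) {s : ℝ} (h0 : 0 < s) (h1 : s ≤ 1) : 0 < Xprod i s :=
  Finset.prod_pos fun j _ => X_pos j h0 h1

theorem Xprod_le_one (i : ℕ) {s : ℝ} (h0 : 0 < s) (h1 : s ≤ 1) : Xprod i s ≤ 1 :=
  Finset.prod_le_one (fun j _ => (X_pos j h0 h1).le) fun j _ => X_le_one j h0 h1

theorem Xprod_le_X_one {i : ℕ} (hi : 1 ≤ i) {s : ℝ} (h0 : 0 < s) (h1 : s ≤ 1) :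
    Xprod i s ≤ X 1 s := by
  induction i, hi using Nat.le_induction with
  | base => simp [Xprod]
  | succ i _ ih =>
    rw [Xprod_succ]
    exact (mul_le_of_le_one_right (Xprod_pos i h0 h1).le (X_le_one _ h0 h1)).trans ih

theorem X_one_pow_le_Xprod (i : ℕ) {s : ℝ} (h0 : 0 < s) (h1 : s ≤ 1) :
    X 1 s ^ i ≤ Xprod i s := by
  have : X 1 s ^ i = ∏ _j ∈ Finset.Icc 1 i, X 1 s := by simp
  rw [this, Xprod]
  exact Finset.prod_le_prod (fun _ _ => (X_pos 1 h0 h1).le) fun j hj =>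
    X_le_X (Finset.mem_Icc.1 hj).1 h0 h1

/-- The sharp scaling inequality `κ ^ (X_1 ⋯ X_i)(s) X_i(s) ≤ X_i(κ s)`. -/
theorem rpow_mul_X_le (i : ℕ) {s κ : ℝ} (h0 : 0 < s) (h1 : s ≤ 1) (hκ : 0 < κ) (hκ1 : κ ≤ 1) :
    κ ^ Xprod i s * X i s ≤ X i (κ * s) := by
  induction i with
  | zero => simp [Xprod_zero, X]
  | succ i ih =>
    have hX := X_pos i h0 h1
    have hb := one_sub_log_X_ge_one i h0 h1
    have hks : 0 < κ * s := mul_pos hκ h0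
    have hks1 : κ * s ≤ 1 := mul_le_one₀ hκ1 h0.le h1
    have hb' := one_sub_log_X_ge_one i hks hks1
    have hlκ : Real.log κ ≤ 0 := Real.log_nonpos hκ.le hκ1
    have h2 := Real.log_le_log (by positivity) ih
    rw [Real.log_mul (by positivity) hX.ne', Real.log_rpow hκ] at h2
    have hYi := Xprod_pos i h0 h1
    set b := 1 - Real.log (X i s) with hbdef
    have hX1 : X (i + 1) s = b⁻¹ := rfl
    have h3 : X (i + 1) (κ * s) ≥ (b - Xprod i s * Real.log κ)⁻¹ := by
      rw [X_succ]
      exact inv_anti₀ (by linarith) (by linarith)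
    refine le_trans ?_ h3
    rw [Xprod_succ, hX1, Real.rpow_def_of_pos hκ]
    -- With `x = log κ · Y_i(s) / b` the claim has been reduced to `1 - x ≤ exp (-x)`.
    have h4 := Real.add_one_le_exp (-(Real.log κ * (Xprod i s * b⁻¹)))
    rw [Real.exp_neg] at h4
    set y := Real.exp (Real.log κ * (Xprod i s * b⁻¹)) with hy
    have hy0 : 0 < y := Real.exp_pos _
    have hb0 : 0 < b := by linarith
    have hd : 0 < b - Xprod i s * Real.log κ := by nlinarith
    rw [le_inv_comm₀ (by positivity) hd, mul_inv, inv_inv]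
    calc b - Xprod i s * Real.log κ = (-(Real.log κ * (Xprod i s * b⁻¹)) + 1) * b := by
          field_simp; ring
      _ ≤ _ := mul_le_mul_of_nonneg_right h4 hb0.le

theorem mul_X_le (i : ℕ) {κ s : ℝ} (hκ : 0 < κ) (hκ1 : κ ≤ 1) (h0 : 0 < s) (h1 : s ≤ 1) :
    κ * X i s ≤ X i (κ * s) := by
  refine le_trans ?_ (rpow_mul_X_le i h0 h1 hκ hκ1)
  refine mul_le_mul_of_nonneg_right ?_ (X_pos i h0 h1).le
  calc κ = κ ^ (1 : ℝ) := (Real.rpow_one κ).symm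
    _ ≤ _ := Real.rpow_le_rpow_of_exponent_ge hκ hκ1 (Xprod_le_one i h0 h1)

theorem pow_mul_Xprod_le (i : ℕ) {κ s : ℝ} (hκ : 0 < κ) (hκ1 : κ ≤ 1) (h0 : 0 < s) (h1 : s ≤ 1) :
    κ ^ i * Xprod i s ≤ Xprod i (κ * s) := by
  induction i with
  | zero => simp [Xprod_zero]
  | succ i ih =>
    rw [Xprod_succ, Xprod_succ, pow_succ]
    calc κ ^ i * κ * (Xprod i s * X (i + 1) s) = (κ ^ i * Xprod i s) * (κ * X (i + 1) s) := by ring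
      _ ≤ _ := mul_le_mul ih (mul_X_le _ hκ hκ1 h0 h1)
        (mul_nonneg hκ.le (X_pos _ h0 h1).le)
        (Xprod_pos i (mul_pos hκ h0) (mul_le_one₀ hκ1 h0.le h1)).le

theorem tendsto_X_zero (i : ℕ) :
    Filter.Tendsto (X i) (nhdsWithin 0 (Set.Ioi 0)) (nhdsWithin 0 (Set.Ioi 0)) := by
  induction i with
  | zero => exact Filter.tendsto_id
  | succ i ih =>
    refine Filter.Tendsto.comp (g := fun y => (1 - Real.log y)⁻¹) ?_ ih
    refine Filter.Tendsto.comp tendsto_inv_atTop_nhdsGT_zero ?_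
    have := Real.tendsto_log_nhdsGT_zero
    exact Filter.tendsto_atTop_add_const_left _ 1 (Filter.tendsto_neg_atBot_atTop.comp this)

/-- The logarithmic derivatives telescope: `X_{i+1}' = X_{i+1}² X_i' / X_i`, and `X_i' / X_i = Y_i /
s` by induction. In particular `log X_i` is a primitive of `Y_i / s`. -/
theorem hasDerivAt_X (i : ℕ) {s : ℝ} (h0 : 0 < s) (h1 : s ≤ 1) :
    HasDerivAt (X i) (X i s * Xprod i s / s) s := by
  induction i with
  | zero =>
    have : X 0 s * Xprod 0 s / s = 1 := by rw [Xprod_zero]; simp [X, h0.ne']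
    rw [this]
    exact hasDerivAt_id s
  | succ i ih =>
    have hX := X_pos i h0 h1
    have hb := one_sub_log_X_ge_one i h0 h1
    have h2 := (((ih.log hX.ne').const_sub 1).inv (by linarith))
    refine HasDerivAt.congr_deriv (f := X (i + 1)) h2 ?_
    rw [Xprod_succ, X_succ]
    field_simp

/-- `X_i` in the variable `t = -log s`. -/
def logX (i : ℕ) (t : ℝ) : ℝ := X i (Real.exp (-t))

/-- `X_1 ⋯ X_i` in the variable `t = -log s`. -/
def logXprod (i : ℕ) (t : ℝ) : ℝ := Xprod i (Real.exp (-t))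

theorem exp_neg_le_one {t : ℝ} (ht : 0 < t) : Real.exp (-t) ≤ 1 := Real.exp_le_one_iff.2 (by linarith)

theorem logX_pos (i : ℕ) {t : ℝ} (ht : 0 < t) : 0 < logX i t :=
  X_pos i (Real.exp_pos _) (exp_neg_le_one ht)

theorem logXprod_pos (i : ℕ) {t : ℝ} (ht : 0 < t) : 0 < logXprod i t :=
  Xprod_pos i (Real.exp_pos _) (exp_neg_le_one ht)

theorem logXprod_le_one (i : ℕ) {t : ℝ} (ht : 0 < t) : logXprod i t ≤ 1 :=
  Xprod_le_one i (Real.exp_pos _) (exp_neg_le_one ht)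

theorem logX_one (t : ℝ) : logX 1 t = (1 + t)⁻¹ := by simp [logX, X]

theorem logXprod_succ (i : ℕ) (t : ℝ) : logXprod (i + 1) t = logXprod i t * logX (i + 1) t :=
  Xprod_succ i _

theorem hasDerivAt_logX (i : ℕ) {t : ℝ} (ht : 0 < t) :
    HasDerivAt (logX i) (-(logX i t * logXprod i t)) t := by
  have h1 := hasDerivAt_X i (Real.exp_pos (-t)) (exp_neg_le_one ht)
  have h2 := h1.comp t ((hasDerivAt_neg t).exp)
  refine HasDerivAt.congr_deriv (f := logX i) h2 ?_
  simp only [logX, logXprod]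
  field_simp [(Real.exp_pos (-t)).ne']

theorem hasDerivAt_logXprod (i : ℕ) {t : ℝ} (ht : 0 < t) :
    HasDerivAt (logXprod i)
      (-(logXprod i t * ∑ j ∈ Finset.Icc 1 i, logXprod j t)) t := by
  induction i with
  | zero =>
    have : logXprod 0 = fun _ => 1 := funext fun t => Xprod_zero _
    rw [this]
    simpa using hasDerivAt_const t (1 : ℝ)
  | succ i ih =>
    have : logXprod (i + 1) = fun t => logXprod i t * logX (i + 1) t :=
      funext fun t => logXprod_succ i t
    rw [this]
    refine (ih.mul (hasDerivAt_logX (i + 1) ht)).congr_deriv ?_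
    rw [Finset.sum_Icc_succ_top (by omega)]
    ring

/-- Half the sum of the products `X_1 ⋯ X_i`, the logarithmic derivative of `(X_1 ⋯ X_r)^{-1/2}`. -/
def logSlope (r : ℕ) (t : ℝ) : ℝ := (1 / 2) * ∑ j ∈ Finset.Icc 1 r, logXprod j t

/-- Riccati equation. Since `(Y_r^(-1/2))' = σ Y_r^(-1/2)` with `σ = logSlope r`, it says that
`Y_r^(-1/2)` solves the critical equation `v'' = -¼ (∑ Y_j²) v`. This is why the profile is built on
`Y_r^(-1/2)`. -/
theorem hasDerivAt_logSlope (r : ℕ) {t : ℝ} (ht : 0 < t) :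
    HasDerivAt (logSlope r)
      (-(logSlope r t ^ 2) - (1 / 4) * ∑ j ∈ Finset.Icc 1 r, logXprod j t ^ 2) t := by
  have h : HasDerivAt (logSlope r) ((1 / 2) * ∑ j ∈ Finset.Icc 1 r,
      (-(logXprod j t * ∑ k ∈ Finset.Icc 1 j, logXprod k t))) t :=
    (HasDerivAt.fun_sum fun j _ => hasDerivAt_logXprod j ht).const_mul _
  refine h.congr_deriv ?_
  unfold logSlope
  clear h
  induction r with
  | zero => simp
  | succ r ih =>
    rw [Finset.sum_Icc_succ_top (by omega), Finset.sum_Icc_succ_top (by omega),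
      Finset.sum_Icc_succ_top (by omega)]
    linear_combination ih

end LogFunctions

/-! ### Symbol estimates in one variable, the cut-off and the profile -/

section OneDimensionalSymbols

variable {ι : Type} {pt : ι → ℝ} {ρ W : ι → ℝ}

theorem IsSymbol.fderiv_of_hasDerivAt {a a' : ι → ℝ → ℝ}
    (hd : ∀ i, ∀ᶠ x in nhds (pt i), HasDerivAt (a i) (a' i x) x)
    (h : IsSymbol pt ρ W a') : IsSymbol pt ρ W (fun i => _root_.fderiv ℝ (a i)) := by
  refine (h.clm (ContinuousLinearMap.lsmul ℝ ℝ)).congr fun i => ?_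
  filter_upwards [hd i] with x hx
  rw [hx.hasFDerivAt.fderiv]
  ext
  simp

theorem IsSymbol.of_hasDerivAt {a a' : ι → ℝ → ℝ} (hs : ∀ i, ContDiffAt ℝ ∞ (a i) (pt i)) (C : ℝ)
    (hC : ∀ i, ‖a i (pt i)‖ ≤ C * W i)
    (hd : ∀ i, ∀ᶠ x in nhds (pt i), HasDerivAt (a i) (a' i x) x)
    (h : IsSymbol pt ρ (fun i => W i / ρ i) a') : IsSymbol pt ρ W a :=
  IsSymbol.of_fderiv hs C hC (h.fderiv_of_hasDerivAt hd)

theorem IsSymbol.deriv {a : ι → ℝ → ℝ} (h : IsSymbol pt ρ W a) :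
    IsSymbol pt ρ (fun i => W i / ρ i) (fun i => deriv (a i)) := by
  refine (h.partialDeriv (1 : ℝ)).congr fun i => ?_
  exact Filter.Eventually.of_forall fun x => by simp

theorem IsSymbol.iteratedDeriv {a : ι → ℝ → ℝ} (h : IsSymbol pt ρ W a) (k : ℕ) :
    IsSymbol pt ρ (fun i => W i / ρ i ^ k) (fun i => iteratedDeriv k (a i)) := by
  induction k with
  | zero => simpa using h
  | succ k ih =>
    simp only [iteratedDeriv_succ]
    convert ih.deriv using 2
    rw [pow_succ, div_div]

/-- A smooth decreasing step from `1` to `0` on `[0, 1]`, and its derivatives. -/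
def cutoff (k : ℕ) : ℝ → ℝ := _root_.iteratedDeriv k (fun s => Real.smoothTransition (1 - s))

theorem contDiff_cutoff_zero : ContDiff ℝ ∞ (fun s : ℝ => Real.smoothTransition (1 - s)) :=
  Real.smoothTransition.contDiff.comp (contDiff_const.sub contDiff_id)

theorem hasDerivAt_cutoff (k : ℕ) (s : ℝ) : HasDerivAt (cutoff k) (cutoff (k + 1) s) s := by
  have := (contDiff_cutoff_zero.differentiable_iteratedDeriv k (by exact_mod_cast
    (WithTop.coe_lt_top (k : ℕ))))
  simp only [cutoff]
  rw [iteratedDeriv_succ]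
  exact (this s).hasDerivAt

theorem continuous_cutoff (k : ℕ) : Continuous (cutoff k) :=
  continuous_iff_continuousAt.2 fun s => (hasDerivAt_cutoff k s).continuousAt

theorem cutoff_zero_apply (s : ℝ) : cutoff 0 s = Real.smoothTransition (1 - s) := by
  simp [cutoff]

theorem cutoff_zero_nonneg (s : ℝ) : 0 ≤ cutoff 0 s := by
  rw [cutoff_zero_apply]; exact Real.smoothTransition.nonneg _

theorem cutoff_zero_le_one (s : ℝ) : cutoff 0 s ≤ 1 := by
  rw [cutoff_zero_apply]; exact Real.smoothTransition.le_one _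

theorem cutoff_zero_of_nonpos {s : ℝ} (hs : s ≤ 0) : cutoff 0 s = 1 := by
  rw [cutoff_zero_apply]; exact Real.smoothTransition.one_of_one_le (by linarith)

theorem cutoff_of_one_le (k : ℕ) {s : ℝ} (hs : 1 ≤ s) : cutoff k s = 0 := by
  have key : ∀ s ∈ Set.Ioi (1 : ℝ), cutoff k s = 0 := by
    induction k with
    | zero =>
      intro s hs
      rw [cutoff_zero_apply]
      exact Real.smoothTransition.zero_of_nonpos (by linarith [Set.mem_Ioi.1 hs])
    | succ k ih =>
      intro s hs
      have h1 : cutoff k =ᶠ[nhds s] fun _ => 0 :=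
        Filter.eventuallyEq_of_mem (isOpen_Ioi.mem_nhds hs) ih
      exact (hasDerivAt_cutoff k s).unique ((hasDerivAt_const s (0 : ℝ)).congr_of_eventuallyEq h1)
  have hcl : IsClosed {s | cutoff k s = 0} := isClosed_eq (continuous_cutoff k) continuous_const
  have : closure (Set.Ioi (1 : ℝ)) ⊆ {s | cutoff k s = 0} := closure_minimal key hcl
  rw [closure_Ioi] at this
  exact this hs

theorem cutoff_succ_of_neg (k : ℕ) {s : ℝ} (hs : s < 0) : cutoff (k + 1) s = 0 := by
  induction k generalizing s with
  | zero =>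
    have h1 : cutoff 0 =ᶠ[nhds s] fun _ => 1 :=
      Filter.eventuallyEq_of_mem (isOpen_Iio.mem_nhds hs) fun x hx =>
        cutoff_zero_of_nonpos (le_of_lt hx)
    exact (hasDerivAt_cutoff 0 s).unique ((hasDerivAt_const s (1 : ℝ)).congr_of_eventuallyEq h1)
  | succ k ih =>
    have h1 : cutoff (k + 1) =ᶠ[nhds s] fun _ => 0 :=
      Filter.eventuallyEq_of_mem (isOpen_Iio.mem_nhds hs) fun x hx => ih hx
    exact (hasDerivAt_cutoff (k + 1) s).unique
      ((hasDerivAt_const s (0 : ℝ)).congr_of_eventuallyEq h1)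

theorem exists_abs_cutoff_le (k : ℕ) : ∃ C, ∀ s, |cutoff k s| ≤ C := by
  cases k with
  | zero =>
    exact ⟨1, fun s => by rw [abs_of_nonneg (cutoff_zero_nonneg s)]; exact cutoff_zero_le_one s⟩
  | succ k =>
    obtain ⟨C, hC⟩ := isCompact_Icc.exists_bound_of_continuousOn (s := Set.Icc (0 : ℝ) 1)
      (continuous_cutoff (k + 1)).continuousOn
    refine ⟨|C|, fun s => ?_⟩
    rcases lt_or_ge s 0 with h | h
    · rw [cutoff_succ_of_neg k h]; simp
    rcases le_or_gt s 1 with h' | h'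
    · exact (hC s ⟨h, h'⟩).trans (le_abs_self C)
    · rw [cutoff_of_one_le _ h'.le]; simp

/-- The primitive of the squared derivative of the step which vanishes for `s ≥ 1`. -/
def cutoffEnergy (s : ℝ) : ℝ := ∫ τ in (1 : ℝ)..s, cutoff 1 τ ^ 2

theorem continuous_cutoff_one_sq : Continuous fun τ => cutoff 1 τ ^ 2 := (continuous_cutoff 1).pow 2

theorem hasDerivAt_cutoffEnergy (s : ℝ) : HasDerivAt cutoffEnergy (cutoff 1 s ^ 2) s :=
  intervalIntegral.integral_hasDerivAt_right
    (continuous_cutoff_one_sq.intervalIntegrable _ _)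
    (continuous_cutoff_one_sq.stronglyMeasurableAtFilter _ _)
    continuous_cutoff_one_sq.continuousAt

theorem cutoffEnergy_of_one_le {s : ℝ} (hs : 1 ≤ s) : cutoffEnergy s = 0 := by
  unfold cutoffEnergy
  rw [intervalIntegral.integral_congr (g := fun _ => 0)]
  · simp
  · intro τ hτ
    rw [Set.uIcc_of_le hs] at hτ
    simp [cutoff_of_one_le 1 hτ.1]

theorem exists_abs_cutoffEnergy_le : ∃ C, ∀ s, |cutoffEnergy s| ≤ C := by
  have hc : Continuous cutoffEnergy :=
    continuous_iff_continuousAt.2 fun s => (hasDerivAt_cutoffEnergy s).continuousAt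
  -- The left end is `-1` and not `0` because the derivative of the step is known to vanish only at
  -- strictly negative arguments.
  obtain ⟨C, hC⟩ := isCompact_Icc.exists_bound_of_continuousOn (s := Set.Icc (-1 : ℝ) 1)
    hc.continuousOn
  refine ⟨|C|, fun s => ?_⟩
  rcases le_or_gt (-1) s with h | h
  · rcases le_or_gt s 1 with h' | h'
    · exact (hC s ⟨h, h'⟩).trans (le_abs_self C)
    · rw [cutoffEnergy_of_one_le h'.le]; simp
  · have : cutoffEnergy s = cutoffEnergy (-1) := by
      unfold cutoffEnergy
      rw [← intervalIntegral.integral_add_adjacent_intervals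
        (continuous_cutoff_one_sq.intervalIntegrable 1 (-1))
        (continuous_cutoff_one_sq.intervalIntegrable (-1) s)]
      rw [intervalIntegral.integral_congr (a := -1) (b := s) (g := fun _ => 0)]
      · simp
      · intro τ hτ
        rw [Set.uIcc_of_ge h.le] at hτ
        simp [cutoff_succ_of_neg 0 (lt_of_le_of_lt hτ.2 (by norm_num : (-1 : ℝ) < 0))]
    rw [this]
    exact (hC (-1) (by norm_num)).trans (le_abs_self C)

theorem contDiffAt_logX (i : ℕ) {t : ℝ} (ht : 0 < t) : ContDiffAt ℝ ∞ (logX i) t := by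
  induction i with
  | zero =>
    have : logX 0 = fun t => Real.exp (-t) := rfl
    rw [this]
    exact (Real.contDiff_exp.comp contDiff_neg).contDiffAt
  | succ i ih =>
    have : logX (i + 1) = fun t => (1 - Real.log (logX i t))⁻¹ := rfl
    rw [this]
    refine (contDiffAt_const.sub (ih.log (logX_pos i ht).ne')).inv ?_
    have := one_sub_log_X_ge_one i (Real.exp_pos (-t)) (exp_neg_le_one ht)
    simp only [logX]
    linarith

theorem one_le_neg_log_logX (i : ℕ) {t : ℝ} (ht : 0 < t) : 1 ≤ 1 - Real.log (logX i t) :=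
  one_sub_log_X_ge_one i (Real.exp_pos (-t)) (exp_neg_le_one ht)

theorem eventually_hasDerivAt_log_logX (i : ℕ) {t : ℝ} (ht : 0 < t) :
    ∀ᶠ x in nhds t, HasDerivAt (fun t => -Real.log (logX i t)) (logXprod i x) x := by
  filter_upwards [isOpen_Ioi.mem_nhds ht] with x hx
  have := ((hasDerivAt_logX i hx).log (logX_pos i hx).ne').neg
  refine this.congr_deriv ?_
  have := (logX_pos i hx).ne'
  field_simp

theorem logXprod_le_inv {i : ℕ} (hi : 1 ≤ i) {t : ℝ} (ht : 0 < t) : logXprod i t ≤ 1 / (1 + t) := by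
  rw [one_div, ← logX_one]
  exact Xprod_le_X_one hi (Real.exp_pos _) (exp_neg_le_one ht)

/-- `1 - log X_j` has derivative `Y_j ≤ 1/(1+t)`, which is a symbol by induction; since `1 - log X_j
≥ 1` its reciprocal `X_{j+1}` is again a symbol. The induction starts at `X_1 = 1/(1+t)`, because
`X_0 = exp (-t)` does not gain a factor `1/(1+t)` under differentiation. -/
theorem isSymbol_logX {i : ℕ} (hi : 1 ≤ i) :
    IsSymbol (fun t : Set.Ioi (0 : ℝ) => (t : ℝ)) (fun t => 1 + (t : ℝ))
      (fun t => logX i t) (fun _ => logX i) := by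
  induction i using Nat.strong_induction_on with
  | _ i ih =>
  have hρ : ∀ t : Set.Ioi (0 : ℝ), 0 < 1 + (t : ℝ) := fun t => by
    have := Set.mem_Ioi.1 t.2; linarith
  have hinv : ∀ {a : Set.Ioi (0 : ℝ) → ℝ → ℝ} {V : Set.Ioi (0 : ℝ) → ℝ},
      IsSymbol (fun t : Set.Ioi (0 : ℝ) => (t : ℝ)) (fun t => 1 + (t : ℝ)) V a →
      (∀ t, 0 < V t) → (∀ t, V t ≤ a t t) → IsSymbol (fun t : Set.Ioi (0 : ℝ) => (t : ℝ))
      (fun t => 1 + (t : ℝ)) (fun t => (V t)⁻¹) (fun t x => (a t x)⁻¹) := by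
    intro a V ha hV hVa
    have := ha.rpow hV 1 one_pos (fun t => by simpa using hVa t) (-1)
    simpa only [Real.rpow_neg_one] using this
  rcases Nat.lt_or_ge i 2 with h2 | h2
  · have : i = 1 := by omega
    subst this
    have h1 : IsSymbol (fun t : Set.Ioi (0 : ℝ) => (t : ℝ)) (fun t => 1 + (t : ℝ))
        (fun t => 1 + (t : ℝ)) (fun _ t => 1 + t) := by
      refine IsSymbol.of_hasDerivAt (a' := fun _ _ => 1)
        (fun t => (contDiff_const.add contDiff_id).contDiffAt) 1 (fun t => ?_) (fun t => ?_) ?_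
      · rw [Real.norm_of_nonneg (hρ t).le, one_mul]
      · exact Filter.Eventually.of_forall fun x => by simpa using (hasDerivAt_id x).const_add 1
      · exact IsSymbol.const _ 1 fun t => by rw [div_self (hρ t).ne']; simp
    have := hinv h1 hρ (fun t => le_rfl)
    simp only [logX_one]
    convert this using 2
    funext x; exact logX_one x
  · obtain ⟨j, rfl⟩ : ∃ j, i = j + 1 := ⟨i - 1, by omega⟩
    have hY := IsSymbol.prod (Finset.Icc 1 j) (fun k hk => ih k (by
      have := (Finset.mem_Icc.1 hk).2; omega) (Finset.mem_Icc.1 hk).1)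
    have hℓ : IsSymbol (fun t : Set.Ioi (0 : ℝ) => (t : ℝ)) (fun t => 1 + (t : ℝ))
        (fun t => 1 - Real.log (logX j t)) (fun _ t => 1 - Real.log (logX j t)) := by
      refine IsSymbol.of_hasDerivAt (a' := fun _ => logXprod j)
        (fun t => contDiffAt_const.sub ((contDiffAt_logX j t.2).log (logX_pos j t.2).ne'))
        1 (fun t => ?_) (fun t => ?_) ?_
      · have := one_le_neg_log_logX j t.2
        rw [Real.norm_of_nonneg (by linarith), one_mul]
      · filter_upwards [eventually_hasDerivAt_log_logX j t.2] with x hx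
        simpa [sub_eq_add_neg] using hx.const_add 1
      · refine IsSymbol.mono (W := fun t : Set.Ioi (0 : ℝ) => logXprod j t) hY hρ
          (fun t => (logXprod_pos j t.2).le) 1 fun t => ?_
        rw [one_mul]
        exact (logXprod_le_inv (by omega) t.2).trans
          (div_le_div_of_nonneg_right (one_le_neg_log_logX j t.2) (hρ t).le)
    exact hinv hℓ (fun t => lt_of_lt_of_le one_pos (one_le_neg_log_logX j t.2)) (fun t => le_rfl)

theorem isSymbol_logXprod (i : ℕ) :
    IsSymbol (fun t : Set.Ioi (0 : ℝ) => (t : ℝ)) (fun t => 1 + (t : ℝ))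
      (fun t => logXprod i t) (fun _ => logXprod i) :=
  IsSymbol.prod (Finset.Icc 1 i) (fun _ hk => isSymbol_logX (Finset.mem_Icc.1 hk).1)

/-- The truncated optimiser of the one-dimensional problem, in the variable `t = -log s`. -/
def profile (r M : ℕ) (t : ℝ) : ℝ :=
  logXprod r t ^ (-(1 / 2) : ℝ) * cutoff 0 (-Real.log (logX r t) - M)

/-- The index is a pair `(t, M)`, so that the constants do not depend on the position `M` of the
cut-off. -/
theorem isSymbol_profile {r : ℕ} (hr : 1 ≤ r) :
    IsSymbol (fun i : Set.Ioi (0 : ℝ) × ℕ => (i.1 : ℝ)) (fun i => 1 + (i.1 : ℝ))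
      (fun i => logXprod r i.1 ^ (-(1 / 2) : ℝ)) (fun i => profile r i.2) := by
  have hρ : ∀ t : Set.Ioi (0 : ℝ), 0 < 1 + (t : ℝ) := fun t => by
    have := Set.mem_Ioi.1 t.2; linarith
  have h1 := (((isSymbol_logXprod r).rpow (fun t => logXprod_pos r t.2) 1 one_pos
    (fun t => by simp) (-(1 / 2))).reindex (Prod.fst : Set.Ioi (0 : ℝ) × ℕ → Set.Ioi (0 : ℝ)))
  have h2 : IsSymbol (fun i : Set.Ioi (0 : ℝ) × ℕ => (i.1 : ℝ)) (fun i => 1 + (i.1 : ℝ))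
      (fun _ => 1) (fun i x => cutoff 0 (-Real.log (logX r x) - i.2)) := by
    -- The inner function `-log X_r` is unbounded; only its derivative `Y_r ≤ 1/(1+t)` has to be a
    -- symbol.
    refine IsSymbol.comp_bounded (a := fun _ x => -Real.log (logX r x))
      (χ := fun k (i : Set.Ioi (0 : ℝ) × ℕ) s => cutoff k (s - i.2)) (fun i => ?_) ?_ (fun k i s => ?_) (fun k => ?_) 0
    · exact ((contDiffAt_logX r i.1.2).log (logX_pos r i.1.2).ne').neg
    · have h4 := (isSymbol_logXprod r).mono
        (W' := fun t : Set.Ioi (0 : ℝ) => 1 / (1 + (t : ℝ))) hρ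
        (fun t => (logXprod_pos r t.2).le) 1
        (fun t => by rw [one_mul]; exact logXprod_le_inv hr t.2)
      exact (h4.reindex (Prod.fst : Set.Ioi (0 : ℝ) × ℕ → Set.Ioi (0 : ℝ))).fderiv_of_hasDerivAt
        fun i => eventually_hasDerivAt_log_logX r i.1.2
    · exact (hasDerivAt_cutoff k (s - i.2)).comp_sub_const s (i.2 : ℝ)
    · obtain ⟨C, hC⟩ := exists_abs_cutoff_le k
      exact ⟨C, fun i s => hC _⟩
  have h3 := IsSymbol.mul h1 h2
  simp only [mul_one] at h3
  exact h3

end OneDimensionalSymbols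

/-! ### The polynomial `∏ (β_k - λ)` and the constants `A(m)`, `B(m)` -/

section EulerOperator

/-- Coefficients of the polynomial `∏_{k < i} (β k - λ)`. -/
def opCoeff (β : ℕ → ℝ) : ℕ → ℕ → ℝ
  | 0, j => if j = 0 then 1 else 0
  | i + 1, 0 => β i * opCoeff β i 0
  | i + 1, j + 1 => β i * opCoeff β i (j + 1) - opCoeff β i j

theorem opCoeff_eq_zero (β : ℕ → ℝ) {i j : ℕ} (h : i < j) : opCoeff β i j = 0 := by
  induction i generalizing j with
  | zero => simp [opCoeff]; omega
  | succ i ih =>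
    obtain ⟨j, rfl⟩ : ∃ k, j = k + 1 := ⟨j - 1, by omega⟩
    rw [opCoeff, ih (by omega), ih (by omega)]
    ring

theorem opCoeff_zero_right (β : ℕ → ℝ) (i : ℕ) :
    opCoeff β i 0 = ∏ k ∈ Finset.range i, β k := by
  induction i with
  | zero => simp [opCoeff]
  | succ i ih => rw [opCoeff, ih, Finset.prod_range_succ]; ring

/-- This compares the coefficients of `λ²` in `P(λ) P(-λ) = ∏ (β_k² - λ²)`, where `P(λ) = ∏ (β_k -
λ)`. -/
theorem opCoeff_discriminant {β : ℕ → ℝ} (i : ℕ) (hβ : ∀ k < i, β k ≠ 0) :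
    opCoeff β i 1 ^ 2 - 2 * opCoeff β i 0 * opCoeff β i 2 =
      (∏ k ∈ Finset.range i, β k ^ 2) * ∑ k ∈ Finset.range i, 1 / β k ^ 2 := by
  induction i with
  | zero => simp [opCoeff]
  | succ i ih =>
    have hb := hβ i (by omega)
    have hP : ∏ k ∈ Finset.range i, β k ^ 2 = opCoeff β i 0 ^ 2 := by
      rw [Finset.prod_pow, opCoeff_zero_right]
    have h1 : β i ^ 2 * (1 / β i ^ 2) = 1 := by field_simp
    have ih' := ih fun k hk => hβ k (by omega)
    rw [Finset.prod_range_succ, Finset.sum_range_succ]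
    simp only [opCoeff]
    linear_combination β i ^ 2 * ih' - hP - (∏ k ∈ Finset.range i, β k ^ 2) * h1

/-- The differential polynomial with coefficients `opCoeff` applied to a chain of derivatives. -/
def opApply (β : ℕ → ℝ) (v : ℕ → ℝ → ℝ) (i : ℕ) (t : ℝ) : ℝ :=
  ∑ j ∈ Finset.range (i + 1), opCoeff β i j * v j t

theorem opApply_succ (β : ℕ → ℝ) (v : ℕ → ℝ → ℝ) (i : ℕ) (t : ℝ) :
    opApply β v (i + 1) t = β i * opApply β v i t -
      ∑ j ∈ Finset.range (i + 1), opCoeff β i j * v (j + 1) t := by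
  rw [opApply, Finset.sum_range_succ']
  simp only [opCoeff, sub_mul, Finset.sum_sub_distrib]
  have h1 : opApply β v i t = ∑ j ∈ Finset.range (i + 1), opCoeff β i (j + 1) * v (j + 1) t +
      opCoeff β i 0 * v 0 t := by
    rw [Finset.sum_range_succ, opCoeff_eq_zero β (Nat.lt_succ_self i), opApply,
      Finset.sum_range_succ']
    ring
  rw [h1, mul_add, Finset.mul_sum]
  simp only [mul_assoc]
  ring

/-- Equivalent to `opApply (i + 1) = (β_i - d/dt) (opApply i)`, the recursion that matches one more
derivative in `s`. -/
theorem hasDerivAt_opApply (β : ℕ → ℝ) {v : ℕ → ℝ → ℝ} {t : ℝ}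
    (hv : ∀ j, HasDerivAt (v j) (v (j + 1) t) t) (i : ℕ) :
    HasDerivAt (opApply β v i) (β i * opApply β v i t - opApply β v (i + 1) t) t := by
  rw [opApply_succ]
  refine (HasDerivAt.fun_sum (u := Finset.range (i + 1))
    fun j _ => (hv j).const_mul (opCoeff β i j)).congr_deriv ?_
  ring

theorem opApply_eq (β : ℕ → ℝ) (v : ℕ → ℝ → ℝ) (i : ℕ) (t : ℝ) :
    opApply β v i t = opCoeff β i 0 * v 0 t + opCoeff β i 1 * v 1 t + opCoeff β i 2 * v 2 t +
      ∑ j ∈ Finset.range i, opCoeff β i (j + 3) * v (j + 3) t := by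
  have : opApply β v i t = ∑ j ∈ Finset.range (i + 3), opCoeff β i j * v j t := by
    rw [Finset.sum_range_succ, Finset.sum_range_succ, opCoeff_eq_zero β (by omega : i < i + 2),
      opCoeff_eq_zero β (by omega : i < i + 1), opApply]
    ring
  rw [this, Finset.sum_range_succ', Finset.sum_range_succ', Finset.sum_range_succ']
  ring

/-- The exponents `m - 1/2, m - 3/2, …`. -/
def halfInt (m k : ℕ) : ℝ := m - 1 / 2 - k

theorem halfInt_ne_zero (m k : ℕ) : halfInt m k ≠ 0 := by
  unfold halfInt
  intro h
  have h1 : (2 * (m : ℤ) - 1 - 2 * k : ℤ) = 0 := by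
    have : (2 * (m : ℝ) - 1 - 2 * k : ℝ) = 0 := by linarith
    exact_mod_cast this
  omega

theorem two_mul_halfInt_reflect {m k : ℕ} (hk : k < m) :
    2 * halfInt m (m - 1 - k) = 2 * ((k + 1 : ℕ) : ℝ) - 1 := by
  unfold halfInt
  rw [Nat.cast_sub (by omega), Nat.cast_sub (by omega)]
  push_cast
  ring

theorem Ico_zero_shift (m : ℕ) : Finset.Ico (0 + 1) (m + 1) = Finset.Icc 1 m := by
  ext k
  simp only [Finset.mem_Ico, Finset.mem_Icc]
  omega

/-- For `k < m` the numbers `2 (m - 1/2 - k)` are the odd numbers up to `2m - 1` in reverse order.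
-/
theorem A_eq (m : ℕ) : A m = opCoeff (halfInt m) m 0 ^ 2 := by
  have h1 : ∏ k ∈ Finset.Ico 0 m, halfInt m (m - 1 - k) ^ 2 =
      ∏ k ∈ Finset.Ico 0 m, (2 * ((k + 1 : ℕ) : ℝ) - 1) ^ 2 / 4 := by
    refine Finset.prod_congr rfl fun k hk => ?_
    rw [← two_mul_halfInt_reflect (Finset.mem_Ico.1 hk).2]
    ring
  rw [opCoeff_zero_right, ← Finset.prod_range_reflect, ← Finset.prod_pow, A,
    Finset.range_eq_Ico, h1, Finset.prod_div_distrib, Finset.prod_const,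
    Finset.prod_Ico_add' (fun k : ℕ => (2 * (k : ℝ) - 1) ^ 2), Ico_zero_shift]
  simp

/-- `B(m) = A(m) ∑ (2k-1)⁻²`, and the discriminant is `∏ β_k² · ∑ β_k⁻²` with `β_k` running through
the halves of the odd numbers. -/
theorem B_eq (m : ℕ) :
    opCoeff (halfInt m) m 1 ^ 2 - 2 * opCoeff (halfInt m) m 0 * opCoeff (halfInt m) m 2 =
      4 * B m := by
  have hB : B m = A m * ∑ k ∈ Finset.Icc 1 m, 1 / (2 * (k : ℝ) - 1) ^ 2 := by
    rw [B, A, Finset.mul_sum, Finset.mul_sum]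
    refine Finset.sum_congr rfl fun k hk => ?_
    rw [← Finset.mul_prod_erase _ _ hk]
    have : (1 : ℝ) ≤ k := by exact_mod_cast (Finset.mem_Icc.1 hk).1
    have : (2 * (k : ℝ) - 1) ≠ 0 := by linarith
    field_simp
  have h1 : ∑ k ∈ Finset.Ico 0 m, 1 / halfInt m (m - 1 - k) ^ 2 =
      ∑ k ∈ Finset.Ico 0 m, 4 * (1 / (2 * ((k + 1 : ℕ) : ℝ) - 1) ^ 2) := by
    refine Finset.sum_congr rfl fun k hk => ?_
    rw [← two_mul_halfInt_reflect (Finset.mem_Ico.1 hk).2]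
    have := halfInt_ne_zero m (m - 1 - k)
    field_simp
    norm_num
  rw [opCoeff_discriminant m fun k _ => halfInt_ne_zero m k, Finset.prod_pow, ← opCoeff_zero_right,
    ← A_eq, hB, ← Finset.sum_range_reflect, Finset.range_eq_Ico, h1, ← Finset.mul_sum,
    Finset.sum_Ico_add' (fun k : ℕ => 1 / (2 * (k : ℝ) - 1) ^ 2), Ico_zero_shift]
  ring

theorem A_nonneg (m : ℕ) : 0 ≤ A m := by rw [A_eq]; positivity

theorem B_nonneg (m : ℕ) : 0 ≤ B m := by
  unfold B
  exact mul_nonneg (by positivity) (Finset.sum_nonneg fun i _ => Finset.prod_nonneg fun k _ =>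
    sq_nonneg _)

end EulerOperator

/-! ### The energy density of the profile, up to a total derivative -/

section ProfileEstimates

theorem hasDerivAt_iteratedDeriv_profile {r : ℕ} (hr : 1 ≤ r) (M j : ℕ) {t : ℝ} (ht : 0 < t) :
    HasDerivAt (iteratedDeriv j (profile r M)) (iteratedDeriv (j + 1) (profile r M) t) t := by
  have := ((isSymbol_profile hr).iteratedDeriv j).smooth (⟨t, ht⟩, M)
  rw [iteratedDeriv_succ]
  exact (this.differentiableAt (by simp)).hasDerivAt

theorem exists_iteratedDeriv_profile_le {r : ℕ} (hr : 1 ≤ r) (j : ℕ) : ∃ C, 0 ≤ C ∧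
    ∀ (M : ℕ) (t : ℝ), 0 < t →
      |iteratedDeriv j (profile r M) t| ≤ C * (logXprod r t ^ (-(1 / 2) : ℝ) / (1 + t) ^ j) := by
  obtain ⟨C, hC⟩ := ((isSymbol_profile hr).iteratedDeriv j).value
  refine ⟨|C|, abs_nonneg C, fun M t ht => (hC (⟨t, ht⟩, M)).trans ?_⟩
  refine mul_le_mul_of_nonneg_right (le_abs_self C) ?_
  have := logXprod_pos r ht
  have : 0 < 1 + t := by linarith
  positivity

theorem iteratedDeriv_profile_eq_zero {r M : ℕ} (j : ℕ) {t : ℝ} (ht : 0 < t)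
    (h : M + 1 < -Real.log (logX r t)) : iteratedDeriv j (profile r M) t = 0 := by
  have hc : ContinuousAt (fun t => -Real.log (logX r t)) t :=
    ((contDiffAt_logX r ht).continuousAt.log (logX_pos r ht).ne').neg
  have he : profile r M =ᶠ[nhds t] fun _ => 0 := by
    filter_upwards [hc.eventually (lt_mem_nhds h)] with x hx
    rw [profile, cutoff_of_one_le 0 (by linarith), mul_zero]
  rw [he.iteratedDeriv_eq]
  simp

/-- `Y_r^(-1/2)` contributes its logarithmic derivative `σ`. The cut-off contributes `Y_r^(-1/2) χ'
Y_r`, because `-log X_r` has derivative `Y_r`. -/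
theorem hasDerivAt_profile {r M : ℕ} {t : ℝ} (ht : 0 < t) :
    HasDerivAt (profile r M) (logSlope r t * profile r M t +
      logXprod r t ^ (1 / 2 : ℝ) * cutoff 1 (-Real.log (logX r t) - M)) t := by
  have hY := logXprod_pos r ht
  have h1 := (hasDerivAt_logXprod r ht).rpow_const (p := -(1 / 2)) (Or.inl hY.ne')
  have h2 := (hasDerivAt_cutoff 0 (-Real.log (logX r t) - M)).comp t
    ((eventually_hasDerivAt_log_logX r ht).self_of_nhds.sub_const (M : ℝ))
  refine (h1.mul h2).congr_deriv ?_
  simp only [Function.comp_apply, profile, logSlope]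
  have e1 : logXprod r t ^ (-(1 / 2) - 1 : ℝ) = logXprod r t ^ (-(1 / 2) : ℝ) / logXprod r t :=
    Real.rpow_sub_one hY.ne' _
  have e2 : logXprod r t ^ (1 / 2 : ℝ) = logXprod r t ^ (-(1 / 2) : ℝ) * logXprod r t := by
    rw [← Real.rpow_add_one hY.ne']; norm_num
  rw [e1, e2]
  field_simp

theorem contDiff_cutoffEnergy : ContDiff ℝ 1 cutoffEnergy := by
  refine contDiff_one_iff_deriv.2 ⟨fun s => (hasDerivAt_cutoffEnergy s).differentiableAt, ?_⟩
  rw [show deriv cutoffEnergy = fun s => cutoff 1 s ^ 2 from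
    funext fun s => (hasDerivAt_cutoffEnergy s).deriv]
  exact continuous_cutoff_one_sq

/-- In the square of `Q_0 v + Q_1 v' + Q_2 v'' + ⋯` use `2 v v' = (v²)'` and `v v'' = (v v')' -
v'²`; what remains below total order three is `Q_0² v² + (Q_1² - 2 Q_0 Q_2) v'² = A v² + 4B v'²`.
Then `v'² = (v' - σ v)² + (σ v²)' - (σ' + σ²) v²`. By the Riccati equation the last term is `¼ ∑
Y_j² v²`, and `(v' - σ v)² = Y_r χ'²` is the derivative of `cutoffEnergy (-log X_r - M)`. So `p`
collects four primitives, and the error consists of products of total order at least three. -/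
theorem exists_profile_flux {m r : ℕ} (hr : 1 ≤ r) :
    ∃ (p p' : ℕ → ℝ → ℝ) (C : ℝ), 0 ≤ C ∧ ∀ (M : ℕ) (t : ℝ), 0 < t →
      ContDiffAt ℝ 1 (p M) t ∧ HasDerivAt (p M) (p' M t) t ∧ |p M t| ≤ C * (logXprod r t)⁻¹ ∧
      |p' M t| ≤ C * (logXprod r t)⁻¹ ∧ (M + 1 < -Real.log (logX r t) → p M t = 0) ∧
      |opApply (halfInt m) (fun j => iteratedDeriv j (profile r M)) m t ^ 2 -
        (A m * profile r M t ^ 2 + B m * (∑ j ∈ Finset.Icc 1 r, logXprod j t ^ 2) *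
          profile r M t ^ 2) - p' M t| ≤ C * ((logXprod r t)⁻¹ / (1 + t) ^ 3) := by
  choose D hD0 hD using fun j => exists_iteratedDeriv_profile_le hr j
  obtain ⟨Cχ, hCχ⟩ := exists_abs_cutoff_le 1
  obtain ⟨CK, hCK⟩ := exists_abs_cutoffEnergy_le
  have hB := B_nonneg m
  set Q := opCoeff (halfInt m) m with hQ
  let v : ℕ → ℕ → ℝ → ℝ := fun M j => iteratedDeriv j (profile r M)
  let Λ : ℝ → ℝ := fun t => -Real.log (logX r t)
  -- The primitives of the terms with coefficients `2 Q_0 Q_1`, `2 Q_0 Q_2` and `4B`; the last one,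
  -- normalised to vanish for arguments at least `1`, makes `p` vanish wherever the cut-off has
  -- removed `v`.
  let p : ℕ → ℝ → ℝ := fun M t => Q 0 * Q 1 * v M 0 t ^ 2 + 2 * Q 0 * Q 2 * (v M 0 t * v M 1 t) +
    4 * B m * (logSlope r t * v M 0 t ^ 2) + 4 * B m * cutoffEnergy (Λ t - M)
  let p' : ℕ → ℝ → ℝ := fun M t => Q 0 * Q 1 * (2 * (v M 0 t * v M 1 t)) +
    2 * Q 0 * Q 2 * (v M 1 t * v M 1 t + v M 0 t * v M 2 t) +
    4 * B m * ((-(logSlope r t ^ 2) - (1 / 4) * ∑ j ∈ Finset.Icc 1 r, logXprod j t ^ 2) *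
      v M 0 t ^ 2 + logSlope r t * (2 * (v M 0 t * v M 1 t))) +
    4 * B m * (logXprod r t * cutoff 1 (Λ t - M) ^ 2)
  have hv0 : ∀ M t, v M 0 t = profile r M t := fun M t => by simp [v]
  have hvd : ∀ M j t, 0 < t → HasDerivAt (v M j) (v M (j + 1) t) t := fun M j t ht =>
    hasDerivAt_iteratedDeriv_profile hr M j ht
  -- products of derivatives
  have hvv : ∀ i j M t, 0 < t →
      |v M i t * v M j t| ≤ D i * D j * ((logXprod r t)⁻¹ / (1 + t) ^ (i + j)) := by
    intro i j M t ht
    have hY := logXprod_pos r ht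
    have h1t : 0 < 1 + t := by linarith
    rw [abs_mul]
    refine (mul_le_mul (hD i M t ht) (hD j M t ht) (abs_nonneg _) ?_).trans (le_of_eq ?_)
    · have := hD0 i; positivity
    · have : (logXprod r t)⁻¹ = logXprod r t ^ (-(1 / 2) : ℝ) * logXprod r t ^ (-(1 / 2) : ℝ) := by
        rw [← Real.rpow_add hY, ← Real.rpow_neg_one]; norm_num
      rw [this, pow_add]
      field_simp
  have hvv0 : ∀ i j M t, 0 < t → |v M i t * v M j t| ≤ D i * D j * (logXprod r t)⁻¹ := by
    intro i j M t ht
    have hY := inv_pos.2 (logXprod_pos r ht)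
    refine (hvv i j M t ht).trans (mul_le_mul_of_nonneg_left ?_ (mul_nonneg (hD0 i) (hD0 j)))
    exact div_le_self hY.le (one_le_pow₀ (by linarith))
  have hvv3 : ∀ i j M t, 3 ≤ i + j → 0 < t →
      |v M i t * v M j t| ≤ D i * D j * ((logXprod r t)⁻¹ / (1 + t) ^ 3) := by
    intro i j M t hij ht
    have hY := inv_pos.2 (logXprod_pos r ht)
    refine (hvv i j M t ht).trans (mul_le_mul_of_nonneg_left ?_ (mul_nonneg (hD0 i) (hD0 j)))
    exact div_le_div_of_nonneg_left hY.le (by positivity) (pow_le_pow_right₀ (by linarith) hij)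
  have hσ : ∀ t, 0 < t → |logSlope r t| ≤ r := by
    intro t ht
    have h1 : ∑ j ∈ Finset.Icc 1 r, logXprod j t ≤ ∑ _j ∈ Finset.Icc 1 r, (1 : ℝ) :=
      Finset.sum_le_sum fun j _ => logXprod_le_one j ht
    have h2 : 0 ≤ ∑ j ∈ Finset.Icc 1 r, logXprod j t :=
      Finset.sum_nonneg fun j _ => (logXprod_pos j ht).le
    simp only [Finset.sum_const, Nat.card_Icc, Nat.add_sub_cancel, nsmul_eq_mul, mul_one] at h1
    rw [abs_le]; unfold logSlope
    constructor <;> linarith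
  have hS : ∀ t, 0 < t → |∑ j ∈ Finset.Icc 1 r, logXprod j t ^ 2| ≤ r := by
    intro t ht
    have h1 : ∑ j ∈ Finset.Icc 1 r, logXprod j t ^ 2 ≤ ∑ _j ∈ Finset.Icc 1 r, (1 : ℝ) :=
      Finset.sum_le_sum fun j _ => pow_le_one₀ (logXprod_pos j ht).le (logXprod_le_one j ht)
    have h2 : 0 ≤ ∑ j ∈ Finset.Icc 1 r, logXprod j t ^ 2 :=
      Finset.sum_nonneg fun j _ => sq_nonneg _
    simp only [Finset.sum_const, Nat.card_Icc, Nat.add_sub_cancel, nsmul_eq_mul, mul_one] at h1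
    rw [abs_le]
    constructor <;> linarith
  have hmul : ∀ c x K y : ℝ, |x| ≤ K * y → |c * x| ≤ |c| * K * y := by
    intro c x K y h
    rw [abs_mul, mul_assoc]
    exact mul_le_mul_of_nonneg_left h (abs_nonneg c)
  let E : ℕ → ℝ := fun i => ∑ j ∈ Finset.range m, |Q (j + 3)| * (D (j + 3) * D i)
  have hE0 : ∀ i, 0 ≤ E i := fun i => Finset.sum_nonneg fun j _ =>
    mul_nonneg (abs_nonneg _) (mul_nonneg (hD0 _) (hD0 _))
  let R : ℕ → ℝ → ℝ := fun M t => ∑ j ∈ Finset.range m, Q (j + 3) * v M (j + 3) t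
  have hRv : ∀ i M t, 0 < t → |R M t * v M i t| ≤ E i * ((logXprod r t)⁻¹ / (1 + t) ^ 3) := by
    intro i M t ht
    simp only [R, E, Finset.sum_mul]
    refine (Finset.abs_sum_le_sum_abs _ _).trans (Finset.sum_le_sum fun j _ => ?_)
    rw [mul_assoc]
    exact hmul _ _ _ _ (hvv3 (j + 3) i M t (by omega) ht)
  let F : ℝ := ∑ j ∈ Finset.range m, |Q (j + 3)| * E (j + 3)
  have hF0 : 0 ≤ F := Finset.sum_nonneg fun j _ => mul_nonneg (abs_nonneg _) (hE0 _)
  have hRR : ∀ M t, 0 < t → |R M t * R M t| ≤ F * ((logXprod r t)⁻¹ / (1 + t) ^ 3) := by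
    intro M t ht
    have : R M t * R M t = ∑ j ∈ Finset.range m, Q (j + 3) * (R M t * v M (j + 3) t) := by
      conv_lhs => enter [2]; simp only [R]
      rw [Finset.mul_sum]
      exact Finset.sum_congr rfl fun j _ => by ring
    rw [this]
    simp only [F, Finset.sum_mul]
    exact (Finset.abs_sum_le_sum_abs _ _).trans
      (Finset.sum_le_sum fun j _ => hmul _ _ _ _ (hRv (j + 3) M t ht))
  have hCχ0 : 0 ≤ Cχ := (abs_nonneg _).trans (hCχ 0)
  have hCK0 : 0 ≤ CK := (abs_nonneg _).trans (hCK 0)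
  let C1 := |Q 0 * Q 1| * (D 0 * D 0) + |2 * Q 0 * Q 2| * (D 0 * D 1) +
    |4 * B m| * (r * (D 0 * D 0)) + |4 * B m| * CK
  let C2 := |Q 0 * Q 1 * 2| * (D 0 * D 1) + |2 * Q 0 * Q 2| * (D 1 * D 1) +
    |2 * Q 0 * Q 2| * (D 0 * D 2) + |4 * B m| * (r ^ 2 * (D 0 * D 0)) +
    |B m| * (r * (D 0 * D 0)) + |8 * B m| * (r * (D 0 * D 1)) + |4 * B m| * Cχ ^ 2
  let C3 := |2 * Q 1 * Q 2| * (D 1 * D 2) + |Q 2 ^ 2| * (D 2 * D 2) + |2 * Q 0| * E 0 +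
    |2 * Q 1| * E 1 + |2 * Q 2| * E 2 + F
  have hC1 : 0 ≤ C1 := by have := hD0 0; have := hD0 1; positivity
  have hC2 : 0 ≤ C2 := by have := hD0 0; have := hD0 1; have := hD0 2; positivity
  have hC3 : 0 ≤ C3 := by
    have := hD0 1; have := hD0 2; have := hE0 0; have := hE0 1; have := hE0 2; positivity
  refine ⟨p, p', C1 + C2 + C3, by positivity, fun M t ht => ?_⟩
  have hY := logXprod_pos r ht
  have hYi : 1 ≤ (logXprod r t)⁻¹ := (one_le_inv₀ hY).2 (logXprod_le_one r ht)
  have hZ : 0 ≤ (logXprod r t)⁻¹ / (1 + t) ^ 3 := by positivity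
  have hv1 : v M 1 t = logSlope r t * v M 0 t +
      logXprod r t ^ (1 / 2 : ℝ) * cutoff 1 (Λ t - M) := by
    have h := hasDerivAt_profile (r := r) (M := M) ht
    rw [hv0]
    refine (hvd M 0 t ht).unique (h.congr_of_eventuallyEq (Filter.Eventually.of_forall fun x => ?_))
    exact hv0 M x
  -- The cut-off term is rewritten through `v` and `v'`, so that the final identity is polynomial in
  -- the derivatives of `v`.
  have hχ : logXprod r t * cutoff 1 (Λ t - M) ^ 2 = (v M 1 t - logSlope r t * v M 0 t) ^ 2 := by
    rw [hv1]
    have : logXprod r t = logXprod r t ^ (1 / 2 : ℝ) * logXprod r t ^ (1 / 2 : ℝ) := by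
      rw [← Real.rpow_add hY]; norm_num
    linear_combination (cutoff 1 (Λ t - M) ^ 2) * this
  have hΛ : HasDerivAt Λ (logXprod r t) t := (eventually_hasDerivAt_log_logX r ht).self_of_nhds
  refine ⟨?_, ?_, ?_, ?_, ?_, ?_⟩
  · have s1 : ∀ j, ContDiffAt ℝ 1 (v M j) t := fun j =>
      (((isSymbol_profile hr).iteratedDeriv j).smooth (⟨t, ht⟩, M)).of_le (by simp)
    have s2 : ContDiffAt ℝ 1 (logSlope r) t := contDiffAt_const.mul
      (ContDiffAt.sum fun j _ => ((isSymbol_logXprod j).smooth ⟨t, ht⟩).of_le (by simp))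
    have s3 : ContDiffAt ℝ 1 Λ t :=
      (((contDiffAt_logX r ht).log (logX_pos r ht).ne').neg).of_le (by simp)
    have s4 : ContDiffAt ℝ 1 (fun t => cutoffEnergy (Λ t - M)) t :=
      contDiff_cutoffEnergy.contDiffAt.comp t (s3.sub contDiffAt_const)
    exact (((contDiffAt_const.mul ((s1 0).pow 2)).add
      (contDiffAt_const.mul ((s1 0).mul (s1 1)))).add
      (contDiffAt_const.mul (s2.mul ((s1 0).pow 2)))).add (contDiffAt_const.mul s4)
  · have d0 := hvd M 0 t ht
    have d1 := hvd M 1 t ht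
    have dK := (hasDerivAt_cutoffEnergy (Λ t - M)).comp t (hΛ.sub_const (M : ℝ))
    refine (((((d0.pow 2).const_mul (Q 0 * Q 1)).add ((d0.mul d1).const_mul (2 * Q 0 * Q 2))).add
      (((hasDerivAt_logSlope r ht).mul (d0.pow 2)).const_mul (4 * B m))).add
      (dK.const_mul (4 * B m))).congr_deriv ?_
    simp only [p', Pi.pow_apply]
    push_cast
    ring
  · have b1 := hmul (Q 0 * Q 1) _ _ _ (hvv0 0 0 M t ht)
    have b2 := hmul (2 * Q 0 * Q 2) _ _ _ (hvv0 0 1 M t ht)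
    have b3 : |logSlope r t * (v M 0 t * v M 0 t)| ≤ (r * (D 0 * D 0)) * (logXprod r t)⁻¹ := by
      rw [abs_mul, mul_assoc]
      exact mul_le_mul (hσ t ht) (hvv0 0 0 M t ht) (abs_nonneg _) (Nat.cast_nonneg r)
    have b3' := hmul (4 * B m) _ _ _ b3
    have b4 : |cutoffEnergy (Λ t - M)| ≤ CK * (logXprod r t)⁻¹ :=
      (hCK _).trans (le_mul_of_one_le_right hCK0 hYi)
    have b4' := hmul (4 * B m) _ _ _ b4
    have hle : |p M t| ≤ C1 * (logXprod r t)⁻¹ := by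
      have e : p M t = Q 0 * Q 1 * (v M 0 t * v M 0 t) + 2 * Q 0 * Q 2 * (v M 0 t * v M 1 t) +
        4 * B m * (logSlope r t * (v M 0 t * v M 0 t)) + 4 * B m * cutoffEnergy (Λ t - M) := by
        simp only [p]; ring
      rw [e]
      refine (abs_add_le _ _).trans ((add_le_add ((abs_add_le _ _).trans
        (add_le_add ((abs_add_le _ _).trans (add_le_add b1 b2)) b3')) b4').trans (le_of_eq ?_))
      simp only [C1]; ring
    refine hle.trans (mul_le_mul_of_nonneg_right (by linarith) (by linarith))
  · have b1 := hmul (Q 0 * Q 1 * 2) _ _ _ (hvv0 0 1 M t ht)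
    have b2 := hmul (2 * Q 0 * Q 2) _ _ _ (hvv0 1 1 M t ht)
    have b3 := hmul (2 * Q 0 * Q 2) _ _ _ (hvv0 0 2 M t ht)
    have b4 : |-(logSlope r t ^ 2) * (v M 0 t * v M 0 t)| ≤
        (r ^ 2 * (D 0 * D 0)) * (logXprod r t)⁻¹ := by
      rw [abs_mul, mul_assoc, abs_neg, abs_pow]
      exact mul_le_mul (pow_le_pow_left₀ (abs_nonneg _) (hσ t ht) 2) (hvv0 0 0 M t ht)
        (abs_nonneg _) (by positivity)
    have b4' := hmul (4 * B m) _ _ _ b4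
    have b5 : |-(∑ j ∈ Finset.Icc 1 r, logXprod j t ^ 2) * (v M 0 t * v M 0 t)| ≤
        (r * (D 0 * D 0)) * (logXprod r t)⁻¹ := by
      rw [abs_mul, mul_assoc, abs_neg]
      exact mul_le_mul (hS t ht) (hvv0 0 0 M t ht) (abs_nonneg _) (by positivity)
    have b5' := hmul (B m) _ _ _ b5
    have b6 : |logSlope r t * (v M 0 t * v M 1 t)| ≤ (r * (D 0 * D 1)) * (logXprod r t)⁻¹ := by
      rw [abs_mul, mul_assoc]
      exact mul_le_mul (hσ t ht) (hvv0 0 1 M t ht) (abs_nonneg _) (Nat.cast_nonneg r)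
    have b6' := hmul (8 * B m) _ _ _ b6
    have b7 : |logXprod r t * cutoff 1 (Λ t - M) ^ 2| ≤ Cχ ^ 2 * (logXprod r t)⁻¹ := by
      rw [abs_mul, abs_pow, abs_of_pos hY, mul_comm]
      exact mul_le_mul (pow_le_pow_left₀ (abs_nonneg _) (hCχ _) 2)
        ((logXprod_le_one r ht).trans hYi) hY.le (by positivity)
    have b7' := hmul (4 * B m) _ _ _ b7
    have hle : |p' M t| ≤ C2 * (logXprod r t)⁻¹ := by
      have e : p' M t = Q 0 * Q 1 * 2 * (v M 0 t * v M 1 t) + 2 * Q 0 * Q 2 * (v M 1 t * v M 1 t) +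
        2 * Q 0 * Q 2 * (v M 0 t * v M 2 t) +
        4 * B m * (-(logSlope r t ^ 2) * (v M 0 t * v M 0 t)) +
        B m * (-(∑ j ∈ Finset.Icc 1 r, logXprod j t ^ 2) * (v M 0 t * v M 0 t)) +
        8 * B m * (logSlope r t * (v M 0 t * v M 1 t)) +
        4 * B m * (logXprod r t * cutoff 1 (Λ t - M) ^ 2) := by
        simp only [p']; ring
      rw [e]
      refine (abs_add_le _ _).trans ((add_le_add ((abs_add_le _ _).trans (add_le_add
        ((abs_add_le _ _).trans (add_le_add ((abs_add_le _ _).trans (add_le_add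
        ((abs_add_le _ _).trans (add_le_add ((abs_add_le _ _).trans (add_le_add b1 b2)) b3))
        b4')) b5')) b6')) b7').trans (le_of_eq ?_))
      simp only [C2]; ring
    refine hle.trans (mul_le_mul_of_nonneg_right (by linarith) (by linarith))
  · intro h
    have h0 : v M 0 t = 0 := iteratedDeriv_profile_eq_zero 0 ht h
    have hK : cutoffEnergy (Λ t - M) = 0 := cutoffEnergy_of_one_le (by
      have : (M : ℝ) + 1 < Λ t := h
      linarith)
    simp only [p, h0, hK]
    ring
  · have b1 := hmul (2 * Q 1 * Q 2) _ _ _ (hvv3 1 2 M t (by omega) ht)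
    have b2 := hmul (Q 2 ^ 2) _ _ _ (hvv3 2 2 M t (by omega) ht)
    have b3 := hmul (2 * Q 0) _ _ _ (hRv 0 M t ht)
    have b4 := hmul (2 * Q 1) _ _ _ (hRv 1 M t ht)
    have b5 := hmul (2 * Q 2) _ _ _ (hRv 2 M t ht)
    have b6 := hRR M t ht
    have hw : opApply (halfInt m) (fun j => iteratedDeriv j (profile r M)) m t =
        Q 0 * v M 0 t + Q 1 * v M 1 t + Q 2 * v M 2 t + R M t := opApply_eq _ _ _ _
    have hA := A_eq m
    have hBm := B_eq m
    rw [← hQ] at hA hBm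
    have e : opApply (halfInt m) (fun j => iteratedDeriv j (profile r M)) m t ^ 2 -
        (A m * profile r M t ^ 2 + B m * (∑ j ∈ Finset.Icc 1 r, logXprod j t ^ 2) *
          profile r M t ^ 2) - p' M t = 2 * Q 1 * Q 2 * (v M 1 t * v M 2 t) +
        Q 2 ^ 2 * (v M 2 t * v M 2 t) + 2 * Q 0 * (R M t * v M 0 t) +
        2 * Q 1 * (R M t * v M 1 t) + 2 * Q 2 * (R M t * v M 2 t) + R M t * R M t := by
      rw [hw, ← hv0]
      simp only [p', hχ]
      linear_combination (v M 1 t) ^ 2 * hBm - (v M 0 t) ^ 2 * hA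
    rw [e]
    have hle := (abs_add_le _ _).trans (add_le_add ((abs_add_le _ _).trans (add_le_add
        ((abs_add_le _ _).trans (add_le_add ((abs_add_le _ _).trans (add_le_add
        ((abs_add_le _ _).trans (add_le_add b1 b2)) b3)) b4)) b5)) b6)
    refine (hle.trans (le_of_eq ?_)).trans (mul_le_mul_of_nonneg_right
      (by linarith : C3 ≤ C1 + C2 + C3) hZ)
    simp only [C3]; ring

end ProfileEstimates

/-! ### A convex boundary as the zero level of a concave function -/

section ConvexChart

variable {E : Type} [NormedAddCommGroup E] [InnerProductSpace ℝ E]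

/-- A concave function whose superlevel set `{0 < g}` is the open epigraph of a convex Lipschitz
graph over the hyperplane orthogonal to `e`. -/
structure IsGraphFunction (e : E) (K : ℝ) (g : E → ℝ) : Prop where
  norm_e : ‖e‖ = 1
  concave : ConcaveOn ℝ Set.univ g
  lip : ∀ x y, |g x - g y| ≤ K * ‖x - y‖
  shift : ∀ x (t : ℝ), g (x + t • e) = g x + t

theorem exists_inner_lt_of_notMem [CompleteSpace E] {Ω : Set E} (hΩo : IsOpen Ω)
    (hΩc : Convex ℝ Ω) {z : E} (hz : z ∉ Ω) : ∃ ν : E, ∀ a ∈ Ω, inner ℝ ν z < inner ℝ ν a := by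
  obtain ⟨f, hf⟩ := geometric_hahn_banach_open_point hΩc hΩo hz
  refine ⟨-(InnerProductSpace.toDual ℝ E).symm f, fun a ha => ?_⟩
  simpa using hf a ha

/-- `g` is the infimum of all affine functions that are nonnegative on `Ω`, have slope exactly one
along `e` and gradient at most `K`. The direction `e` points from a boundary point `p` to an
interior point `q`, and every hyperplane separating a point near `p` from `Ω` admits this
normalisation, since a whole ball around `q` lies in `Ω`. -/
theorem exists_graphFunction [CompleteSpace E] {Ω : Set E} (hΩo : IsOpen Ω) (hΩc : Convex ℝ Ω)
    (hΩne : Ω.Nonempty) (hΩu : Ω ≠ Set.univ) :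
    ∃ (p e : E) (K ρ : ℝ) (g : E → ℝ), IsGraphFunction e K g ∧ 0 < ρ ∧ g p = 0 ∧
      ∀ x ∈ Metric.ball p ρ, (x ∈ Ω ↔ 0 < g x) := by
  obtain ⟨p, hp⟩ : (frontier Ω).Nonempty := nonempty_frontier_iff.2 ⟨hΩne, hΩu⟩
  obtain ⟨q, hq⟩ := hΩne
  have hpΩ : p ∉ Ω := fun h => by
    rw [hΩo.frontier_eq] at hp
    exact hp.2 h
  obtain ⟨r, hr, hrΩ⟩ := Metric.nhds_basis_closedBall.mem_iff.1 (hΩo.mem_nhds hq)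
  have hqp : q - p ≠ 0 := sub_ne_zero.2 fun h => hpΩ (h ▸ hq)
  have hL : 0 < ‖q - p‖ := norm_pos_iff.2 hqp
  set L := ‖q - p‖ with hLdef
  set e : E := L⁻¹ • (q - p) with he
  have hen : ‖e‖ = 1 := by
    rw [he, norm_smul, norm_inv, Real.norm_of_nonneg hL.le, inv_mul_cancel₀ hL.ne']
  -- If `ν` separates a point within `r/2` of `p` from the ball of radius `r` about `q`, then `⟪ν, q
  -- - p⟫ ≥ r ‖ν‖ / 2`, hence `⟪ν, e⟫ ≥ ‖ν‖ r / (2L) = ‖ν‖ / K`.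
  set K : ℝ := 2 * L / r with hK
  have hK0 : 0 < K := by positivity
  let S : Set (E × ℝ) := {s | inner ℝ s.1 e = 1 ∧ ‖s.1‖ ≤ K ∧ ∀ y ∈ Ω, 0 ≤ inner ℝ s.1 y + s.2}
  -- supporting functionals at points outside `Ω` near `p`
  have hsep : ∀ z ∈ Metric.ball p (r / 2), z ∉ Ω → ∃ s : S, inner ℝ s.1.1 z + s.1.2 = 0 := by
    intro z hz hzΩ
    obtain ⟨ν, hν⟩ := exists_inner_lt_of_notMem hΩo hΩc hzΩ
    have hν0 : ν ≠ 0 := by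
      rintro rfl
      simpa using hν q hq
    have hn : 0 < ‖ν‖ := norm_pos_iff.2 hν0
    have h1 := hν (q - (r / ‖ν‖) • ν) (hrΩ (by
      rw [mem_closedBall_iff_norm, sub_sub_cancel_left, norm_neg, norm_smul, norm_div, norm_norm,
        Real.norm_of_nonneg hr.le, div_mul_cancel₀ _ hn.ne']))
    rw [inner_sub_right, inner_smul_right, real_inner_self_eq_norm_sq] at h1
    have h2 : r / ‖ν‖ * ‖ν‖ ^ 2 = r * ‖ν‖ := by field_simp
    rw [h2] at h1
    have h3 : inner ℝ ν (z - p) ≥ -(‖ν‖ * (r / 2)) := by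
      have h4 := abs_real_inner_le_norm ν (z - p)
      have h5 : ‖z - p‖ ≤ r / 2 := (mem_ball_iff_norm.1 hz).le
      have h6 := mul_le_mul_of_nonneg_left h5 hn.le
      linarith [neg_abs_le (inner ℝ ν (z - p))]
    have h4 : inner ℝ ν (q - p) ≥ r * ‖ν‖ / 2 := by
      have : inner ℝ ν (q - p) = inner ℝ ν q - inner ℝ ν z + inner ℝ ν (z - p) := by
        rw [inner_sub_right, inner_sub_right]; ring
      rw [this]; linarith
    have h5 : inner ℝ ν e ≥ ‖ν‖ / K := by
      rw [he, inner_smul_right, hK]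
      calc ‖ν‖ / (2 * L / r) = L⁻¹ * (r * ‖ν‖ / 2) := by field_simp
        _ ≤ _ := mul_le_mul_of_nonneg_left h4 (by positivity)
    have h6 : 0 < inner ℝ ν e := lt_of_lt_of_le (by positivity) h5
    refine ⟨⟨((inner ℝ ν e)⁻¹ • ν, -inner ℝ ((inner ℝ ν e)⁻¹ • ν) z), ?_, ?_, ?_⟩, ?_⟩
    · simp only [inner_smul_left, RCLike.conj_to_real]
      exact inv_mul_cancel₀ h6.ne'
    · simp only [norm_smul, norm_inv, Real.norm_of_nonneg h6.le]
      rw [inv_mul_le_iff₀ h6]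
      have := (div_le_iff₀ hK0).1 h5
      linarith
    · intro y hy
      simp only [inner_smul_left, RCLike.conj_to_real]
      have := mul_pos (inv_pos.2 h6) (sub_pos.2 (hν y hy))
      linarith
    · simp
  obtain ⟨s0, hs0⟩ := hsep p (Metric.mem_ball_self (by positivity)) hpΩ
  have : Nonempty S := ⟨s0⟩
  let ℓ : S → E → ℝ := fun s x => inner ℝ s.1.1 x + s.1.2
  have hℓq : ∀ s x, -(K * ‖x - q‖) ≤ ℓ s x := by
    intro s x
    have h1 := abs_real_inner_le_norm s.1.1 (x - q)
    have h2 := mul_le_mul_of_nonneg_right s.2.2.1 (norm_nonneg (x - q))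
    have h3 := s.2.2.2 q hq
    have h4 : ℓ s x = inner ℝ s.1.1 q + s.1.2 + inner ℝ s.1.1 (x - q) := by
      simp only [ℓ, inner_sub_right]; ring
    rw [h4]
    linarith [neg_abs_le (inner ℝ s.1.1 (x - q))]
  have hbdd : ∀ x, BddBelow (Set.range fun s => ℓ s x) := fun x =>
    ⟨-(K * ‖x - q‖), by rintro _ ⟨s, rfl⟩; exact hℓq s x⟩
  let g : E → ℝ := fun x => ⨅ s, ℓ s x
  have hgle : ∀ s x, g x ≤ ℓ s x := fun s x => ciInf_le (hbdd x) s
  have hlip1 : ∀ x y, g x ≤ g y + K * ‖x - y‖ := by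
    intro x y
    rw [← sub_le_iff_le_add]
    refine le_ciInf fun s => ?_
    have h1 := abs_real_inner_le_norm s.1.1 (x - y)
    have h2 := mul_le_mul_of_nonneg_right s.2.2.1 (norm_nonneg (x - y))
    have h4 : ℓ s x = ℓ s y + inner ℝ s.1.1 (x - y) := by
      simp only [ℓ, inner_sub_right]; ring
    linarith [hgle s x, le_abs_self (inner ℝ s.1.1 (x - y))]
  have hlip : ∀ x y, |g x - g y| ≤ K * ‖x - y‖ := by
    intro x y
    rw [abs_le]
    have := hlip1 x y
    have := hlip1 y x
    rw [norm_sub_rev y x] at this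
    constructor <;> linarith
  have hpos : ∀ x ∈ Ω, 0 < g x := by
    intro x hx
    obtain ⟨δ, hδ, hδΩ⟩ := Metric.nhds_basis_closedBall.mem_iff.1 (hΩo.mem_nhds hx)
    refine hδ.trans_le (le_ciInf fun s => ?_)
    -- All competitors are nonnegative at `x - δ e ∈ Ω` and have slope one along `e`, so they are at
    -- least `δ` at `x`; the infimum stays positive.
    have h1 := s.2.2.2 (x - δ • e) (hδΩ (by
      rw [mem_closedBall_iff_norm, sub_sub_cancel_left, norm_neg, norm_smul, hen,
        Real.norm_of_nonneg hδ.le, mul_one]))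
    rw [inner_sub_right, inner_smul_right, s.2.1] at h1
    simp only [ℓ]
    linarith
  refine ⟨p, e, K, r / 2, g, ⟨hen, ⟨convex_univ, ?_⟩, hlip, ?_⟩, by positivity, ?_, ?_⟩
  · intro x _ y _ a b ha hb hab
    refine le_ciInf fun s => ?_
    have h1 := mul_le_mul_of_nonneg_left (hgle s x) ha
    have h2 := mul_le_mul_of_nonneg_left (hgle s y) hb
    have h3 : ℓ s (a • x + b • y) = a * ℓ s x + b * ℓ s y := by
      simp only [ℓ, inner_add_right, inner_smul_right]
      linear_combination - s.1.2 * hab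
    rw [h3]
    simpa using add_le_add h1 h2
  · have key : ∀ x (t : ℝ), g x + t ≤ g (x + t • e) := by
      intro x t
      refine le_ciInf fun s => ?_
      have : ℓ s (x + t • e) = ℓ s x + t := by
        simp only [ℓ, inner_add_right, inner_smul_right, s.2.1]; ring
      rw [this]
      linarith [hgle s x]
    intro x t
    refine le_antisymm ?_ (key x t)
    have := key (x + t • e) (-t)
    rw [add_assoc, ← add_smul, add_neg_cancel, zero_smul, add_zero] at this
    linarith
  · refine le_antisymm (hs0 ▸ hgle s0 p) ?_
    have hc : Continuous g := (LipschitzWith.of_dist_le_mul (K := K.toNNReal) fun x y => by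
      rw [Real.coe_toNNReal K hK0.le, dist_eq_norm, dist_eq_norm]
      exact hlip x y).continuous
    have : closure Ω ⊆ {x | 0 ≤ g x} :=
      closure_minimal (fun x hx => (hpos x hx).le) (isClosed_le continuous_const hc)
    exact this (frontier_subset_closure hp)
  · intro x hx
    refine ⟨hpos x, fun h => ?_⟩
    by_contra hxΩ
    obtain ⟨s, hs⟩ := hsep x hx hxΩ
    exact absurd (hs ▸ hgle s x) (not_le.2 h)

namespace IsGraphFunction

variable {e : E} {K : ℝ} {g : E → ℝ}

theorem one_le_K (h : IsGraphFunction e K g) : 1 ≤ K := by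
  have h1 := h.lip (0 + (1 : ℝ) • e) 0
  rw [h.shift] at h1
  simpa [h.norm_e] using h1

theorem continuous (h : IsGraphFunction e K g) : Continuous g :=
  (LipschitzWith.of_dist_le_mul (K := K.toNNReal) fun x y => by
    rw [Real.coe_toNNReal K (by linarith [h.one_le_K]), dist_eq_norm, dist_eq_norm]
    exact h.lip x y).continuous

/-- Hahn–Banach separates `(x, g x)` from the strict hypograph. The slope along `e` is found by
moving both ways along `e`, the upper bound on `‖ξ‖` by comparing with the Lipschitz bound at `x -
ξ`. -/
theorem exists_supergradient [CompleteSpace E] (h : IsGraphFunction e K g) (x : E) :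
    ∃ ξ : E, (∀ y, g y ≤ g x + inner ℝ ξ (y - x)) ∧ inner ℝ ξ e = 1 ∧ 1 ≤ ‖ξ‖ ∧ ‖ξ‖ ≤ K := by
  have hconv : Convex ℝ {p : E × ℝ | p.1 ∈ Set.univ ∧ p.2 < g p.1} :=
    h.concave.convex_strict_hypograph
  have hopen : IsOpen {p : E × ℝ | p.1 ∈ Set.univ ∧ p.2 < g p.1} := by
    simp only [Set.mem_univ, true_and]
    exact isOpen_lt continuous_snd (h.continuous.comp continuous_fst)
  obtain ⟨f, hf⟩ := geometric_hahn_banach_open_point hconv hopen (x := (x, g x)) (by simp)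
  have hsplit : ∀ y (s : ℝ), f (y, s) = f (y, 0) + s * f (0, 1) := by
    intro y s
    have : (y, s) = (y, (0 : ℝ)) + s • ((0 : E), (1 : ℝ)) := by simp
    rw [this, map_add, map_smul, smul_eq_mul]
  have hc : 0 < f (0, 1) := by
    have := hf (x, g x - 1) (by simp)
    rw [hsplit, hsplit x (g x)] at this
    linarith
  set c := f (0, 1)
  have hle : ∀ y, f (y, 0) + g y * c ≤ f (x, 0) + g x * c := by
    intro y
    refine le_of_forall_pos_lt_add fun ε hε => ?_
    have := hf (y, g y - ε / c) (by simp; positivity)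
    rw [hsplit, hsplit x (g x), sub_mul, div_mul_cancel₀ _ hc.ne'] at this
    linarith
  let φ : E →L[ℝ] ℝ := f.comp (ContinuousLinearMap.inl ℝ E ℝ)
  have hφ : ∀ y, φ y = f (y, 0) := fun y => rfl
  let ξ : E := (-c⁻¹) • (InnerProductSpace.toDual ℝ E).symm φ
  have hξ : ∀ y, g y ≤ g x + inner ℝ ξ (y - x) := by
    intro y
    have h1 : inner ℝ ξ (y - x) = -c⁻¹ * (f (y, 0) - f (x, 0)) := by
      rw [← hφ, ← hφ, ← map_sub]
      simp only [ξ, inner_smul_left, RCLike.conj_to_real, InnerProductSpace.toDual_symm_apply]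
    have h2 := mul_le_mul_of_nonneg_left (hle y) (inv_pos.2 hc).le
    have h3 : c⁻¹ * c = 1 := inv_mul_cancel₀ hc.ne'
    rw [h1]
    have h4 : c⁻¹ * (f (y, 0) + g y * c) = c⁻¹ * f (y, 0) + g y := by
      linear_combination g y * h3
    have h5 : c⁻¹ * (f (x, 0) + g x * c) = c⁻¹ * f (x, 0) + g x := by
      linear_combination g x * h3
    linarith
  have he : inner ℝ ξ e = 1 := by
    have h1 := hξ (x + (1 : ℝ) • e)
    have h2 := hξ (x + (-1 : ℝ) • e)
    rw [h.shift, add_sub_cancel_left, inner_smul_right] at h1 h2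
    linarith
  refine ⟨ξ, hξ, he, ?_, ?_⟩
  · have := real_inner_le_norm ξ e
    rwa [he, h.norm_e, mul_one] at this
  · have h1 := hξ (x - ξ)
    have h2 := h.lip (x - ξ) x
    rw [sub_sub_cancel_left, inner_neg_right, real_inner_self_eq_norm_sq] at h1
    rw [sub_sub_cancel_left, norm_neg] at h2
    rcases (norm_nonneg ξ).eq_or_lt with h0 | h0
    · rw [← h0]; linarith [h.one_le_K]
    · have := neg_abs_le (g (x - ξ) - g x)
      nlinarith

end IsGraphFunction

/-- A nearest point of the complement of `Ω` lies on the frontier. -/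
theorem infDist_frontier_le [FiniteDimensional ℝ E] {Ω : Set E} {x y : E} (hx : x ∈ Ω)
    (hy : y ∉ Ω) : Metric.infDist x (frontier Ω) ≤ ‖x - y‖ := by
  have : ProperSpace E := FiniteDimensional.proper ℝ E
  obtain ⟨z, hz, hd⟩ := exists_mem_frontier_infDist_compl_eq_dist hx
    (fun h => hy (h ▸ Set.mem_univ y))
  calc Metric.infDist x (frontier Ω) ≤ dist x z := Metric.infDist_le_dist_of_mem hz
    _ = Metric.infDist x Ωᶜ := hd.symm
    _ ≤ dist x y := Metric.infDist_le_dist_of_mem hy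
    _ = _ := dist_eq_norm _ _

theorem infDist_frontier_pos {Ω : Set E} (hΩo : IsOpen Ω) (hΩu : Ω ≠ Set.univ) {x : E}
    (hx : x ∈ Ω) : 0 < Metric.infDist x (frontier Ω) := by
  have hne : (frontier Ω).Nonempty := nonempty_frontier_iff.2 ⟨⟨x, hx⟩, hΩu⟩
  refine (isClosed_frontier.notMem_iff_infDist_pos hne).1 fun h => ?_
  rw [hΩo.frontier_eq] at h
  exact h.2 hx

end ConvexChart

/-! ### Integration along lines, and radial integrals -/

section Disintegration

open scoped ENNReal

variable {E : Type} [NormedAddCommGroup E] [InnerProductSpace ℝ E]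

/-- The component of `z` orthogonal to the unit vector `e`. -/
def perp (e z : E) : E := z - inner ℝ e z • e

theorem perp_add_smul {e : E} (he : ‖e‖ = 1) (z : E) (t : ℝ) : perp e (z + t • e) = perp e z := by
  simp only [perp, inner_add_right, inner_smul_right, real_inner_self_eq_norm_sq, he]
  module

theorem norm_perp_le {e : E} (he : ‖e‖ = 1) (z : E) : ‖perp e z‖ ≤ ‖z‖ := by
  have h1 : ‖perp e z‖ ^ 2 = ‖z‖ ^ 2 - inner ℝ e z ^ 2 := by
    rw [perp, norm_sub_sq_real, inner_smul_right, norm_smul, he, real_inner_comm z e, mul_one,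
      Real.norm_eq_abs, sq_abs]
    ring
  refine abs_le_of_sq_le_sq' ?_ (norm_nonneg z) |>.2
  rw [h1]
  nlinarith [sq_nonneg (inner ℝ e z)]

theorem norm_le_norm_perp_add {e : E} (he : ‖e‖ = 1) (z : E) :
    ‖z‖ ≤ ‖perp e z‖ + |inner ℝ e z| := by
  have : z = perp e z + inner ℝ e z • e := by simp [perp]
  calc ‖z‖ = ‖perp e z + inner ℝ e z • e‖ := by rw [← this]
    _ ≤ _ := norm_add_le _ _
    _ = _ := by rw [norm_smul, he, mul_one, Real.norm_eq_abs]

theorem continuous_perp (e : E) : Continuous (perp e) := by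
  unfold perp; fun_prop

/-- The normalised indicator of a strip `0 < ⟪e, z⟫ ≤ s` integrates to one on every line. -/
theorem lintegral_strip {e : E} (he : ‖e‖ = 1) (z : E) {s : ℝ} (hs : 0 < s) :
    ∫⁻ t : ℝ, {z | inner ℝ e z ∈ Set.Ioc 0 s}.indicator (fun _ => ENNReal.ofReal s⁻¹)
      (z + t • e) = 1 := by
  have : ∀ t : ℝ, {z | inner ℝ e z ∈ Set.Ioc 0 s}.indicator (fun _ => ENNReal.ofReal s⁻¹)
      (z + t • e) = (Set.Ioc (-inner ℝ e z) (s - inner ℝ e z)).indicator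
        (fun _ => ENNReal.ofReal s⁻¹) t := by
    intro t
    simp only [Set.indicator, Set.mem_ofPred_eq, inner_add_right, inner_smul_right,
      real_inner_self_eq_norm_sq, he, Set.mem_Ioc]
    congr 1
    apply propext
    constructor <;> rintro ⟨h1, h2⟩ <;> constructor <;> linarith
  simp_rw [this]
  rw [lintegral_indicator measurableSet_Ioc, setLIntegral_const, Real.volume_Ioc,
    ← ENNReal.ofReal_mul (inv_pos.2 hs).le]
  rw [show s⁻¹ * (s - inner ℝ e z - -inner ℝ e z) = 1 by field_simp; ring]
  simp

variable [FiniteDimensional ℝ E] [MeasurableSpace E] [BorelSpace E]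

/-- Tonelli along the lines parallel to `e`, in the coordinate `ζ`. -/
theorem lintegral_disintegrate {e : E} {ζ : E → ℝ} (hζ : Measurable ζ)
    (hζe : ∀ x (t : ℝ), ζ (x + t • e) = ζ x + t) {F : E → ℝ → ℝ≥0∞}
    (hF : Measurable (Function.uncurry F)) (hFe : ∀ x (t s : ℝ), F (x + t • e) s = F x s)
    {ψ : E → ℝ≥0∞} (hψ : Measurable ψ) :
    ∫⁻ x, (∫⁻ s : ℝ, ψ (x + s • e)) * F x (ζ x) = ∫⁻ x, ψ x * ∫⁻ t, F x t := by
  have m1 : Measurable fun p : E × ℝ => ψ (p.1 + p.2 • e) := by fun_prop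
  have m2 : Measurable fun x : E => F x (ζ x) := hF.comp (measurable_id.prodMk hζ)
  have m3 : Measurable fun p : E × ℝ => ψ p.1 * F p.1 (ζ p.1 - p.2) :=
    (hψ.comp measurable_fst).mul
      (hF.comp (measurable_fst.prodMk ((hζ.comp measurable_fst).sub measurable_snd)))
  calc ∫⁻ x, (∫⁻ s : ℝ, ψ (x + s • e)) * F x (ζ x)
      = ∫⁻ x, ∫⁻ s : ℝ, ψ (x + s • e) * F x (ζ x) := by
        refine lintegral_congr fun x => ?_
        have hm : Measurable fun s : ℝ => ψ (x + s • e) := by fun_prop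
        rw [lintegral_mul_const _ hm]
    _ = ∫⁻ s : ℝ, ∫⁻ x, ψ (x + s • e) * F x (ζ x) :=
        lintegral_lintegral_swap (m1.mul (m2.comp measurable_fst)).aemeasurable
    _ = ∫⁻ s : ℝ, ∫⁻ x, ψ x * F x (ζ x - s) := by
        refine lintegral_congr fun s => ?_
        -- Translating `x` by `s e` increases `ζ` by `s` and does not change `F` in its first
        -- argument.
        rw [← lintegral_add_right_eq_self (fun x => ψ x * F x (ζ x - s)) (s • e)]
        refine lintegral_congr fun x => ?_
        rw [hζe, hFe, add_sub_cancel_right]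
    _ = ∫⁻ x, ∫⁻ s : ℝ, ψ x * F x (ζ x - s) := (lintegral_lintegral_swap m3.aemeasurable).symm
    _ = ∫⁻ x, ψ x * ∫⁻ t, F x t := by
        refine lintegral_congr fun x => ?_
        have hm : Measurable fun s : ℝ => F x (ζ x - s) :=
          hF.comp (measurable_const.prodMk (measurable_const.sub measurable_id))
        rw [lintegral_const_mul _ hm, lintegral_sub_left_eq_self (fun t => F x t)]

theorem integrable_inv_add_norm_pow {p : ℕ} (hp : Module.finrank ℝ E < p) {s : ℝ} (hs : 0 < s) :
    Integrable fun z : E => ((s + ‖z‖) ^ p)⁻¹ := by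
  have h1 : Integrable fun z : E => (1 + ‖z‖) ^ (-(p : ℝ)) :=
    integrable_one_add_norm (by exact_mod_cast hp)
  have h2 := (h1.comp_smul (R := s⁻¹) (inv_ne_zero hs.ne')).const_mul ((s ^ p)⁻¹)
  refine h2.congr (Filter.Eventually.of_forall fun z => ?_)
  simp only [norm_smul, norm_inv, Real.norm_of_nonneg hs.le]
  rw [Real.rpow_neg (by positivity), Real.rpow_natCast, ← mul_inv, ← mul_pow]
  congr 2
  field_simp

theorem integral_inv_add_norm_pow (p : ℕ) {s : ℝ} (hs : 0 < s) :
    ∫ z : E, ((s + ‖z‖) ^ p)⁻¹ =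
      s ^ Module.finrank ℝ E / s ^ p * ∫ z : E, ((1 + ‖z‖) ^ p)⁻¹ := by
  have h1 : ∀ z : E, ((s + ‖z‖) ^ p)⁻¹ = (s ^ p)⁻¹ * ((1 + ‖s⁻¹ • z‖) ^ p)⁻¹ := by
    intro z
    simp only [norm_smul, norm_inv, Real.norm_of_nonneg hs.le]
    rw [← mul_inv, ← mul_pow]
    congr 2
    field_simp
  simp_rw [h1]
  rw [integral_const_mul, Measure.integral_comp_smul volume (fun z : E => ((1 + ‖z‖) ^ p)⁻¹) s⁻¹,
    smul_eq_mul, inv_pow, inv_inv, abs_of_pos (pow_pos hs _)]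
  ring

theorem lintegral_inv_add_norm_pow {p : ℕ} (hp : Module.finrank ℝ E < p) {s : ℝ} (hs : 0 < s) :
    ∫⁻ z : E, ENNReal.ofReal ((s + ‖z‖) ^ p)⁻¹ = ENNReal.ofReal
      (s ^ Module.finrank ℝ E / s ^ p * ∫ z : E, ((1 + ‖z‖) ^ p)⁻¹) := by
  rw [← integral_inv_add_norm_pow p hs, ofReal_integral_eq_lintegral_ofReal
    (integrable_inv_add_norm_pow hp hs) (Filter.Eventually.of_forall fun z => by positivity)]

end Disintegration

/-! ### Non-flatness of the graph measured by second differences -/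

section Nonflatness

open scoped ENNReal

variable {E : Type} [NormedAddCommGroup E] [InnerProductSpace ℝ E]

/-- The (negative) symmetric second difference of `g`. -/
def secondDiff (g : E → ℝ) (x z : E) : ℝ := 2 * g x - g (x + z) - g (x - z)

namespace IsGraphFunction

variable {e : E} {K : ℝ} {g : E → ℝ}

theorem secondDiff_nonneg (h : IsGraphFunction e K g) (x z : E) : 0 ≤ secondDiff g x z := by
  have := h.concave.2 (Set.mem_univ (x + z)) (Set.mem_univ (x - z))
    (by norm_num : (0 : ℝ) ≤ 1 / 2) (by norm_num : (0 : ℝ) ≤ 1 / 2) (by norm_num)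
  rw [show (1 / 2 : ℝ) • (x + z) + (1 / 2 : ℝ) • (x - z) = x by module, smul_eq_mul,
    smul_eq_mul] at this
  unfold secondDiff
  linarith

theorem secondDiff_le (h : IsGraphFunction e K g) (x z : E) :
    secondDiff g x z ≤ 2 * K * ‖z‖ := by
  have h1 := h.lip x (x + z)
  have h2 := h.lip x (x - z)
  rw [sub_add_cancel_left, norm_neg] at h1
  rw [sub_sub_cancel] at h2
  unfold secondDiff
  linarith [le_abs_self (g x - g (x + z)), le_abs_self (g x - g (x - z))]

/-- Invariance along `e`, in the base point and in the displacement, makes second differences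
admissible factors in `lintegral_disintegrate`. -/
theorem secondDiff_add_smul_left (h : IsGraphFunction e K g) (x z : E) (t : ℝ) :
    secondDiff g (x + t • e) z = secondDiff g x z := by
  unfold secondDiff
  rw [add_right_comm, add_sub_right_comm, h.shift, h.shift, h.shift]
  ring

theorem secondDiff_add_smul_right (h : IsGraphFunction e K g) (x z : E) (t : ℝ) :
    secondDiff g x (z + t • e) = secondDiff g x z := by
  unfold secondDiff
  rw [← add_assoc, h.shift, show x - (z + t • e) = x - z + (-t) • e by module, h.shift]
  ring

theorem continuous_secondDiff (h : IsGraphFunction e K g) :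
    Continuous fun p : E × E => secondDiff g p.1 p.2 := by
  have := h.continuous
  unfold secondDiff
  fun_prop

end IsGraphFunction

variable [FiniteDimensional ℝ E] [MeasurableSpace E] [BorelSpace E]

/-- The weighted mean of the second differences of `g` at `x` over all displacements. -/
def nonflatIntegral (g : E → ℝ) (x : E) : ℝ≥0∞ :=
  ∫⁻ z : E, ENNReal.ofReal (((g x + ‖z‖) ^ (2 * (Module.finrank ℝ E + 2)))⁻¹ * secondDiff g x z)

/-- A scale-invariant measure of how far the graph `{g = 0}` is from its tangent plane near `x`,
at the scale `g x`. -/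
def nonflat (g : E → ℝ) (x : E) : ℝ :=
  g x ^ (Module.finrank ℝ E + 3) * (nonflatIntegral g x).toReal

namespace IsGraphFunction

variable {e : E} {K : ℝ} {g : E → ℝ}

theorem measurable_nonflatIntegral_integrand (h : IsGraphFunction e K g) :
    Measurable fun p : E × E => ENNReal.ofReal
      (((g p.1 + ‖p.2‖) ^ (2 * (Module.finrank ℝ E + 2)))⁻¹ * secondDiff g p.1 p.2) := by
  have h1 := h.continuous.measurable
  have h2 := h.continuous_secondDiff.measurable
  fun_prop

theorem measurable_nonflat (h : IsGraphFunction e K g) : Measurable (nonflat g) :=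
  (h.continuous.measurable.pow_const _).mul
    h.measurable_nonflatIntegral_integrand.lintegral_prod_right'.ennreal_toReal

theorem nonflatIntegral_le (h : IsGraphFunction e K g) {x : E} (hx : 0 < g x) :
    nonflatIntegral g x ≤ ENNReal.ofReal (2 * K * (g x ^ Module.finrank ℝ E /
      g x ^ (2 * Module.finrank ℝ E + 3) *
        ∫ z : E, ((1 + ‖z‖) ^ (2 * Module.finrank ℝ E + 3))⁻¹)) := by
  have hK := h.one_le_K
  rw [ENNReal.ofReal_mul (by linarith), ← lintegral_inv_add_norm_pow (by omega) hx,
    ← lintegral_const_mul _ (by fun_prop)]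
  refine lintegral_mono fun z => ?_
  rw [← ENNReal.ofReal_mul (by linarith)]
  refine ENNReal.ofReal_le_ofReal ?_
  have h1 := h.secondDiff_le x z
  have h2 := norm_nonneg z
  have h3 : secondDiff g x z ≤ 2 * K * (g x + ‖z‖) := by nlinarith
  calc ((g x + ‖z‖) ^ (2 * (Module.finrank ℝ E + 2)))⁻¹ * secondDiff g x z
      ≤ ((g x + ‖z‖) ^ (2 * (Module.finrank ℝ E + 2)))⁻¹ * (2 * K * (g x + ‖z‖)) :=
        mul_le_mul_of_nonneg_left h3 (by positivity)
    _ = _ := by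
        rw [show 2 * (Module.finrank ℝ E + 2) = 2 * Module.finrank ℝ E + 3 + 1 by ring, pow_succ]
        field_simp

theorem nonflatIntegral_ne_top (h : IsGraphFunction e K g) {x : E} (hx : 0 < g x) :
    nonflatIntegral g x ≠ ⊤ :=
  ((h.nonflatIntegral_le hx).trans_lt ENNReal.ofReal_lt_top).ne

theorem nonflat_nonneg {x : E} (hx : 0 < g x) : 0 ≤ nonflat g x := by
  unfold nonflat; positivity

/-- The linear bound `2K‖z‖` for second differences, integrated against the kernel, gives `g^(-N-3)`
by scaling; the prefactor in `nonflat` compensates exactly this power. -/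
theorem exists_nonflat_le (h : IsGraphFunction e K g) :
    ∃ C, 0 ≤ C ∧ ∀ x, 0 < g x → nonflat g x ≤ C := by
  have hK := h.one_le_K
  set I := ∫ z : E, ((1 + ‖z‖) ^ (2 * Module.finrank ℝ E + 3))⁻¹ with hI
  have hI0 : 0 ≤ I := integral_nonneg fun z => by positivity
  refine ⟨2 * K * I, by positivity, fun x hx => ?_⟩
  have h1 := ENNReal.toReal_mono ENNReal.ofReal_ne_top (h.nonflatIntegral_le hx)
  rw [ENNReal.toReal_ofReal (by positivity)] at h1
  refine (mul_le_mul_of_nonneg_left h1 (by positivity)).trans (le_of_eq ?_)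
  rw [← hI, show 2 * Module.finrank ℝ E + 3 = Module.finrank ℝ E + 3 + Module.finrank ℝ E by ring,
    pow_add]
  field_simp
  ring

/-- The Riesz mass of the region between the graph and a supporting half-space. -/
theorem exists_lintegral_gap_le (h : IsGraphFunction e K g) : ∃ C, 0 ≤ C ∧ ∀ x ξ : E, 0 < g x →
    (∀ y, g y ≤ g x + inner ℝ ξ (y - x)) → inner ℝ ξ e = 1 →
    ∫⁻ y in {y | g y ≤ 0 ∧ 0 < g x + inner ℝ ξ (y - x)},
      ENNReal.ofReal (‖x - y‖ ^ (2 * (Module.finrank ℝ E + 2)))⁻¹ ≤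
        ENNReal.ofReal (C * (nonflat g x / g x ^ (Module.finrank ℝ E + 4))) := by
  have hK := h.one_le_K
  set P := 2 * (Module.finrank ℝ E + 2) with hP
  refine ⟨(K + 1) ^ P * 2 ^ P, by positivity, fun x ξ hx hξ hξe => ?_⟩
  set s := g x with hs
  have hgm := h.continuous.measurable
  -- A majorant of `‖z‖^(-P)` on the gap that is constant along `e`.
  let w : E → ℝ := fun z => (K + 1) ^ P * ((s + ‖perp e z‖) ^ P)⁻¹
  have hw0 : ∀ z, 0 ≤ w z := fun z => by positivity
  have hwm : Measurable w := by
    have := (continuous_perp e).measurable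
    fun_prop
  let ζ : E → ℝ := fun z => s + inner ℝ ξ z
  have hζm : Measurable ζ := by fun_prop
  -- In the coordinate `ζ = g x + ⟪ξ, z⟫` each line parallel to `e` meets the gap within `0 < ζ ≤
  -- secondDiff g x z`; integrating over `t` produces the second difference as the length of that
  -- interval.
  let F : E → ℝ → ℝ≥0∞ := fun z t =>
    ENNReal.ofReal (w z) * (if 0 < t ∧ t ≤ secondDiff g x z then 1 else 0)
  have hΔm : Measurable fun z => secondDiff g x z :=
    (h.continuous_secondDiff.comp (Continuous.prodMk_right x)).measurable
  have hFm : Measurable (Function.uncurry F) := by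
    refine (hwm.comp measurable_fst).ennreal_ofReal.mul (Measurable.ite ?_ measurable_const
      measurable_const)
    exact (measurableSet_lt measurable_const measurable_snd).inter
      (measurableSet_le measurable_snd (hΔm.comp measurable_fst))
  have hSm : MeasurableSet {y | g y ≤ 0 ∧ 0 < s + inner ℝ ξ (y - x)} := by
    have h1 : Measurable fun y => s + inner ℝ ξ (y - x) := by fun_prop
    exact (hgm measurableSet_Iic).inter (h1 measurableSet_Ioi)
  let ψ : E → ℝ≥0∞ := {z | inner ℝ e z ∈ Set.Ioc 0 s}.indicator (fun _ => ENNReal.ofReal s⁻¹)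
  have hψm : Measurable ψ := by
    refine measurable_const.indicator ?_
    have : Measurable fun z : E => (inner ℝ e z : ℝ) := by fun_prop
    exact this measurableSet_Ioc
  have hdis := lintegral_disintegrate (e := e) (ζ := ζ) hζm (fun z t => by
      simp only [ζ, inner_add_right, inner_smul_right, hξe]; ring) (F := F) hFm (fun z t τ => by
      simp only [F, w, perp_add_smul h.norm_e, h.secondDiff_add_smul_right]) hψm
  have hψ1 : ∀ z, ∫⁻ τ : ℝ, ψ (z + τ • e) = 1 := fun z => lintegral_strip h.norm_e z hx
  simp only [hψ1, one_mul] at hdis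
  have hFt : ∀ z, ∫⁻ t, F z t = ENNReal.ofReal (w z * secondDiff g x z) := by
    intro z
    have : ∀ t, F z t = (Set.Ioc 0 (secondDiff g x z)).indicator
        (fun _ => ENNReal.ofReal (w z)) t := by
      intro t
      simp [F, Set.indicator]
    simp_rw [this]
    rw [lintegral_indicator measurableSet_Ioc, setLIntegral_const, Real.volume_Ioc, sub_zero,
      ENNReal.ofReal_mul (hw0 z)]
  calc ∫⁻ y in {y | g y ≤ 0 ∧ 0 < s + inner ℝ ξ (y - x)}, ENNReal.ofReal (‖x - y‖ ^ P)⁻¹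
      = ∫⁻ z, {y | g y ≤ 0 ∧ 0 < s + inner ℝ ξ (y - x)}.indicator
          (fun y => ENNReal.ofReal (‖x - y‖ ^ P)⁻¹) (x + z) := by
        rw [← lintegral_indicator hSm, lintegral_add_left_eq_self]
    _ ≤ ∫⁻ z, F z (ζ z) := by
        refine lintegral_mono fun z => ?_
        simp only [Set.indicator, Set.mem_ofPred_eq, add_sub_cancel_left, sub_add_cancel_left,
          norm_neg]
        split_ifs with hz
        · have h1 : s ≤ K * ‖z‖ := by
            have := h.lip x (x + z)
            rw [sub_add_cancel_left, norm_neg] at this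
            linarith [le_abs_self (g x - g (x + z)), hz.1]
          -- By `g (x + z) ≤ 0` in the gap, together with the supergradient inequality at the
          -- reflected point `x - z`.
          have h2 : ζ z ≤ secondDiff g x z := by
            have h3 := hξ (x - z)
            rw [sub_sub_cancel_left, inner_neg_right] at h3
            simp only [ζ, secondDiff]
            linarith [hz.1]
          have h4 : s + ‖perp e z‖ ≤ (K + 1) * ‖z‖ := by
            have := norm_perp_le h.norm_e z
            linarith
          have h5 : 0 < s + ‖perp e z‖ := by positivity
          have h6 : 0 < ‖z‖ := by nlinarith
          simp only [F]
          rw [if_pos ⟨hz.2, h2⟩, mul_one]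
          refine ENNReal.ofReal_le_ofReal ?_
          simp only [w]
          rw [← div_eq_mul_inv, ← div_pow, ← inv_pow]
          refine pow_le_pow_left₀ (by positivity) ?_ _
          rw [inv_le_comm₀ h6 (by positivity), inv_div, div_le_iff₀ (by linarith)]
          linarith
        · exact zero_le
    _ = ∫⁻ z, ψ z * ENNReal.ofReal (w z * secondDiff g x z) := by
        rw [hdis]
        exact lintegral_congr fun z => by rw [hFt]
    _ ≤ ∫⁻ z, ENNReal.ofReal ((K + 1) ^ P * 2 ^ P * s⁻¹) *
          ENNReal.ofReal (((g x + ‖z‖) ^ P)⁻¹ * secondDiff g x z) := by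
        refine lintegral_mono fun z => ?_
        simp only [ψ, Set.indicator, Set.mem_ofPred_eq]
        split_ifs with hz
        · rw [← ENNReal.ofReal_mul (by positivity), ← ENNReal.ofReal_mul (by positivity)]
          refine ENNReal.ofReal_le_ofReal ?_
          have h1 := norm_le_norm_perp_add h.norm_e z
          rw [abs_of_pos hz.1] at h1
          -- On the strip `0 < ⟪e, z⟫ ≤ s` the transversal kernel is comparable to the full one.
          have h2 : ((s + ‖perp e z‖) ^ P)⁻¹ ≤ 2 ^ P * ((s + ‖z‖) ^ P)⁻¹ := by
            rw [← div_eq_mul_inv, ← div_pow, ← inv_pow]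
            refine pow_le_pow_left₀ (by positivity) ?_ _
            rw [inv_le_comm₀ (by positivity) (by positivity), inv_div, div_le_iff₀ (by positivity)]
            have hz2 : inner ℝ e z ≤ s := hz.2
            linarith [norm_nonneg (perp e z)]
          have h3 := h.secondDiff_nonneg x z
          calc s⁻¹ * (w z * secondDiff g x z)
              = s⁻¹ * ((K + 1) ^ P * secondDiff g x z) * ((s + ‖perp e z‖) ^ P)⁻¹ := by
                simp only [w]; ring
            _ ≤ s⁻¹ * ((K + 1) ^ P * secondDiff g x z) * (2 ^ P * ((s + ‖z‖) ^ P)⁻¹) :=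
                mul_le_mul_of_nonneg_left h2 (by positivity)
            _ = _ := by ring
        · simp
    _ = ENNReal.ofReal ((K + 1) ^ P * 2 ^ P * s⁻¹) * nonflatIntegral g x := by
        have hm : Measurable fun z => ENNReal.ofReal (((g x + ‖z‖) ^ P)⁻¹ * secondDiff g x z) := by
          fun_prop
        rw [lintegral_const_mul _ hm]
        rfl
    _ = ENNReal.ofReal ((K + 1) ^ P * 2 ^ P * (nonflat g x / s ^ (Module.finrank ℝ E + 4))) := by
        rw [← ENNReal.ofReal_toReal (h.nonflatIntegral_ne_top hx),
          ← ENNReal.ofReal_mul (by positivity)]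
        congr 1
        rw [nonflat, ← hs, show Module.finrank ℝ E + 4 = Module.finrank ℝ E + 3 + 1 by ring,
          pow_succ]
        field_simp
        ring

end IsGraphFunction

end Nonflatness

/-! ### Averages of second differences and integrals over layers of `g` -/

section LayerIntegrals

open scoped ENNReal

variable {E : Type} [NormedAddCommGroup E] [InnerProductSpace ℝ E] [FiniteDimensional ℝ E]
  [MeasurableSpace E] [BorelSpace E]

theorem exists_abs_secondDiff_le {ψ : E → ℝ} (hψ : ContDiff ℝ ∞ ψ) (hc : HasCompactSupport ψ) :
    ∃ C, 0 ≤ C ∧ ∀ x z, |secondDiff ψ x z| ≤ C * ‖z‖ ^ 2 := by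
  obtain ⟨L, hL⟩ := (hψ.fderiv_right (m := ∞) (by simp)).lipschitzWith_of_hasCompactSupport
    (hc.fderiv ℝ) (by simp)
  refine ⟨L, L.2, fun x z => ?_⟩
  have hd : ∀ y, HasFDerivAt (fun y => ψ (y + z) - ψ y) (fderiv ℝ ψ (y + z) - fderiv ℝ ψ y) y := by
    intro y
    have h1 := (hasFDerivAt_comp_add_right (f := ψ) z).2
      (hψ.differentiable (by simp) (y + z)).hasFDerivAt
    exact h1.sub (hψ.differentiable (by simp) y).hasFDerivAt
  have hb : ∀ y, ‖fderiv ℝ ψ (y + z) - fderiv ℝ ψ y‖ ≤ L * ‖z‖ := by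
    intro y
    have := hL.dist_le_mul (y + z) y
    rwa [dist_eq_norm, dist_eq_norm, add_sub_cancel_left] at this
  have := convex_univ.norm_image_sub_le_of_norm_hasFDerivWithin_le
    (fun y _ => (hd y).hasFDerivWithinAt) (fun y _ => hb y) (Set.mem_univ (x - z))
    (Set.mem_univ x)
  rw [sub_sub_cancel, sub_add_cancel, Real.norm_eq_abs] at this
  rw [abs_sub_comm] at this
  unfold secondDiff
  calc |2 * ψ x - ψ (x + z) - ψ (x - z)| = |ψ x - ψ (x - z) - (ψ (x + z) - ψ x)| := by
        congr 1; ring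
    _ ≤ L * ‖z‖ * ‖z‖ := this
    _ = _ := by ring

/-- Summation by parts for second differences. -/
theorem integral_mul_secondDiff {ψ g : E → ℝ} (hψ : Continuous ψ) (hc : HasCompactSupport ψ)
    (hg : Continuous g) (z : E) :
    ∫ x, ψ x * secondDiff g x z = ∫ x, g x * secondDiff ψ x z := by
  have i1 : ∀ f : E → ℝ, Continuous f → Integrable fun x => ψ x * f x := fun f hf =>
    (hψ.mul hf).integrable_of_hasCompactSupport hc.mul_right
  have i2 : ∀ w : E, Integrable fun x => g x * ψ (x + w) := by
    intro w
    have := (i1 (fun x => g (x - w)) (by fun_prop)).comp_add_right w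
    simpa [mul_comm] using this
  have i3 : ∀ w : E, ∫ x, ψ x * g (x + w) = ∫ x, g x * ψ (x - w) := by
    intro w
    rw [← integral_add_right_eq_self (fun x => g x * ψ (x - w)) w]
    simp [mul_comm]
  have e1 : ∫ x, ψ x * secondDiff g x z =
      2 * (∫ x, g x * ψ x) - (∫ x, g x * ψ (x - z)) - ∫ x, g x * ψ (x + z) := by
    rw [← i3 z]
    have := i3 (-z)
    simp only [← sub_eq_add_neg, sub_neg_eq_add] at this
    rw [← this]
    have i0 : Integrable fun x => 2 * (g x * ψ x) := by simpa using (i2 0).const_mul 2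
    have i5 : Integrable fun x => ψ x * g (x + z) := i1 _ (by fun_prop)
    have i6 : Integrable fun x => ψ x * g (x - z) := i1 _ (by fun_prop)
    have i7 : Integrable fun x => 2 * (g x * ψ x) - ψ x * g (x + z) := i0.sub i5
    rw [← integral_const_mul, ← integral_sub i0 i5, ← integral_sub i7 i6]
    refine integral_congr_ae (Filter.Eventually.of_forall fun x => ?_)
    simp only [secondDiff]; ring
  have e2 : ∫ x, g x * secondDiff ψ x z =
      2 * (∫ x, g x * ψ x) - (∫ x, g x * ψ (x - z)) - ∫ x, g x * ψ (x + z) := by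
    have i0 : Integrable fun x => 2 * (g x * ψ x) := by simpa using (i2 0).const_mul 2
    have i4 : Integrable fun x => g x * ψ (x - z) := by simpa [sub_eq_add_neg] using i2 (-z)
    have i7 : Integrable fun x => 2 * (g x * ψ x) - g x * ψ (x - z) := i0.sub i4
    rw [← integral_const_mul, ← integral_sub i0 i4, ← integral_sub i7 (i2 z)]
    refine integral_congr_ae (Filter.Eventually.of_forall fun x => ?_)
    simp only [secondDiff]; ring
  rw [e1, e2]

namespace IsGraphFunction

variable {e : E} {K : ℝ} {g : E → ℝ}

/-- Although `g` is only Lipschitz, its averaged second differences are quadratic in `z`: for `‖z‖ ≤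
1` they are moved onto the smooth weight `ψ`, for larger `z` the linear bound suffices. As second
differences of `g` are nonnegative, this is a bound for their `L¹` size. -/
theorem exists_integral_mul_secondDiff_le (h : IsGraphFunction e K g) {ψ : E → ℝ}
    (hψ : ContDiff ℝ ∞ ψ) (hc : HasCompactSupport ψ) (h0 : ∀ x, 0 ≤ ψ x) :
    ∃ C, 0 ≤ C ∧ ∀ z, ∫ x, ψ x * secondDiff g x z ≤ C * ‖z‖ ^ 2 := by
  obtain ⟨C, hC, hψ2⟩ := exists_abs_secondDiff_le hψ hc
  obtain ⟨R, hR⟩ := hc.isCompact.isBounded.subset_closedBall (0 : E)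
  have hK := h.one_le_K
  have hsupp : ∀ x, R < ‖x‖ → ψ x = 0 := by
    intro x hx
    by_contra h
    have := hR (subset_tsupport ψ h)
    rw [mem_closedBall_zero_iff] at this
    linarith
  obtain ⟨G, hG⟩ := (isCompact_closedBall (0 : E) (R + 1)).exists_bound_of_continuousOn
    h.continuous.continuousOn
  have hI : 0 ≤ ∫ x, ψ x := integral_nonneg h0
  set V := volume.real (Metric.closedBall (0 : E) (R + 1)) with hV
  have hV0 : 0 ≤ V := measureReal_nonneg
  refine ⟨|G| * C * V + 2 * K * ∫ x, ψ x, by positivity, fun z => ?_⟩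
  rcases le_or_gt ‖z‖ 1 with hz | hz
  · rw [integral_mul_secondDiff hψ.continuous hc h.continuous]
    have hzero : ∀ x ∉ Metric.closedBall (0 : E) (R + 1), g x * secondDiff ψ x z = 0 := by
      intro x hx
      rw [mem_closedBall_zero_iff, not_le] at hx
      have n1 : ‖x‖ ≤ ‖x + z‖ + ‖z‖ := by simpa using norm_sub_le (x + z) z
      have n2 : ‖x‖ ≤ ‖x - z‖ + ‖z‖ := by simpa using norm_add_le (x - z) z
      rw [secondDiff, hsupp x (by linarith), hsupp (x + z) (by linarith),
        hsupp (x - z) (by linarith)]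
      simp
    rw [← setIntegral_eq_integral_of_forall_compl_eq_zero hzero]
    have hfin : volume (Metric.closedBall (0 : E) (R + 1)) < ⊤ :=
      (isCompact_closedBall _ _).measure_lt_top
    have := norm_setIntegral_le_of_norm_le_const (C := |G| * (C * ‖z‖ ^ 2))
      (f := fun x => g x * secondDiff ψ x z) hfin (fun x hx => by
      rw [norm_mul]
      exact mul_le_mul ((hG x hx).trans (le_abs_self G)) (hψ2 x z) (norm_nonneg _)
        (abs_nonneg G))
    refine (le_abs_self _).trans (this.trans ?_)
    rw [← hV]
    have : 0 ≤ 2 * K * (∫ x, ψ x) * ‖z‖ ^ 2 := by positivity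
    nlinarith
  · have h1 : ∫ x, ψ x * secondDiff g x z ≤ ∫ x, ψ x * (2 * K * ‖z‖) := by
      refine integral_mono ?_ ?_ fun x => mul_le_mul_of_nonneg_left (h.secondDiff_le x z) (h0 x)
      · have := h.continuous
        exact (hψ.continuous.mul (by unfold secondDiff; fun_prop)).integrable_of_hasCompactSupport
          hc.mul_right
      · exact (hψ.continuous.integrable_of_hasCompactSupport hc).mul_const _
    rw [integral_mul_const] at h1
    refine h1.trans ?_
    have h2 : ‖z‖ ≤ ‖z‖ ^ 2 := by nlinarith
    have h3 : 0 ≤ |G| * C * V * ‖z‖ ^ 2 := by positivity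
    have h4 := mul_le_mul_of_nonneg_left h2 (show 0 ≤ 2 * K * ∫ x, ψ x by positivity)
    linarith

/-- Integrals over a ball of quantities depending on `g` and an `e`-invariant factor. -/
theorem exists_setLIntegral_ball_le (h : IsGraphFunction e K g) (p : E) (ρ : ℝ) :
    ∃ ψ : E → ℝ, ContDiff ℝ ∞ ψ ∧ HasCompactSupport ψ ∧ (∀ x, 0 ≤ ψ x) ∧
      ∀ F : E → ℝ → ℝ≥0∞, Measurable (Function.uncurry F) →
        (∀ x (t s : ℝ), F (x + t • e) s = F x s) →
        ∫⁻ x in Metric.ball p ρ, F x (g x) ≤ ∫⁻ x, ENNReal.ofReal (ψ x) * ∫⁻ t, F x t := by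
  let b : ContDiffBump p := ⟨|ρ| + 1, |ρ| + 2, by positivity, by linarith⟩
  refine ⟨b, b.contDiff, b.hasCompactSupport, fun x => b.nonneg, fun F hF hFe => ?_⟩
  rw [← lintegral_disintegrate h.continuous.measurable h.shift hF hFe
    (b.continuous.measurable.ennreal_ofReal), ← lintegral_indicator Metric.isOpen_ball.measurableSet]
  refine lintegral_mono fun x => ?_
  simp only [Set.indicator]
  split_ifs with hx
  · refine le_mul_of_one_le_left zero_le ?_
    calc (1 : ℝ≥0∞) = ∫⁻ s in Set.Icc (0 : ℝ) 1, 1 := by simp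
      _ ≤ ∫⁻ s in Set.Icc (0 : ℝ) 1, ENNReal.ofReal (b (x + s • e)) := by
          refine setLIntegral_mono' measurableSet_Icc fun s hs => ?_
          rw [b.one_of_mem_closedBall, ENNReal.ofReal_one]
          rw [mem_closedBall_iff_norm, add_sub_right_comm]
          refine (norm_add_le _ _).trans ?_
          rw [norm_smul, h.norm_e, mul_one, Real.norm_of_nonneg hs.1]
          exact add_le_add (((mem_ball_iff_norm.1 hx).le).trans (le_abs_self ρ)) hs.2
      _ ≤ _ := setLIntegral_le_lintegral _ _
  · exact zero_le

theorem exists_lintegral_comp_le (h : IsGraphFunction e K g) (p : E) (ρ : ℝ) :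
    ∃ C : ℝ≥0∞, C ≠ ⊤ ∧ ∀ G : ℝ → ℝ≥0∞, Measurable G →
      ∫⁻ x in Metric.ball p ρ, G (g x) ≤ C * ∫⁻ t, G t := by
  obtain ⟨ψ, hψ, hc, h0, hF⟩ := h.exists_setLIntegral_ball_le p ρ
  refine ⟨∫⁻ x, ENNReal.ofReal (ψ x), ?_, fun G hG => ?_⟩
  · rw [← ofReal_integral_eq_lintegral_ofReal
      (hψ.continuous.integrable_of_hasCompactSupport hc) (Filter.Eventually.of_forall h0)]
    exact ENNReal.ofReal_ne_top
  · have := hF (fun _ t => G t) (hG.comp measurable_snd) (fun _ _ _ => rfl)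
    refine this.trans (le_of_eq ?_)
    rw [lintegral_mul_const _ hψ.continuous.measurable.ennreal_ofReal]

/-- The part of a thin cylinder around `p` in direction `e` on which `0 < g < δ'` lies in the ball,
and on each of its lines `g` is a unit-speed coordinate. -/
theorem exists_le_lintegral_comp (h : IsGraphFunction e K g) {p : E} (hp : g p = 0) {ρ : ℝ}
    (hρ : 0 < ρ) : ∃ (c : ℝ≥0∞) (δ : ℝ), c ≠ 0 ∧ 0 < δ ∧ ∀ δ' ≤ δ, ∀ G : ℝ → ℝ≥0∞, Measurable G →
      c * ∫⁻ t in Set.Ioo 0 δ', G t ≤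
        ∫⁻ x in Metric.ball p ρ ∩ g ⁻¹' Set.Ioo 0 δ', G (g x) := by
  have hK := h.one_le_K
  -- On the cylinder `|g|` is at most `Kη = ρ/4` at the projection orthogonal to `e` through `p`, so
  -- `0 < g < δ' ≤ ρ/4` forces the height over it to be at most `ρ/2`; with `η ≤ ρ/4` the point is
  -- in the ball.
  set η := ρ / (4 * K) with hη
  have hη0 : 0 < η := by positivity
  have hηρ : K * η = ρ / 4 := by rw [hη]; field_simp
  have hη1 : η ≤ ρ / 4 := by nlinarith
  let T : Set E := {z | ‖perp e (z - p)‖ < η}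
  have hTo : IsOpen T := isOpen_lt ((continuous_perp e).comp (by fun_prop)).norm continuous_const
  let S : Set E := {z | inner ℝ e z ∈ Set.Ioc 0 1}
  have hSm : MeasurableSet S := by
    have : Measurable fun z : E => (inner ℝ e z : ℝ) := by fun_prop
    exact this measurableSet_Ioc
  have hTe : ∀ z (t : ℝ), z + t • e ∈ T ↔ z ∈ T := by
    intro z t
    simp only [T, Set.mem_ofPred_eq, add_sub_right_comm, perp_add_smul h.norm_e]
  refine ⟨volume (S ∩ T), ρ / 4, ?_, by positivity, fun δ' hδ' G hG => ?_⟩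
  · have ho : IsOpen ({z : E | inner ℝ e z ∈ Set.Ioo 0 1} ∩ T) := by
      refine IsOpen.inter ?_ hTo
      have : Continuous fun z : E => (inner ℝ e z : ℝ) := by fun_prop
      exact isOpen_Ioo.preimage this
    have hne : ({z : E | inner ℝ e z ∈ Set.Ioo 0 1} ∩ T).Nonempty := by
      refine ⟨p + (1 / 2 - inner ℝ e p) • e, ?_, ?_⟩
      · simp only [Set.mem_ofPred_eq, inner_add_right, inner_smul_right,
          real_inner_self_eq_norm_sq, h.norm_e]
        norm_num
      · rw [hTe]
        simpa [T, perp] using hη0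
    refine ((ho.measure_pos volume hne).trans_le (measure_mono ?_)).ne'
    exact Set.inter_subset_inter_left _ fun z hz => ⟨hz.1, hz.2.le⟩
  · have hbm : MeasurableSet (Metric.ball p ρ ∩ g ⁻¹' Set.Ioo 0 δ') :=
      Metric.isOpen_ball.measurableSet.inter (h.continuous.measurable measurableSet_Ioo)
    let F : E → ℝ → ℝ≥0∞ := fun z t => T.indicator (fun _ => 1) z * (Set.Ioo 0 δ').indicator G t
    have hFm : Measurable (Function.uncurry F) :=
      ((measurable_const.indicator hTo.measurableSet).comp measurable_fst).mul
        ((hG.indicator measurableSet_Ioo).comp measurable_snd)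
    have hdis := lintegral_disintegrate h.continuous.measurable h.shift hFm (fun z t s => by
      simp only [F, Set.indicator, hTe]) (ψ := S.indicator (fun _ => ENNReal.ofReal 1⁻¹))
      (measurable_const.indicator hSm)
    have hψ1 : ∀ z, ∫⁻ s : ℝ, S.indicator (fun _ => ENNReal.ofReal 1⁻¹) (z + s • e) = 1 :=
      fun z => lintegral_strip h.norm_e z one_pos
    simp only [hψ1, one_mul] at hdis
    calc volume (S ∩ T) * ∫⁻ t in Set.Ioo 0 δ', G t
        = ∫⁻ x, S.indicator (fun _ => ENNReal.ofReal 1⁻¹) x * ∫⁻ t, F x t := by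
          simp only [F]
          have hm : Measurable ((Set.Ioo 0 δ').indicator G) := hG.indicator measurableSet_Ioo
          simp_rw [lintegral_const_mul _ hm, lintegral_indicator measurableSet_Ioo, ← mul_assoc]
          have hm' : Measurable fun x => S.indicator (fun _ => ENNReal.ofReal 1⁻¹) x *
              T.indicator (fun _ => (1 : ℝ≥0∞)) x :=
            (measurable_const.indicator hSm).mul (measurable_const.indicator hTo.measurableSet)
          rw [lintegral_mul_const _ hm']
          congr 1
          rw [← setLIntegral_one, ← lintegral_indicator (hSm.inter hTo.measurableSet)]
          refine lintegral_congr fun x => ?_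
          by_cases hx : x ∈ S <;> by_cases hx' : x ∈ T <;> simp [hx, hx']
      _ = ∫⁻ x, F x (g x) := hdis.symm
      _ ≤ _ := by
          rw [← lintegral_indicator hbm]
          refine lintegral_mono fun x => ?_
          by_cases h1 : x ∈ T
          · by_cases h2 : g x ∈ Set.Ioo 0 δ'
            · have h1' : ‖perp e (x - p)‖ < η := h1
              have e1 : x = p + perp e (x - p) + (inner ℝ e (x - p)) • e := by
                simp only [perp]; module
              have e2 : g x = g (p + perp e (x - p)) + inner ℝ e (x - p) := by
                conv_lhs => rw [e1]
                exact h.shift _ _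
              have e3 := h.lip (p + perp e (x - p)) p
              rw [add_sub_cancel_left, hp, sub_zero] at e3
              have e4 : K * ‖perp e (x - p)‖ ≤ ρ / 4 := by
                rw [← hηρ]; exact mul_le_mul_of_nonneg_left h1'.le (by linarith)
              have e5 : |inner ℝ e (x - p)| ≤ δ' + ρ / 4 := by
                rw [abs_le]
                have := abs_le.1 (e3.trans e4)
                constructor <;> linarith [h2.1, h2.2]
              have e6 : x ∈ Metric.ball p ρ ∩ g ⁻¹' Set.Ioo 0 δ' := by
                refine ⟨?_, h2⟩
                rw [mem_ball_iff_norm]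
                have := norm_le_norm_perp_add h.norm_e (x - p)
                linarith
              simp [F, h1, h2, Set.indicator_of_mem e6]
            · simp [F, h2]
          · simp [F, h1]

end IsGraphFunction

end LayerIntegrals

/-! ### Integrability of the non-flatness up to the boundary -/

section NonflatIntegrability

open scoped ENNReal

variable {E : Type} [NormedAddCommGroup E] [InnerProductSpace ℝ E] [FiniteDimensional ℝ E]
  [MeasurableSpace E] [BorelSpace E]

namespace IsGraphFunction

variable {e : E} {K : ℝ} {g : E → ℝ}

theorem setLIntegral_rpow_lt_top {β : ℝ} (hβ : -1 < β) :
    ∫⁻ t in Set.Ioo (0 : ℝ) 1, ENNReal.ofReal (t ^ β) < ⊤ := by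
  have h1 : IntegrableOn (fun t : ℝ => t ^ β) (Set.Ioo 0 1) := by
    have := (intervalIntegral.intervalIntegrable_rpow' (a := 0) (b := 1) hβ)
    rw [intervalIntegrable_iff_integrableOn_Ioo_of_le zero_le_one] at this
    exact this
  rw [← ofReal_integral_eq_lintegral_ofReal h1]
  · exact ENNReal.ofReal_lt_top
  · filter_upwards [ae_restrict_mem measurableSet_Ioo] with t ht
    exact Real.rpow_nonneg ht.1.le _

/-- The non-flatness is integrable near the graph with a singular weight: this is where the
concavity of `g` enters, through the size of its averaged second differences. -/
theorem setLIntegral_nonflat_lt_top (h : IsGraphFunction e K g) (p : E) (ρ : ℝ) :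
    ∫⁻ x in Metric.ball p ρ ∩ g ⁻¹' Set.Ioo 0 1,
      ENNReal.ofReal (g x ^ (-(3 / 2) : ℝ) * nonflat g x) < ⊤ := by
  have hgm := h.continuous.measurable
  obtain ⟨ψ, hψ, hψc, hψ0, hF⟩ := h.exists_setLIntegral_ball_le p ρ
  obtain ⟨C, hC, hCz⟩ := h.exists_integral_mul_secondDiff_le hψ hψc hψ0
  set N := Module.finrank ℝ E with hN
  set I := ∫ z : E, ((1 + ‖z‖) ^ (2 * N + 2))⁻¹ with hI
  let c : ℝ → ℝ := fun t => t ^ (-(3 / 2) : ℝ) * t ^ (N + 3)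
  have hcm : Measurable c := by fun_prop
  let k : E → ℝ → ℝ≥0∞ := fun z t =>
    (Set.Ioo (0 : ℝ) 1).indicator (fun t => ENNReal.ofReal (c t * ((t + ‖z‖) ^ (2 * (N + 2)))⁻¹)) t
  have hkm : Measurable (Function.uncurry k) := by
    have e1 : Function.uncurry k = {q : E × ℝ | q.2 ∈ Set.Ioo (0 : ℝ) 1}.indicator
        (fun q => ENNReal.ofReal (c q.2 * ((q.2 + ‖q.1‖) ^ (2 * (N + 2)))⁻¹)) := by
      funext ⟨z, t⟩
      simp [k, Function.uncurry, Set.indicator]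
    rw [e1]
    exact Measurable.indicator (by fun_prop) (measurable_snd measurableSet_Ioo)
  have hkz : ∀ z, Measurable (k z) := fun z => hkm.comp (measurable_const.prodMk measurable_id)
  let F : E → E → ℝ → ℝ≥0∞ := fun z x t => ENNReal.ofReal (secondDiff g x z) * k z t
  have hΔm : Measurable fun q : E × E => secondDiff g q.1 q.2 := h.continuous_secondDiff.measurable
  have hFm : ∀ z, Measurable (Function.uncurry (F z)) := fun z =>
    ((hΔm.comp (measurable_fst.prodMk measurable_const)).ennreal_ofReal).mul
      ((hkz z).comp measurable_snd)
  have hB : MeasurableSet (Metric.ball p ρ ∩ g ⁻¹' Set.Ioo 0 1) :=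
    Metric.isOpen_ball.measurableSet.inter (hgm measurableSet_Ioo)
  have s1 : ∫⁻ x in Metric.ball p ρ ∩ g ⁻¹' Set.Ioo 0 1,
      ENNReal.ofReal (g x ^ (-(3 / 2) : ℝ) * nonflat g x) ≤
      ∫⁻ x in Metric.ball p ρ, ∫⁻ z, F z x (g x) := by
    rw [← lintegral_indicator hB, ← lintegral_indicator Metric.isOpen_ball.measurableSet]
    refine lintegral_mono fun x => ?_
    by_cases hx : x ∈ Metric.ball p ρ ∩ g ⁻¹' Set.Ioo 0 1
    · have hg : g x ∈ Set.Ioo (0 : ℝ) 1 := hx.2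
      rw [Set.indicator_of_mem hx, Set.indicator_of_mem hx.1]
      have hc0 : 0 ≤ c (g x) := mul_nonneg (Real.rpow_nonneg hg.1.le _) (pow_nonneg hg.1.le _)
      have e1 : ∀ z, F z x (g x) = ENNReal.ofReal (c (g x)) * ENNReal.ofReal
          (((g x + ‖z‖) ^ (2 * (N + 2)))⁻¹ * secondDiff g x z) := by
        intro z
        simp only [F, k, Set.indicator_of_mem hg]
        have := hg.1
        rw [← ENNReal.ofReal_mul (h.secondDiff_nonneg x z), ← ENNReal.ofReal_mul hc0]
        congr 1; ring
      simp_rw [e1]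
      have hm : Measurable fun z => ENNReal.ofReal
          (((g x + ‖z‖) ^ (2 * (N + 2)))⁻¹ * secondDiff g x z) := by
        have := hΔm.comp (measurable_const (a := x) |>.prodMk measurable_id)
        fun_prop
      rw [lintegral_const_mul _ hm, nonflat, ← mul_assoc, ENNReal.ofReal_mul hc0,
        ENNReal.ofReal_toReal (h.nonflatIntegral_ne_top hg.1)]
      rfl
    · rw [Set.indicator_of_notMem hx]; exact zero_le
  have hjoint : Measurable fun q : E × E => F q.2 q.1 (g q.1) := by
    refine hΔm.ennreal_ofReal.mul ?_
    exact hkm.comp (measurable_snd.prodMk (hgm.comp measurable_fst))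
  have s2 : ∫⁻ x in Metric.ball p ρ, ∫⁻ z, F z x (g x) =
      ∫⁻ z, ∫⁻ x in Metric.ball p ρ, F z x (g x) :=
    lintegral_lintegral_swap hjoint.aemeasurable
  -- For fixed `z` the second difference is constant along `e`, so the integral splits into its
  -- average, of order `‖z‖²`, and an integral over the values `t` of `g`.
  have s3 : ∀ z, ∫⁻ x in Metric.ball p ρ, F z x (g x) ≤
      ENNReal.ofReal (C * ‖z‖ ^ 2) * ∫⁻ t, k z t := by
    intro z
    refine (hF (F z) (hFm z) fun x t s => by
      simp only [F, h.secondDiff_add_smul_left]).trans ?_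
    simp only [F]
    simp_rw [lintegral_const_mul _ (hkz z), ← mul_assoc]
    have hm : Measurable fun x => ENNReal.ofReal (ψ x) * ENNReal.ofReal (secondDiff g x z) := by
      have h1 := hψ.continuous.measurable
      have h2 := hΔm.comp (measurable_id.prodMk (measurable_const (a := z)))
      exact h1.ennreal_ofReal.mul h2.ennreal_ofReal
    rw [lintegral_mul_const _ hm]
    gcongr
    have e1 : ∀ x, ENNReal.ofReal (ψ x) * ENNReal.ofReal (secondDiff g x z) =
        ENNReal.ofReal (ψ x * secondDiff g x z) := fun x => (ENNReal.ofReal_mul (hψ0 x)).symm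
    simp_rw [e1]
    rw [← ofReal_integral_eq_lintegral_ofReal]
    · exact ENNReal.ofReal_le_ofReal (hCz z)
    · have := h.continuous
      exact (hψ.continuous.mul (by unfold secondDiff; fun_prop)).integrable_of_hasCompactSupport
        hψc.mul_right
    · exact Filter.Eventually.of_forall fun x => mul_nonneg (hψ0 x) (h.secondDiff_nonneg x z)
  have s4 : ∫⁻ z, ENNReal.ofReal (C * ‖z‖ ^ 2) * ∫⁻ t, k z t =
      ∫⁻ t, ∫⁻ z, ENNReal.ofReal (C * ‖z‖ ^ 2) * k z t := by
    rw [← lintegral_lintegral_swap]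
    · exact lintegral_congr fun z => (lintegral_const_mul _ (hkz z)).symm
    · have : Measurable fun q : E × ℝ => ENNReal.ofReal (C * ‖q.1‖ ^ 2) := by fun_prop
      exact (this.mul hkm).aemeasurable
  -- Power count: `t^(-3/2) t^(N+3) ∫ ‖z‖² (t + ‖z‖)^(-2N-4) dz` is of order `t^(-1/2)`. The
  -- quadratic bound gains one power of `t` over the linear one, which would leave `t^(-3/2)`.
  have s5 : ∀ t, ∫⁻ z, ENNReal.ofReal (C * ‖z‖ ^ 2) * k z t ≤
      (Set.Ioo (0 : ℝ) 1).indicator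
        (fun t => ENNReal.ofReal (C * I) * ENNReal.ofReal (t ^ (-(1 / 2) : ℝ))) t := by
    intro t
    by_cases ht : t ∈ Set.Ioo (0 : ℝ) 1
    · have h0 : 0 < t := ht.1
      have hc0 : 0 ≤ c t := mul_nonneg (Real.rpow_nonneg h0.le _) (pow_nonneg h0.le _)
      have hI0 : 0 ≤ I := integral_nonneg fun z => by positivity
      simp only [k, Set.indicator_of_mem ht]
      have e1 : ∀ z : E, ENNReal.ofReal (C * ‖z‖ ^ 2) *
          ENNReal.ofReal (c t * ((t + ‖z‖) ^ (2 * (N + 2)))⁻¹) ≤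
          ENNReal.ofReal (C * c t) * ENNReal.ofReal ((t + ‖z‖) ^ (2 * N + 2))⁻¹ := by
        intro z
        rw [← ENNReal.ofReal_mul (by positivity), ← ENNReal.ofReal_mul (by positivity)]
        refine ENNReal.ofReal_le_ofReal ?_
        have h2 : ‖z‖ ^ 2 ≤ (t + ‖z‖) ^ 2 :=
          pow_le_pow_left₀ (norm_nonneg _) (by linarith) 2
        rw [show 2 * (N + 2) = 2 * N + 2 + 2 by ring, pow_add _ (2 * N + 2) 2]
        have h3 : 0 < (t + ‖z‖) := by positivity
        calc C * ‖z‖ ^ 2 * (c t * ((t + ‖z‖) ^ (2 * N + 2) * (t + ‖z‖) ^ 2)⁻¹)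
            ≤ C * (t + ‖z‖) ^ 2 * (c t * ((t + ‖z‖) ^ (2 * N + 2) * (t + ‖z‖) ^ 2)⁻¹) := by
              gcongr
          _ = _ := by field_simp
      refine (lintegral_mono e1).trans (le_of_eq ?_)
      rw [lintegral_const_mul _ (by fun_prop), lintegral_inv_add_norm_pow (by omega) h0,
        ← ENNReal.ofReal_mul (by positivity), ← ENNReal.ofReal_mul (by positivity)]
      congr 1
      rw [← hI, ← hN]
      have e2 : t ^ (-(1 / 2) : ℝ) = t ^ (-(3 / 2) : ℝ) * t := by
        rw [← Real.rpow_add_one h0.ne']; norm_num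
      simp only [c]
      rw [e2, show 2 * N + 2 = N + (N + 2) by ring, pow_add t N (N + 2),
        show N + 3 = N + 2 + 1 by ring, pow_succ t (N + 2)]
      field_simp
    · simp [k, ht]
  refine (s1.trans_eq s2).trans_lt ((lintegral_mono s3).trans_lt ?_)
  rw [s4]
  refine (lintegral_mono s5).trans_lt ?_
  rw [lintegral_indicator measurableSet_Ioo, lintegral_const_mul _ (by fun_prop)]
  exact ENNReal.mul_lt_top ENNReal.ofReal_lt_top (setLIntegral_rpow_lt_top (by norm_num))

end IsGraphFunction

end NonflatIntegrability

/-! ### A convergent and a divergent logarithmic integral -/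

section LogarithmicIntegrals

open scoped ENNReal Topology

theorem measurable_X (i : ℕ) : Measurable (X i) := by
  induction i with
  | zero => exact measurable_id
  | succ i ih =>
    simp only [X]
    exact (measurable_const.sub ih.log).inv

theorem measurable_Xprod (i : ℕ) : Measurable (Xprod i) := by
  unfold Xprod
  exact Finset.measurable_fun_prod _ fun j _ => measurable_X j

theorem hasDerivAt_X_div (i : ℕ) {D s : ℝ} (hD : 0 < D) (hs : 0 < s) (hsD : s ≤ D) :
    HasDerivAt (fun s => X i (s / D)) (X i (s / D) * Xprod i (s / D) / s) s := by
  have h1 : 0 < s / D := div_pos hs hD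
  have h2 : s / D ≤ 1 := (div_le_one hD).2 hsD
  have := (hasDerivAt_X i h1 h2).comp s ((hasDerivAt_id s).div_const D)
  refine this.congr_deriv ?_
  field_simp

theorem tendsto_X_div_zero (i : ℕ) {D : ℝ} (hD : 0 < D) :
    Filter.Tendsto (fun s => X i (s / D)) (𝓝[>] 0) (𝓝[>] 0) := by
  refine (tendsto_X_zero i).comp ?_
  refine tendsto_nhdsWithin_iff.2 ⟨?_, ?_⟩
  · have : Filter.Tendsto (fun s : ℝ => s / D) (𝓝 0) (𝓝 (0 / D)) :=
      (continuous_id.div_const D).tendsto 0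
    rw [zero_div] at this
    exact this.mono_left nhdsWithin_le_nhds
  · filter_upwards [self_mem_nhdsWithin] with s hs
    exact div_pos hs hD

/-- The integrand has the primitive `2 X_1^(1/2)`, which tends to `0` at the boundary. -/
theorem setLIntegral_X_one_lt_top {D δ : ℝ} (hD : 0 < D) (hδD : δ ≤ D) :
    ∫⁻ s in Set.Ioo 0 δ, ENNReal.ofReal (s⁻¹ * X 1 (s / D) ^ (3 / 2 : ℝ)) < ⊤ := by
  have hpos : ∀ s ∈ Set.Ioc 0 δ, 0 < X 1 (s / D) := fun s hs =>
    X_pos 1 (div_pos hs.1 hD) ((div_le_one hD).2 (hs.2.trans hδD))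
  have hd : ∀ s ∈ Set.Ioc 0 δ, HasDerivAt (fun s => 2 * X 1 (s / D) ^ (1 / 2 : ℝ))
      (s⁻¹ * X 1 (s / D) ^ (3 / 2 : ℝ)) s := by
    intro s hs
    have h1 := hpos s hs
    refine (((hasDerivAt_X_div 1 hD hs.1 (hs.2.trans hδD)).rpow_const
      (Or.inl h1.ne')).const_mul 2).congr_deriv ?_
    have e1 : Xprod 1 (s / D) = X 1 (s / D) := by simp [Xprod]
    have e2 : X 1 (s / D) ^ (3 / 2 : ℝ) = X 1 (s / D) ^ (1 / 2 - 1 : ℝ) * X 1 (s / D) ^ 2 := by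
      rw [← Real.rpow_natCast, ← Real.rpow_add h1]; norm_num
    rw [e1, e2]
    ring
  -- The primitive is redefined at `0`: the convention `log 0 = 0` gives `X_1` the value `1` there,
  -- while its limit is `0`.
  have hne : ∀ s ∈ Set.Ioc 0 δ, Function.update (fun s => 2 * X 1 (s / D) ^ (1 / 2 : ℝ)) 0 0
      =ᶠ[𝓝 s] fun s => 2 * X 1 (s / D) ^ (1 / 2 : ℝ) := by
    intro s hs
    filter_upwards [lt_mem_nhds hs.1] with y hy
    rw [Function.update_of_ne hy.ne']
  have hint : IntegrableOn (fun s => s⁻¹ * X 1 (s / D) ^ (3 / 2 : ℝ)) (Set.Ioc 0 δ) := by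
    refine intervalIntegral.integrableOn_deriv_of_nonneg
      (g := Function.update (fun s => 2 * X 1 (s / D) ^ (1 / 2 : ℝ)) 0 0) ?_
      (fun s hs => (hd s ⟨hs.1, hs.2.le⟩).congr_of_eventuallyEq (hne s ⟨hs.1, hs.2.le⟩))
      (fun s hs => mul_nonneg (inv_nonneg.2 hs.1.le)
        (Real.rpow_nonneg (hpos s ⟨hs.1, hs.2.le⟩).le _))
    intro s hs
    rcases hs.1.eq_or_lt with rfl | h0
    · rw [continuousWithinAt_update_same]
      have h1 : Filter.Tendsto (fun s => X 1 (s / D)) (𝓝[>] 0) (𝓝 0) :=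
        (tendsto_X_div_zero 1 hD).mono_right nhdsWithin_le_nhds
      have h2 := (h1.rpow_const (p := 1 / 2) (Or.inr (by norm_num))).const_mul 2
      rw [Real.zero_rpow (by norm_num), mul_zero] at h2
      exact h2.mono_left (nhdsWithin_mono _ fun y hy =>
        lt_of_le_of_ne hy.1.1 (Ne.symm hy.2))
    · exact ((hd s ⟨h0, hs.2⟩).congr_of_eventuallyEq
        (hne s ⟨h0, hs.2⟩)).continuousAt.continuousWithinAt
  have hint' := hint.mono_set Set.Ioo_subset_Ioc_self
  rw [← ofReal_integral_eq_lintegral_ofReal hint']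
  · exact ENNReal.ofReal_lt_top
  · filter_upwards [ae_restrict_mem measurableSet_Ioo] with s hs
    exact mul_nonneg (inv_nonneg.2 hs.1.le) (Real.rpow_nonneg (hpos s ⟨hs.1, hs.2.le⟩).le _)

/-- The primitive `log X_r` tends to `-∞`. This divergence is the source of the final contradiction.
-/
theorem setLIntegral_Xprod_eq_top (r : ℕ) {D δ : ℝ} (hD : 0 < D) (hδ : 0 < δ) (hδD : δ ≤ D) :
    ∫⁻ s in Set.Ioo 0 δ, ENNReal.ofReal (s⁻¹ * Xprod r (s / D)) = ⊤ := by
  by_contra hfin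
  have hIoo : Set.Ioo 0 δ ∈ 𝓝[>] (0 : ℝ) := Ioo_mem_nhdsGT hδ
  have hpos : ∀ i, ∀ s ∈ Set.Ioo 0 δ, 0 < X i (s / D) := fun i s hs =>
    X_pos i (div_pos hs.1 hD) ((div_le_one hD).2 (hs.2.le.trans hδD))
  have hd : ∀ s ∈ Set.Ioo 0 δ, HasDerivAt (fun s => Real.log (X r (s / D)))
      (s⁻¹ * Xprod r (s / D)) s := by
    intro s hs
    have h1 := (hpos r s hs).ne'
    refine ((hasDerivAt_X_div r hD hs.1 (hs.2.le.trans hδD)).log h1).congr_deriv ?_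
    have := hs.1.ne'
    field_simp
  refine not_integrableOn_of_tendsto_norm_atTop_of_deriv_isBigO_filter
    (f := fun s => Real.log (X r (s / D))) (g := fun s => s⁻¹ * Xprod r (s / D))
    (k := Set.Ioo 0 δ) (𝓝[>] 0) hIoo ?_ ?_ ?_ ?_
  · filter_upwards [hIoo] with s hs using (hd s hs).differentiableAt
  · exact Filter.tendsto_abs_atBot_atTop.comp
      (Real.tendsto_log_nhdsGT_zero.comp (tendsto_X_div_zero r hD))
  · refine Filter.EventuallyEq.isBigO ?_
    filter_upwards [hIoo] with s hs using (hd s hs).deriv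
  · have hm : Measurable fun s => s⁻¹ * Xprod r (s / D) :=
      measurable_inv.mul ((measurable_Xprod r).comp (measurable_id.div_const D))
    refine ⟨hm.aestronglyMeasurable, ?_⟩
    rw [hasFiniteIntegral_iff_ofReal]
    · exact lt_top_iff_ne_top.2 hfin
    · filter_upwards [ae_restrict_mem measurableSet_Ioo] with s hs
      exact mul_nonneg (inv_nonneg.2 hs.1.le) (Xprod_pos r (div_pos hs.1 hD)
        ((div_le_one hD).2 (hs.2.le.trans hδD))).le

end LogarithmicIntegrals

/-! ### Potentials of sets at a distance, and their symbol estimates -/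

section Potentials

set_option linter.unusedSectionVars false

variable {E : Type} [NormedAddCommGroup E] [InnerProductSpace ℝ E] [FiniteDimensional ℝ E]
  [MeasurableSpace E] [BorelSpace E]

theorem integrableOn_inv_norm_sub_pow {p : ℕ} (hp : Module.finrank ℝ E < p) {S : Set E}
    (hS : MeasurableSet S) {x : E} {ρ : ℝ} (hρ : 0 < ρ) (h : ∀ y ∈ S, ρ ≤ ‖x - y‖) :
    IntegrableOn (fun y => (‖x - y‖ ^ p)⁻¹) S := by
  have h1 : Integrable fun y : E => 2 ^ p * ((ρ + ‖x - y‖) ^ p)⁻¹ :=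
    ((integrable_inv_add_norm_pow (E := E) hp hρ).comp_sub_left x).const_mul _
  refine h1.integrableOn.mono' (Measurable.aestronglyMeasurable (by fun_prop)) ?_
  filter_upwards [ae_restrict_mem hS] with y hy
  have h2 := h y hy
  rw [Real.norm_of_nonneg (by positivity), ← div_eq_mul_inv, ← div_pow, ← inv_pow]
  refine pow_le_pow_left₀ (by positivity) ?_ _
  rw [inv_le_comm₀ (hρ.trans_le h2) (by positivity), inv_div, div_le_iff₀ (by positivity)]
  linarith

/-- The potential of a set `S` for a translation invariant kernel. -/
def potential {F : Type} [NormedAddCommGroup F] [NormedSpace ℝ F] (κ : E → F) (S : Set E)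
    (x : E) : F := ∫ y in S, κ (x - y)

/-- Kernels with the differentiability properties of `‖z‖ ^ (-p)` away from the origin. -/
abbrev IsKernel {F : Type} [NormedAddCommGroup F] [NormedSpace ℝ F] (p : ℕ) (κ : E → F) : Prop :=
  IsSymbol (fun z : {z : E // z ≠ 0} => z.1) (fun z => ‖z.1‖) (fun z => (‖z.1‖ ^ p)⁻¹)
    (fun _ => κ)

variable {F : Type} [NormedAddCommGroup F] [NormedSpace ℝ F] {p : ℕ} {κ : E → F}

theorem IsKernel.fderiv (h : IsKernel p κ) : IsKernel (p + 1) (fderiv ℝ κ) := by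
  have := IsSymbol.fderiv h
  refine this.mono (fun z => norm_pos_iff.2 z.2) (fun z => by positivity) 1 fun z => ?_
  rw [one_mul, pow_succ, mul_inv, div_eq_mul_inv]

theorem IsKernel.exists_norm_le (h : IsKernel p κ) :
    ∃ C, 0 ≤ C ∧ ∀ z, z ≠ 0 → ‖κ z‖ ≤ C * (‖z‖ ^ p)⁻¹ := by
  obtain ⟨C, hC⟩ := h.value
  exact ⟨|C|, abs_nonneg C, fun z hz => (hC ⟨z, hz⟩).trans
    (mul_le_mul_of_nonneg_right (le_abs_self C) (by positivity))⟩

theorem IsKernel.aestronglyMeasurable (h : IsKernel p κ) {S : Set E} (hS : MeasurableSet S) {x : E}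
    (hx : ∀ y ∈ S, x ≠ y) : AEStronglyMeasurable (fun y => κ (x - y)) (volume.restrict S) := by
  refine ContinuousOn.aestronglyMeasurable (fun y hy => ?_) hS
  have h1 := (h.smooth ⟨x - y, sub_ne_zero.2 (hx y hy)⟩).continuousAt
  exact (ContinuousAt.comp (f := fun y => x - y) h1 (by fun_prop)).continuousWithinAt

theorem half_norm_sub_le {S : Set E} {x₀ x : E} {ρ : ℝ} (h : ∀ y ∈ S, ρ ≤ ‖x₀ - y‖)
    (hx : x ∈ Metric.ball x₀ (ρ / 2)) {y : E} (hy : y ∈ S) : ‖x₀ - y‖ / 2 ≤ ‖x - y‖ := by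
  rw [mem_ball_iff_norm, norm_sub_rev] at hx
  have := h y hy
  have := norm_sub_le_norm_sub_add_norm_sub x₀ x y
  linarith

/-- Differentiation under the integral. Within the ball of radius `ρ/2` all distances to `S` are at
least half of those from the centre, which dominates the kernels by integrable functions of `y`
alone. -/
theorem IsKernel.hasFDerivAt_potential (h : IsKernel p κ) (hp : Module.finrank ℝ E < p)
    {S : Set E} (hS : MeasurableSet S) {x₀ x : E} {ρ : ℝ} (hρ : 0 < ρ)
    (hd : ∀ y ∈ S, ρ ≤ ‖x₀ - y‖) (hx : x ∈ Metric.ball x₀ (ρ / 2)) :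
    HasFDerivAt (potential κ S) (potential (_root_.fderiv ℝ κ) S x) x := by
  obtain ⟨C, hC0, hC⟩ := h.exists_norm_le
  obtain ⟨C', hC0', hC'⟩ := h.fderiv.exists_norm_le
  have hlow : ∀ {x' y}, x' ∈ Metric.ball x₀ (ρ / 2) → y ∈ S → ‖x₀ - y‖ / 2 ≤ ‖x' - y‖ :=
    fun hx' hy => half_norm_sub_le hd hx' hy
  have hne : ∀ {x' y}, x' ∈ Metric.ball x₀ (ρ / 2) → y ∈ S → x' ≠ y := by
    intro x' y hx' hy
    rw [← sub_ne_zero, ← norm_pos_iff]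
    have := hd y hy
    linarith [hlow hx' hy]
  have hint : ∀ {q : ℕ}, Module.finrank ℝ E < q →
      IntegrableOn (fun y => 2 ^ q * (‖x₀ - y‖ ^ q)⁻¹) S := fun hq =>
    (integrableOn_inv_norm_sub_pow hq hS hρ hd).const_mul _
  have hbd : ∀ {q : ℕ} {x' y}, x' ∈ Metric.ball x₀ (ρ / 2) → y ∈ S →
      (‖x' - y‖ ^ q)⁻¹ ≤ 2 ^ q * (‖x₀ - y‖ ^ q)⁻¹ := by
    intro q x' y hx' hy
    have h1 := hd y hy
    have h2 := hlow hx' hy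
    rw [← div_eq_mul_inv, ← div_pow, ← inv_pow]
    refine pow_le_pow_left₀ (by positivity) ?_ _
    rw [← inv_div]
    exact inv_anti₀ (by linarith) h2
  refine hasFDerivAt_integral_of_dominated_of_fderiv_le
    (bound := fun y => C' * (2 ^ (p + 1) * (‖x₀ - y‖ ^ (p + 1))⁻¹))
    (F' := fun x y => _root_.fderiv ℝ κ (x - y)) (Metric.isOpen_ball.mem_nhds hx) ?_ ?_ ?_ ?_ ?_ ?_
  · filter_upwards [Metric.isOpen_ball.mem_nhds hx] with x' hx'
    exact h.aestronglyMeasurable hS fun y hy => hne hx' hy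
  · refine ((hint hp).const_mul C).mono' (h.aestronglyMeasurable hS fun y hy => hne hx hy) ?_
    filter_upwards [ae_restrict_mem hS] with y hy
    exact (hC _ (sub_ne_zero.2 (hne hx hy))).trans (mul_le_mul_of_nonneg_left (hbd hx hy) hC0)
  · exact h.fderiv.aestronglyMeasurable hS fun y hy => hne hx hy
  · filter_upwards [ae_restrict_mem hS] with y hy x' hx'
    exact (hC' _ (sub_ne_zero.2 (hne hx' hy))).trans (mul_le_mul_of_nonneg_left (hbd hx' hy) hC0')
  · exact (hint (by omega)).const_mul C'
  · filter_upwards [ae_restrict_mem hS] with y hy x' hx'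
    have h1 := (h.smooth ⟨x' - y, sub_ne_zero.2 (hne hx' hy)⟩).differentiableAt (by simp)
    have h2 := HasFDerivAt.comp x' h1.hasFDerivAt ((hasFDerivAt_id x').sub_const y)
    rwa [ContinuousLinearMap.comp_id] at h2

theorem IsKernel.norm_potential_le (h : IsKernel p κ) (hp : Module.finrank ℝ E < p) :
    ∃ C, ∀ (S : Set E) (x : E) (ρ : ℝ), MeasurableSet S → 0 < ρ → (∀ y ∈ S, ρ ≤ ‖x - y‖) →
      ‖potential κ S x‖ ≤ C * ∫ y in S, (‖x - y‖ ^ p)⁻¹ := by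
  obtain ⟨C, hC0, hC⟩ := h.exists_norm_le
  refine ⟨C, fun S x ρ hS hρ hd => ?_⟩
  rw [← integral_const_mul]
  refine norm_integral_le_of_norm_le ((integrableOn_inv_norm_sub_pow hp hS hρ hd).const_mul C) ?_
  filter_upwards [ae_restrict_mem hS] with y hy
  exact hC _ (norm_pos_iff.1 (hρ.trans_le (hd y hy)))

theorem IsKernel.contDiffOn_potential (hp : Module.finrank ℝ E < p) {S : Set E}
    (hS : MeasurableSet S) {x₀ : E} {ρ : ℝ} (hρ : 0 < ρ)
    (hd : ∀ y ∈ S, ρ ≤ ‖x₀ - y‖) (n : ℕ) (h : IsKernel p κ) :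
    ContDiffOn ℝ n (potential κ S) (Metric.ball x₀ (ρ / 2)) := by
  induction n generalizing F p with
  | zero =>
    exact contDiffOn_zero.2 fun x hx =>
      (h.hasFDerivAt_potential hp hS hρ hd hx).continuousAt.continuousWithinAt
  | succ n ih =>
    refine (contDiffOn_succ_iff_fderiv_of_isOpen (n := n) Metric.isOpen_ball).2 ⟨fun x hx =>
      (h.hasFDerivAt_potential hp hS hρ hd hx).differentiableAt.differentiableWithinAt,
      by simp, ?_⟩
    exact (ih (by omega) h.fderiv).congr fun x hx =>
      (h.hasFDerivAt_potential hp hS hρ hd hx).fderiv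

/-- Each derivative costs one factor `‖x - y‖⁻¹ ≤ (c ρ)⁻¹` in the kernel. The weight is the absolute
potential of `S` itself and not a power of `ρ`, so the smallness of a small set is inherited by all
derivatives. -/
theorem IsKernel.isSymbol_potential {ι : Type} {pt : ι → E} {ρ : ι → ℝ} (hρ : ∀ i, 0 < ρ i)
    {c : ℝ} (hc : 0 < c) {S : ι → Set E} (hS : ∀ i, MeasurableSet (S i))
    (hd : ∀ i, ∀ y ∈ S i, c * ρ i ≤ ‖pt i - y‖) (hp : Module.finrank ℝ E < p) (h : IsKernel p κ) :
    IsSymbol pt ρ (fun i => ∫ y in S i, (‖pt i - y‖ ^ p)⁻¹) (fun i => potential κ (S i)) := by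
  have hcρ : ∀ i, 0 < c * ρ i := fun i => mul_pos hc (hρ i)
  refine ⟨fun i => contDiffAt_infty.2 fun n =>
    (h.contDiffOn_potential hp (hS i) (hcρ i) (hd i) n).contDiffAt
      (Metric.ball_mem_nhds _ (by have := hcρ i; linarith)), fun n => ?_⟩
  induction n generalizing F p with
  | zero =>
    obtain ⟨C, hC⟩ := h.norm_potential_le hp
    exact ⟨C, fun i => hC _ _ _ (hS i) (hcρ i) (hd i)⟩
  | succ n ih =>
    obtain ⟨C, hC⟩ := h.norm_potential_le hp
    refine ⟨⟨C, fun i => hC _ _ _ (hS i) (hcρ i) (hd i)⟩, ?_⟩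
    have h1 := (ih (p := p + 1) (by omega) h.fderiv).mono (K := c⁻¹)
      (W' := fun i => (∫ y in S i, (‖pt i - y‖ ^ p)⁻¹) / ρ i) hρ
      (fun i => integral_nonneg fun y => by positivity) (fun i => ?_)
    · refine h1.congr fun i => ?_
      filter_upwards [Metric.ball_mem_nhds (pt i) (half_pos (hcρ i))] with x hx
      exact ((h.hasFDerivAt_potential hp (hS i) (hcρ i) (hd i) hx).fderiv).symm
    · have hi1 := integrableOn_inv_norm_sub_pow hp (hS i) (hcρ i) (hd i)
      have hi2 := integrableOn_inv_norm_sub_pow (p := p + 1) (by omega) (hS i) (hcρ i) (hd i)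
      rw [show c⁻¹ * ((∫ y in S i, (‖pt i - y‖ ^ p)⁻¹) / ρ i) =
        (c * ρ i)⁻¹ * ∫ y in S i, (‖pt i - y‖ ^ p)⁻¹ by rw [mul_inv]; ring, ← integral_const_mul]
      refine setIntegral_mono_on hi2 (hi1.const_mul _) (hS i) fun y hy => ?_
      have h2 := hd i y hy
      have h3 := hcρ i
      rw [pow_succ, mul_inv, mul_comm]
      exact mul_le_mul_of_nonneg_right (inv_anti₀ h3 h2) (by positivity)

/-- For an even exponent the kernel is a real power of the bilinear symbol `⟪z, z⟫`; this is why the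
Riesz exponent is taken of the form `2k`. -/
theorem isKernel_inv_norm_pow (k : ℕ) : IsKernel (2 * k) fun z : E => (‖z‖ ^ (2 * k))⁻¹ := by
  have hpos : ∀ z : {z : E // z ≠ 0}, 0 < ‖z.1‖ := fun z => norm_pos_iff.2 z.2
  have hid : IsSymbol (fun z : {z : E // z ≠ 0} => z.1) (fun z => ‖z.1‖) (fun z => ‖z.1‖)
      (fun _ z => z) := by
    refine IsSymbol.of_fderiv (fun _ => contDiffAt_id) 1 (by simp) ?_
    refine (IsSymbol.const (fun _ => ContinuousLinearMap.id ℝ E) 1 fun z => ?_).congr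
      fun z => Filter.Eventually.of_forall fun y => ?_
    · rw [one_mul, div_self (hpos z).ne']; exact ContinuousLinearMap.norm_id_le
    · exact fderiv_id.symm
  have h1 := (((hid.bilin (innerSL ℝ) hid).rpow
    (fun z => mul_pos (hpos z) (hpos z)) 1 one_pos (fun z => by
      rw [one_mul, innerSL_apply_apply, real_inner_self_eq_norm_mul_norm])) (-(k : ℝ)))
  refine (h1.congr fun z => Filter.Eventually.of_forall fun y => ?_).mono hpos
    (fun z => by positivity) 1 (fun z => ?_)
  · have e1 : innerSL ℝ y y = ‖y‖ ^ 2 := real_inner_self_eq_norm_sq y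
    beta_reduce
    rw [e1, Real.rpow_neg (by positivity), Real.rpow_natCast, pow_mul]
  · rw [one_mul, Real.rpow_neg (by positivity), Real.rpow_natCast, ← sq, pow_mul]

end Potentials

/-! ### The Riesz potential of a half-space -/

section HalfSpace

set_option linter.unusedSectionVars false

open scoped Pointwise

variable {E : Type} [NormedAddCommGroup E] [InnerProductSpace ℝ E] [FiniteDimensional ℝ E]
  [MeasurableSpace E] [BorelSpace E]

theorem measurableSet_halfSpace (n : E) (t : ℝ) : MeasurableSet {z : E | t ≤ inner ℝ n z} := by
  have : Continuous fun z : E => (inner ℝ n z : ℝ) := by fun_prop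
  exact measurableSet_le measurable_const this.measurable

/-- The reflection in the hyperplane orthogonal to `n - e` exchanges the two unit normals. -/
theorem setIntegral_halfSpace_rotate {n e : E} (hn : ‖n‖ = 1) (he : ‖e‖ = 1) (f : ℝ → ℝ) (t : ℝ) :
    ∫ z in {z : E | t ≤ inner ℝ n z}, f ‖z‖ = ∫ z in {z : E | t ≤ inner ℝ e z}, f ‖z‖ := by
  let R : E ≃ₗᵢ[ℝ] E := (ℝ ∙ (n - e))ᗮ.reflection
  have hR : R n = e := Submodule.reflection_sub (hn.trans he.symm)
  rw [← R.measurePreserving.setIntegral_preimage_emb R.toHomeomorph.measurableEmbedding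
    (fun z => f ‖z‖) {z : E | t ≤ inner ℝ e z}]
  have : R ⁻¹' {z : E | t ≤ inner ℝ e z} = {z : E | t ≤ inner ℝ n z} := by
    ext z
    simp only [Set.mem_preimage, Set.mem_ofPred_eq]
    rw [← hR, R.inner_map_map]
  rw [this]
  simp only [R.norm_map]

theorem setIntegral_halfSpace_scale (n : E) (p : ℕ) {t : ℝ} (ht : 0 < t) :
    ∫ z in {z : E | t ≤ inner ℝ n z}, (‖z‖ ^ p)⁻¹ =
      t ^ Module.finrank ℝ E / t ^ p * ∫ z in {z : E | 1 ≤ inner ℝ n z}, (‖z‖ ^ p)⁻¹ := by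
  have h1 := Measure.setIntegral_comp_smul_of_pos (volume : Measure E) (fun z : E => (‖z‖ ^ p)⁻¹)
    {z : E | 1 ≤ inner ℝ n z} ht
  have h2 : t • {z : E | 1 ≤ inner ℝ n z} = {z : E | t ≤ inner ℝ n z} := by
    ext z
    rw [Set.mem_smul_set_iff_inv_smul_mem₀ ht.ne']
    simp only [Set.mem_ofPred_eq, inner_smul_right]
    rw [inv_mul_eq_div, le_div_iff₀ ht, one_mul]
  rw [h2] at h1
  simp only [norm_smul, Real.norm_of_nonneg ht.le, mul_pow, mul_inv, smul_eq_mul] at h1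
  rw [integral_const_mul] at h1
  have := ht.ne'
  field_simp at h1 ⊢
  linarith

/-- By rotation and scaling the potential is a fixed constant times a power of the distance `t`. A
suitable power of the potential therefore recovers the distance exactly. -/
theorem setIntegral_halfSpace {n e : E} (hn : ‖n‖ = 1) (he : ‖e‖ = 1) (p : ℕ) {t : ℝ}
    (ht : 0 < t) (x : E) :
    ∫ y in {y : E | t ≤ inner ℝ n (x - y)}, (‖x - y‖ ^ p)⁻¹ =
      t ^ Module.finrank ℝ E / t ^ p * ∫ z in {z : E | 1 ≤ inner ℝ e z}, (‖z‖ ^ p)⁻¹ := by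
  rw [← setIntegral_halfSpace_rotate hn he (fun s => (s ^ p)⁻¹), ← setIntegral_halfSpace_scale n p ht]
  exact (Measure.measurePreserving_sub_left (volume : Measure E) x).setIntegral_preimage_emb
    (Homeomorph.subLeft x).measurableEmbedding (fun z : E => (‖z‖ ^ p)⁻¹) {z : E | t ≤ inner ℝ n z}

theorem setIntegral_halfSpace_pos {e : E} (he : ‖e‖ = 1) {p : ℕ} (hp : Module.finrank ℝ E < p) :
    0 < ∫ z in {z : E | 1 ≤ inner ℝ e z}, (‖z‖ ^ p)⁻¹ := by
  have hn : ∀ z ∈ {z : E | 1 ≤ inner ℝ e z}, 1 ≤ ‖(0 : E) - z‖ := by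
    intro z hz
    have h1 := real_inner_le_norm e z
    rw [he, one_mul] at h1
    rw [zero_sub, norm_neg]
    exact le_trans hz h1
  have hint := integrableOn_inv_norm_sub_pow hp (measurableSet_halfSpace e 1) one_pos hn
  simp only [zero_sub, norm_neg] at hint hn
  rw [setIntegral_pos_iff_support_of_nonneg_ae
    (Filter.Eventually.of_forall fun z => by positivity) hint]
  have ho : IsOpen {z : E | 1 < inner ℝ e z} := by
    have : Continuous fun z : E => (inner ℝ e z : ℝ) := by fun_prop
    exact isOpen_lt continuous_const this
  refine (ho.measure_pos volume ⟨(2 : ℝ) • e, ?_⟩).trans_le (measure_mono fun z hz => ?_)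
  · simp [inner_smul_right, he]
  · have h1 : 1 ≤ inner ℝ e z := le_of_lt hz
    refine ⟨?_, h1⟩
    have := hn z h1
    simp only [Function.mem_support]
    positivity

end HalfSpace

/-! ### Powers of small perturbations of one -/

section PowerSymbol

variable {ι E : Type} [NormedAddCommGroup E] [NormedSpace ℝ E] {pt : ι → E} {ρ V : ι → ℝ}

theorem abs_one_add_rpow_sub_one_le {w β : ℝ} (hw : 0 ≤ w) (h0 : β ≤ 0) (h1 : -1 ≤ β) :
    |(1 + w) ^ β - 1| ≤ w := by
  have h2 : (1 + w) ^ β ≤ 1 := Real.rpow_le_one_of_one_le_of_nonpos (by linarith) h0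
  have h3 : (1 + w) ^ (-1 : ℝ) ≤ (1 + w) ^ β := Real.rpow_le_rpow_of_exponent_le (by linarith) h1
  have h4 : 1 - w ≤ (1 + w) ^ (-1 : ℝ) := by
    rw [Real.rpow_neg_one, ← one_div, le_div_iff₀ (by linarith)]
    nlinarith
  rw [abs_le]
  constructor <;> linarith

/-- `1 + w` has weight `1` only, but the difference has value at most `w` and derivative `β (1 +
w)^(β-1) Dw`, so it keeps the small weight of `w`. -/
theorem IsSymbol.one_add_rpow_sub_one {w : ι → E → ℝ} (hw : IsSymbol pt ρ V w)
    (hρ : ∀ i, 0 < ρ i) (hV : ∀ i, 0 ≤ V i) (hw0 : ∀ i, 0 ≤ w i (pt i)) {M : ℝ}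
    (hM : ∀ i, V i ≤ M) {β : ℝ} (h0 : β ≤ 0) (h1 : -1 ≤ β) :
    IsSymbol pt ρ V (fun i y => (1 + w i y) ^ β - 1) := by
  have hone : IsSymbol pt ρ (fun _ => 1) (fun i y => 1 + w i y) :=
    (IsSymbol.const (fun _ => (1 : ℝ)) 1 (by simp)).add
      (hw.mono hρ hV M fun i => by rw [mul_one]; exact hM i)
  have hlow : ∀ i, 1 * (1 : ℝ) ≤ 1 + w i (pt i) := fun i => by linarith [hw0 i]
  have hr := fun γ => hone.rpow (fun _ => one_pos) 1 one_pos hlow γ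
  obtain ⟨C, hC⟩ := hw.value
  refine IsSymbol.of_fderiv (fun i => ((hr β).smooth i).sub contDiffAt_const) C (fun i => ?_) ?_
  · refine le_trans ?_ (hC i)
    rw [Real.norm_eq_abs, Real.norm_of_nonneg (hw0 i)]
    exact abs_one_add_rpow_sub_one_le (hw0 i) h0 h1
  · have h2 := ((hr (β - 1)).const_mul β).smul hw.fderiv
    simp only [Real.one_rpow, one_mul] at h2
    refine h2.congr fun i => ?_
    filter_upwards [((hw.smooth i).of_le (by simp : (1 : WithTop ℕ∞) ≤ ∞)).eventually (by simp),
      (hone.smooth i).continuousAt.eventually (lt_mem_nhds (by linarith [hw0 i] :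
        (0 : ℝ) < 1 + w i (pt i)))] with y hy hy'
    exact ((((hy.differentiableAt (by simp)).hasFDerivAt.const_add 1).rpow_const (p := β)
      (Or.inl hy'.ne')).sub_const 1).fderiv.symm

end PowerSymbol

/-! ### A smooth distance from a Riesz potential -/

section RegularDistance

set_option linter.unusedSectionVars false

variable {E : Type} [NormedAddCommGroup E] [InnerProductSpace ℝ E] [FiniteDimensional ℝ E]
  [MeasurableSpace E] [BorelSpace E]

namespace IsGraphFunction

variable {e : E} {K : ℝ} {g : E → ℝ}

theorem le_mul_norm_sub (h : IsGraphFunction e K g) {x y : E} (hy : g y ≤ 0) :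
    g x ≤ K * ‖x - y‖ := by
  linarith [h.lip x y, le_abs_self (g x - g y)]

/-- Splitting the Riesz potential of `{g ≤ 0}` along a supporting hyperplane. -/
theorem potential_eq (h : IsGraphFunction e K g) {x ξ : E}
    (hξ : ∀ y, g y ≤ g x + inner ℝ ξ (y - x)) (hξ1 : 1 ≤ ‖ξ‖) {y : E} (hy : 0 < g y) :
    potential (fun z : E => (‖z‖ ^ (2 * (Module.finrank ℝ E + 2)))⁻¹) {z | g z ≤ 0} y =
      ((((g x + inner ℝ ξ (y - x)) / ‖ξ‖) ^ (Module.finrank ℝ E + 4))⁻¹ *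
        ∫ z in {z : E | 1 ≤ inner ℝ e z}, (‖z‖ ^ (2 * (Module.finrank ℝ E + 2)))⁻¹) +
      potential (fun z : E => (‖z‖ ^ (2 * (Module.finrank ℝ E + 2)))⁻¹)
        {z | g z ≤ 0 ∧ 0 < g x + inner ℝ ξ (z - x)} y := by
  have hK := h.one_le_K
  have hξ0 : 0 < ‖ξ‖ := by linarith
  set L : E → ℝ := fun z => g x + inner ℝ ξ (z - x) with hL
  have hLc : Continuous L := by fun_prop
  have hLy : 0 < L y := hy.trans_le (hξ y)
  have hgm := h.continuous.measurable
  have hsplit : {z | g z ≤ 0} = {z | L z ≤ 0} ∪ {z | g z ≤ 0 ∧ 0 < L z} := by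
    ext z
    simp only [Set.mem_ofPred_eq, Set.mem_union]
    have := hξ z
    constructor
    · intro hz
      rcases le_or_gt (L z) 0 with h1 | h1
      · exact Or.inl h1
      · exact Or.inr ⟨hz, h1⟩
    · rintro (h1 | h1)
      · exact this.trans h1
      · exact h1.1
  have hm1 : MeasurableSet {z | L z ≤ 0} := measurableSet_le hLc.measurable measurable_const
  have hm2 : MeasurableSet {z | g z ≤ 0 ∧ 0 < L z} :=
    (measurableSet_le hgm measurable_const).inter (measurableSet_lt measurable_const hLc.measurable)
  have hdist : ∀ z, g z ≤ 0 → g y / K ≤ ‖y - z‖ := fun z hz => by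
    rw [div_le_iff₀ (by linarith), mul_comm]; exact h.le_mul_norm_sub hz
  have hρ : 0 < g y / K := by positivity
  have hp : Module.finrank ℝ E < 2 * (Module.finrank ℝ E + 2) := by omega
  have key : {z | L z ≤ 0} = {z | L y / ‖ξ‖ ≤ inner ℝ (‖ξ‖⁻¹ • ξ) (y - z)} := by
    ext z
    simp only [Set.mem_ofPred_eq, inner_smul_left, hL, inner_sub_right]
    rw [div_eq_inv_mul]
    have : ((starRingEnd ℝ) ‖ξ‖⁻¹) = ‖ξ‖⁻¹ := rfl
    rw [this, ← mul_sub, mul_le_mul_iff_of_pos_left (inv_pos.2 hξ0)]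
    constructor <;> intro h <;> linarith
  rw [potential, hsplit, setIntegral_union _ hm2
    (integrableOn_inv_norm_sub_pow hp hm1 hρ fun z hz => hdist z ((hξ z).trans hz))
    (integrableOn_inv_norm_sub_pow hp hm2 hρ fun z hz => hdist z hz.1)]
  · congr 1
    rw [key, setIntegral_halfSpace (by simp [norm_smul, hξ0.ne']) h.norm_e _ (div_pos hLy hξ0)]
    congr 1
    have := (div_pos hLy hξ0).ne'
    rw [show 2 * (Module.finrank ℝ E + 2) = Module.finrank ℝ E + (Module.finrank ℝ E + 4) by ring,
      pow_add, ← div_div, div_self (pow_ne_zero _ this), one_div]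
  · rw [Set.disjoint_left]
    intro z hz hz'
    exact absurd hz'.2 (not_lt.2 hz)

/-- A smooth function comparable to `g`, with eikonal defect and second derivatives controlled by
the non-flatness of the graph. -/
theorem exists_regularDistance (h : IsGraphFunction e K g) :
    ∃ (δ : E → ℝ) (c C : ℝ), 0 < c ∧ 0 ≤ C ∧
      (∀ x, 0 < g x → c * g x ≤ δ x ∧ δ x ≤ g x) ∧
      IsSymbol (fun x : {x // 0 < g x} => x.1) (fun x => g x.1) (fun x => g x.1) (fun _ => δ) ∧
      IsSymbol (fun x : {x // 0 < g x} => x.1) (fun x => g x.1) (fun x => nonflat g x.1 / g x.1)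
        (fun _ => fderiv ℝ (fderiv ℝ δ)) ∧
      (∀ x, 0 < g x → |‖fderiv ℝ δ x‖ ^ 2 - 1| ≤ C * nonflat g x) ∧
      ∀ x, 0 < g x → ∃ y, g y ≤ 0 ∧ ‖x - y‖ ≤ g x ∧ ‖x - y‖ ≤ δ x * (1 + C * nonflat g x) := by
  have hK := h.one_le_K
  have hgm := h.continuous.measurable
  set N := Module.finrank ℝ E with hN
  set κ : E → ℝ := fun z => (‖z‖ ^ (2 * (N + 2)))⁻¹ with hκ
  have hker : IsKernel (2 * (N + 2)) κ := isKernel_inv_norm_pow _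
  have hp : Module.finrank ℝ E < 2 * (N + 2) := by omega
  set c₀ := ∫ z in {z : E | 1 ≤ inner ℝ e z}, κ z with hc₀
  have hc₀pos : 0 < c₀ := setIntegral_halfSpace_pos h.norm_e hp
  choose ξ hξ hξe hξ1 hξK using h.exists_supergradient
  have hξ0 : ∀ x, 0 < ‖ξ x‖ := fun x => by linarith [hξ1 x]
  obtain ⟨T, hT0, hT⟩ := h.exists_nonflat_le
  obtain ⟨G, hG0, hG⟩ := h.exists_lintegral_gap_le
  let pt : {x // 0 < g x} → E := fun x => x.1
  let ρ : {x // 0 < g x} → ℝ := fun x => g x.1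
  have hρ : ∀ i, 0 < ρ i := fun i => i.2
  let θ : {x // 0 < g x} → ℝ := fun x => nonflat g x.1
  have hθ0 : ∀ i, 0 ≤ θ i := fun i => nonflat_nonneg i.2
  let S : {x // 0 < g x} → Set E := fun x => {z | g z ≤ 0 ∧ 0 < g x.1 + inner ℝ (ξ x.1) (z - x.1)}
  have hSm : ∀ i, MeasurableSet (S i) := fun i => by
    have : Continuous fun z => g i.1 + inner ℝ (ξ i.1) (z - i.1) := by fun_prop
    exact (measurableSet_le hgm measurable_const).inter
      (measurableSet_lt measurable_const this.measurable)
  have hSd : ∀ i, ∀ y ∈ S i, K⁻¹ * ρ i ≤ ‖pt i - y‖ := fun i y hy => by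
    rw [inv_mul_eq_div, div_le_iff₀ (by linarith), mul_comm]; exact h.le_mul_norm_sub hy.1
  have hpotS := hker.isSymbol_potential hρ (inv_pos.2 (by linarith : 0 < K)) hSm hSd hp
  have hWS : ∀ i, ∫ y in S i, (‖pt i - y‖ ^ (2 * (N + 2)))⁻¹ ≤ G * (θ i / ρ i ^ (N + 4)) := by
    intro i
    have h1 := hG i.1 (ξ i.1) i.2 (hξ i.1) (hξe i.1)
    rw [← ofReal_integral_eq_lintegral_ofReal (integrableOn_inv_norm_sub_pow hp (hSm i)
      (mul_pos (inv_pos.2 (by linarith)) (hρ i)) (hSd i))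
      (Filter.Eventually.of_forall fun y => by positivity)] at h1
    exact (ENNReal.ofReal_le_ofReal_iff (mul_nonneg hG0
      (div_nonneg (hθ0 i) (pow_nonneg (hρ i).le _)))).1 h1
  -- The signed distance to the supporting hyperplane at the base point: affine, with gradient of
  -- norm one.
  let ℓ : {x // 0 < g x} → E → ℝ := fun x y => (g x.1 + inner ℝ (ξ x.1) (y - x.1)) / ‖ξ x.1‖
  have hℓpt : ∀ i, ℓ i (pt i) = g i.1 / ‖ξ i.1‖ := fun i => by simp [ℓ, pt]
  have hℓle : ∀ i, ℓ i (pt i) ≤ g i.1 := fun i => by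
    rw [hℓpt]; exact div_le_self i.2.le (hξ1 _)
  have hℓge : ∀ i, K⁻¹ * g i.1 ≤ ℓ i (pt i) := fun i => by
    rw [hℓpt, inv_mul_eq_div]
    exact div_le_div_of_nonneg_left i.2.le (hξ0 _) (hξK _)
  have hℓpos : ∀ i, 0 < ℓ i (pt i) := fun i => by rw [hℓpt]; exact div_pos i.2 (hξ0 _)
  have hℓd : ∀ i y, HasFDerivAt (ℓ i) (innerSL ℝ (‖ξ i.1‖⁻¹ • ξ i.1)) y := by
    intro i y
    have h1 := (((innerSL ℝ (ξ i.1)).hasFDerivAt (x := y - i.1)).comp y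
      ((hasFDerivAt_id y).sub_const i.1)).const_add (g i.1)
    have h2 := h1.mul_const (‖ξ i.1‖⁻¹)
    refine h2.congr_fderiv ?_
    ext z
    simp
  have hℓn : ∀ i : {x // 0 < g x}, ‖innerSL ℝ (‖ξ i.1‖⁻¹ • ξ i.1)‖ = 1 := fun i => by
    rw [innerSL_apply_norm, norm_smul, norm_inv, norm_norm, inv_mul_cancel₀ (hξ0 _).ne']
  have hℓs : IsSymbol pt ρ ρ ℓ := by
    refine IsSymbol.of_fderiv (fun i => ?_) 1 (fun i => ?_) ?_
    · have h1 : ContDiff ℝ ∞ fun y => (inner ℝ (ξ i.1) (y - i.1) : ℝ) :=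
        contDiff_const.inner ℝ (contDiff_id.sub contDiff_const)
      exact ((contDiff_const.add h1).div_const _).contDiffAt
    · rw [Real.norm_of_nonneg (hℓpos i).le, one_mul]; exact hℓle i
    · refine (IsSymbol.const (fun i : {x // 0 < g x} => innerSL ℝ (‖ξ i.1‖⁻¹ • ξ i.1)) 1 fun i => ?_).congr
        fun i => Filter.Eventually.of_forall fun y => ((hℓd i y).fderiv).symm
      rw [hℓn, one_mul, div_self (hρ i).ne']
  -- The potential of the gap relative to that of the supporting half-space, a symbol of weight `θ`
  -- by the gap estimate.
  let w : {x // 0 < g x} → E → ℝ := fun i y => c₀⁻¹ * (ℓ i y ^ (N + 4) * potential κ (S i) y)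
  have hw : IsSymbol pt ρ θ w := by
    refine (((hℓs.pow (N + 4)).mul hpotS).mono hρ (fun i => mul_nonneg (pow_nonneg (hρ i).le _)
      (integral_nonneg fun y => by positivity)) G fun i => ?_).const_mul c₀⁻¹
    refine (mul_le_mul_of_nonneg_left (hWS i) (pow_nonneg (hρ i).le _)).trans (le_of_eq ?_)
    have := (hρ i).ne'
    field_simp
  have hw0 : ∀ i, 0 ≤ w i (pt i) := fun i => mul_nonneg (inv_nonneg.2 hc₀pos.le)
    (mul_nonneg (pow_nonneg (hℓpos i).le _) (integral_nonneg fun y => by positivity))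
  have hN4 : (0 : ℝ) < (N + 4 : ℕ) := by positivity
  set β : ℝ := -((N + 4 : ℕ) : ℝ)⁻¹ with hβ
  have hβ0 : β ≤ 0 := by rw [hβ, neg_nonpos]; positivity
  have hβ1 : -1 ≤ β := by
    rw [hβ, neg_le_neg_iff]
    refine inv_le_one_of_one_le₀ ?_
    push_cast
    linarith [Nat.cast_nonneg (α := ℝ) N]
  have hq := hw.one_add_rpow_sub_one hρ hθ0 hw0 (fun i => hT i.1 i.2) hβ0 hβ1
  have hb := hℓs.mul hq
  -- With kernel exponent `2(N+2)` the half-space potential is `c₀ ℓ^(-(N+4))`, hence the power `β =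
  -- -1/(N+4)`. The function does not depend on a base point; only its representation `ℓ (1 + w)^β`
  -- does.
  let δ : E → ℝ := fun y => (c₀⁻¹ * potential κ {z | g z ≤ 0} y) ^ β
  have hδeq : ∀ i y, 0 < g y → δ y = ℓ i y * (1 + w i y) ^ β := by
    intro i y hy
    have h1 := h.potential_eq (hξ i.1) (hξ1 i.1) hy
    have hℓy : 0 < ℓ i y := div_pos (hy.trans_le (hξ i.1 y)) (hξ0 i.1)
    have hpos : 0 ≤ potential κ (S i) y := integral_nonneg fun y => by positivity
    have e1 : c₀⁻¹ * potential κ {z | g z ≤ 0} y = (ℓ i y ^ (N + 4))⁻¹ * (1 + w i y) := by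
      rw [h1]
      have := hℓy.ne'
      have := hc₀pos.ne'
      simp only [w]
      change c₀⁻¹ * ((ℓ i y ^ (N + 4))⁻¹ * c₀ + potential κ (S i) y) = _
      field_simp
    simp only [δ]
    rw [e1, Real.mul_rpow (by positivity) (by positivity)]
    congr 1
    rw [hβ, Real.inv_rpow (by positivity), Real.rpow_neg (by positivity), inv_inv,
      Real.pow_rpow_inv_natCast hℓy.le (by omega)]
  have hnear : ∀ i : {x // 0 < g x}, ∀ᶠ y in nhds (pt i), 0 < g y := fun i =>
    h.continuous.continuousAt.eventually (lt_mem_nhds i.2)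
  have hδb : ∀ i, (fun y => ℓ i y + ℓ i y * ((1 + w i y) ^ β - 1)) =ᶠ[nhds (pt i)] δ := fun i => by
    filter_upwards [hnear i] with y hy
    rw [hδeq i y hy]; ring
  have hδs : IsSymbol pt ρ ρ (fun _ => δ) :=
    (hℓs.add (hb.mono hρ (fun i => mul_nonneg (hρ i).le (hθ0 i)) T fun i => by
      rw [mul_comm]; exact mul_le_mul_of_nonneg_right (hT i.1 i.2) (hρ i).le)).congr hδb
  -- The gradient is a constant unit covector plus a term of weight `θ`. A further derivative
  -- removes the constant, so the Hessian has weight `θ / g`.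
  have hbd : ∀ i, ∀ᶠ y in nhds (pt i),
      fderiv ℝ δ y = innerSL ℝ (‖ξ i.1‖⁻¹ • ξ i.1) +
        fderiv ℝ (fun y => ℓ i y * ((1 + w i y) ^ β - 1)) y := by
    intro i
    filter_upwards [(hδb i).eventuallyEq_nhds, ((hb.smooth i).of_le
      (by simp : (1 : WithTop ℕ∞) ≤ ∞)).eventually (by simp)] with y hy hy'
    rw [← hy.fderiv_eq]
    exact ((hℓd i y).add (hy'.differentiableAt (by simp)).hasFDerivAt).fderiv
  obtain ⟨C₁, hC₁⟩ := hb.fderiv.value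
  obtain ⟨C₂, hC₂⟩ := hw.value
  have hgrad : ∀ i : {x // 0 < g x}, |‖fderiv ℝ δ i.1‖ ^ 2 - 1| ≤
      (|C₁| * (2 + |C₁| * T)) * θ i := by
    intro i
    set η := fderiv ℝ (fun y => ℓ i y * ((1 + w i y) ^ β - 1)) (pt i) with hη
    have e1 : ‖η‖ ≤ |C₁| * θ i := by
      refine (hC₁ i).trans ?_
      rw [mul_div_assoc, mul_div_cancel₀ _ (hρ i).ne']
      exact mul_le_mul_of_nonneg_right (le_abs_self _) (hθ0 i)
    have e2 := (hbd i).self_of_nhds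
    have e3 : ‖fderiv ℝ δ i.1‖ ≤ 1 + ‖η‖ := by
      change ‖fderiv ℝ δ (pt i)‖ ≤ _
      rw [e2]
      exact (norm_add_le _ _).trans_eq (congrArg (· + ‖η‖) (hℓn i))
    have e4 : 1 ≤ ‖fderiv ℝ δ i.1‖ + ‖η‖ := by
      change 1 ≤ ‖fderiv ℝ δ (pt i)‖ + _
      rw [e2]
      have := norm_sub_le (innerSL ℝ (‖ξ i.1‖⁻¹ • ξ i.1) + η) η
      rwa [add_sub_cancel_right, hℓn i] at this
    have e5 : ‖η‖ ≤ |C₁| * T :=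
      e1.trans (mul_le_mul_of_nonneg_left (hT i.1 i.2) (abs_nonneg _))
    have e6 : |‖fderiv ℝ δ i.1‖ - 1| ≤ ‖η‖ := by rw [abs_le]; constructor <;> linarith
    calc |‖fderiv ℝ δ i.1‖ ^ 2 - 1|
        = |‖fderiv ℝ δ i.1‖ - 1| * (‖fderiv ℝ δ i.1‖ + 1) := by
          rw [show ‖fderiv ℝ δ i.1‖ ^ 2 - 1 = (‖fderiv ℝ δ i.1‖ - 1) * (‖fderiv ℝ δ i.1‖ + 1) by
            ring, abs_mul, abs_of_nonneg (by positivity : 0 ≤ ‖fderiv ℝ δ i.1‖ + 1)]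
      _ ≤ (|C₁| * θ i) * (2 + |C₁| * T) :=
          mul_le_mul (e6.trans e1) (by linarith) (by positivity)
            (mul_nonneg (abs_nonneg _) (hθ0 i))
      _ = _ := by ring
  have hδle : ∀ i : {x // 0 < g x}, δ i.1 ≤ ℓ i (pt i) := fun i => by
    rw [hδeq i i.1 i.2]
    exact mul_le_of_le_one_right (hℓpos i).le
      (Real.rpow_le_one_of_one_le_of_nonpos (by linarith [hw0 i]) hβ0)
  have hwθ : ∀ i, w i (pt i) ≤ |C₂| * θ i := fun i =>
    (le_abs_self _).trans ((hC₂ i).trans (mul_le_mul_of_nonneg_right (le_abs_self _) (hθ0 i)))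
  have hℓδ : ∀ i : {x // 0 < g x}, ℓ i (pt i) ≤ δ i.1 * (1 + w i (pt i)) := fun i => by
    rw [hδeq i i.1 i.2]
    have h1 : (1 + w i (pt i)) ^ (-1 : ℝ) ≤ (1 + w i (pt i)) ^ β :=
      Real.rpow_le_rpow_of_exponent_le (by linarith [hw0 i]) hβ1
    have h2 : 0 < 1 + w i (pt i) := by linarith [hw0 i]
    rw [Real.rpow_neg_one, inv_le_iff_one_le_mul₀ h2] at h1
    have := mul_le_mul_of_nonneg_left h1 (hℓpos i).le
    rw [mul_one, ← mul_assoc] at this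
    exact this
  have hδpos : ∀ i : {x // 0 < g x}, 0 ≤ δ i.1 := fun i => by
    rw [hδeq i i.1 i.2]
    exact mul_nonneg (hℓpos i).le (Real.rpow_nonneg (by linarith [hw0 i]) _)
  refine ⟨δ, K⁻¹ * (1 + |C₂| * T)⁻¹, |C₁| * (2 + |C₁| * T) + |C₂|, by positivity, by positivity,
    fun x hx => ⟨?_, (hδle ⟨x, hx⟩).trans (hℓle ⟨x, hx⟩)⟩, hδs, ?_, fun x hx => ?_, fun x hx => ?_⟩
  · have h1 := hℓge ⟨x, hx⟩
    have h2 := hℓδ ⟨x, hx⟩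
    have h3 : w ⟨x, hx⟩ x ≤ |C₂| * T := (hwθ ⟨x, hx⟩).trans
      (mul_le_mul_of_nonneg_left (hT x hx) (abs_nonneg _))
    have h4 : K⁻¹ * g x ≤ δ x * (1 + |C₂| * T) := h1.trans (h2.trans
      (mul_le_mul_of_nonneg_left (by linarith) (hδpos ⟨x, hx⟩)))
    rw [mul_right_comm, ← div_eq_mul_inv, div_le_iff₀ (by positivity)]
    exact h4
  · have h1 := (hb.fderiv.fderiv).mono (W' := fun x => nonflat g x.1 / g x.1) hρ
      (fun i => div_nonneg (div_nonneg (mul_nonneg (hρ i).le (hθ0 i)) (hρ i).le) (hρ i).le) 1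
      (fun i => by
        rw [one_mul, mul_div_assoc, mul_div_cancel_left₀ _ (hρ i).ne'])
    refine h1.congr fun i => ?_
    filter_upwards [(hbd i).eventually_nhds] with y hy
    have := Filter.EventuallyEq.fderiv_eq (𝕜 := ℝ) hy
    rw [this, fderiv_const_add]
  · refine (hgrad ⟨x, hx⟩).trans ?_
    have : 0 ≤ |C₂| * θ ⟨x, hx⟩ := mul_nonneg (abs_nonneg _) (hθ0 _)
    change _ * θ ⟨x, hx⟩ ≤ _ * θ ⟨x, hx⟩
    linarith
  -- The foot of the perpendicular on the supporting hyperplane: `g ≤ 0` there, and its distance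
  -- from `x` is `ℓ x`.
  · refine ⟨x - (g x / ‖ξ x‖ ^ 2) • ξ x, ?_, ?_⟩
    · have h1 := hξ x (x - (g x / ‖ξ x‖ ^ 2) • ξ x)
      rw [sub_sub_cancel_left, inner_neg_right, inner_smul_right, real_inner_self_eq_norm_sq,
        div_mul_cancel₀ _ (pow_pos (hξ0 x) 2).ne'] at h1
      linarith
    · have e1 : ‖x - (x - (g x / ‖ξ x‖ ^ 2) • ξ x)‖ = ℓ ⟨x, hx⟩ x := by
        rw [sub_sub_cancel, norm_smul, Real.norm_of_nonneg (by positivity)]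
        change _ = ℓ ⟨x, hx⟩ (pt ⟨x, hx⟩)
        rw [hℓpt]
        have := (hξ0 x).ne'
        field_simp
      rw [e1]
      refine ⟨hℓle ⟨x, hx⟩, (hℓδ ⟨x, hx⟩).trans (mul_le_mul_of_nonneg_left ?_ (hδpos ⟨x, hx⟩))⟩
      have h1 := hwθ ⟨x, hx⟩
      have h2 : 0 ≤ (|C₁| * (2 + |C₁| * T)) * θ ⟨x, hx⟩ := mul_nonneg (by positivity) (hθ0 _)
      change _ ≤ 1 + _ * θ ⟨x, hx⟩
      linarith

end IsGraphFunction

end RegularDistance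

/-! ### Chains of derivatives composed with a function -/

section Chains

/-- A sequence of functions on `(0, D)`, each the derivative of its predecessor. -/
def IsChain (D : ℝ) (f : ℕ → ℝ → ℝ) : Prop :=
  ∀ i s, 0 < s → s < D → HasDerivAt (f i) (f (i + 1) s) s

theorem IsChain.contDiffAt {D : ℝ} {f : ℕ → ℝ → ℝ} (hf : IsChain D f) (i : ℕ) {s : ℝ} (h0 : 0 < s)
    (hD : s < D) : ContDiffAt ℝ ∞ (f i) s := by
  have key : ∀ (n : ℕ) (i : ℕ), ContDiffOn ℝ n (f i) (Set.Ioo 0 D) := by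
    intro n
    induction n with
    | zero =>
      exact fun i => contDiffOn_zero.2 fun s hs =>
        (hf i s hs.1 hs.2).continuousAt.continuousWithinAt
    | succ n ih =>
      refine fun i => (contDiffOn_succ_iff_deriv_of_isOpen (n := n) isOpen_Ioo).2 ⟨fun s hs =>
        (hf i s hs.1 hs.2).differentiableAt.differentiableWithinAt, by simp, ?_⟩
      exact (ih (i + 1)).congr fun s hs => (hf i s hs.1 hs.2).deriv
  exact contDiffAt_infty.2 fun n => (key n i).contDiffAt (isOpen_Ioo.mem_nhds ⟨h0, hD⟩)

variable {E : Type} [NormedAddCommGroup E] [NormedSpace ℝ E]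

theorem eventually_differentiableAt {F : Type} [NormedAddCommGroup F] [NormedSpace ℝ F] {a : E → F}
    {x : E} (h : ContDiffAt ℝ ∞ a x) : ∀ᶠ y in nhds x, DifferentiableAt ℝ a y := by
  filter_upwards [(h.of_le (by simp : (1 : WithTop ℕ∞) ≤ ∞)).eventually (by simp)] with y hy
  exact hy.differentiableAt (by simp)

theorem IsChain.contDiffAt_comp_mul {D : ℝ} {f : ℕ → ℝ → ℝ} (hf : IsChain D f) (i : ℕ) {h a : E → ℝ}
    {x : E} (hh : ContDiffAt ℝ ∞ h x) (h0 : 0 < h x) (hD : h x < D) (ha : ContDiffAt ℝ ∞ a x) :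
    ContDiffAt ℝ ∞ (fun y => f i (h y) * a y) x :=
  ((hf.contDiffAt i h0 hD).comp x hh).mul ha

theorem IsChain.partialDeriv_comp_mul {D : ℝ} {f : ℕ → ℝ → ℝ} (hf : IsChain D f) (i : ℕ)
    {h a : E → ℝ} {x : E} (hh : ContDiffAt ℝ ∞ h x) (h0 : 0 < h x) (hD : h x < D)
    (ha : ContDiffAt ℝ ∞ a x) (v : E) :
    (fun y => fderiv ℝ (fun y => f i (h y) * a y) y v) =ᶠ[nhds x] fun y =>
      f (i + 1) (h y) * (fderiv ℝ h y v * a y) + f i (h y) * fderiv ℝ a y v := by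
  filter_upwards [eventually_differentiableAt hh, eventually_differentiableAt ha,
    hh.continuousAt.eventually (lt_mem_nhds h0), hh.continuousAt.eventually (gt_mem_nhds hD)]
    with y h1 h2 h3 h4
  have := ((hf i (h y) h3 h4).comp_hasFDerivAt y h1.hasFDerivAt).mul h2.hasFDerivAt
  change (fderiv ℝ ((f i ∘ h) * a) y) v = _
  rw [this.fderiv]
  simp
  ring

end Chains

/-! ### Laplacian and gradient in an orthonormal basis -/

section LaplacianPartial

variable {E : Type} [NormedAddCommGroup E] [InnerProductSpace ℝ E] [FiniteDimensional ℝ E]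

theorem sum_sq_apply_orthonormalBasis {ι : Type} [Fintype ι] (b : OrthonormalBasis ι ℝ E)
    (L : E →L[ℝ] ℝ) : ∑ j, L (b j) ^ 2 = ‖L‖ ^ 2 := by
  have h1 := b.sum_sq_norm_inner_left ((InnerProductSpace.toDual ℝ E).symm L)
  rw [LinearIsometryEquiv.norm_map] at h1
  rw [← h1]
  refine Finset.sum_congr rfl fun j _ => ?_
  rw [InnerProductSpace.toDual_symm_apply, Real.norm_eq_abs, sq_abs]

theorem norm_gradient_sq {ι : Type} [Fintype ι] (b : OrthonormalBasis ι ℝ E) (u : E → ℝ) (x : E) :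
    ‖gradient u x‖ ^ 2 = ∑ j, fderiv ℝ u x (b j) ^ 2 := by
  rw [sum_sq_apply_orthonormalBasis, gradient, LinearIsometryEquiv.norm_map]

theorem laplacian_eventuallyEq {ι : Type} [Fintype ι] (b : OrthonormalBasis ι ℝ E) {u : E → ℝ}
    {x : E} (hu : ContDiffAt ℝ ∞ u x) :
    Laplacian.laplacian u =ᶠ[nhds x]
      fun y => ∑ j, fderiv ℝ (fun z => fderiv ℝ u z (b j)) y (b j) := by
  filter_upwards [eventually_differentiableAt (hu.fderiv_right (m := ∞) (by simp))] with y hy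
  rw [InnerProductSpace.laplacian_eq_iteratedFDeriv_orthonormalBasis u b]
  refine Finset.sum_congr rfl fun j _ => ?_
  rw [iteratedFDeriv_two_apply, fderiv_clm_apply hy (differentiableAt_const _)]
  simp

end LaplacianPartial

/-! ### Almost distance functions and their error terms -/

section Expansion

set_option linter.unusedSectionVars false

variable {E : Type} [NormedAddCommGroup E] [InnerProductSpace ℝ E] [FiniteDimensional ℝ E]
  {ι : Type} {pt : ι → E} {ρ Er : ι → ℝ} {h φ : E → ℝ} {D : ℝ}

/-- The data near the boundary: `h` is almost a distance function and `φ` is almost constant, with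
errors of relative size `Er`. -/
structure IsAlmostDistance (pt : ι → E) (ρ Er : ι → ℝ) (D : ℝ) (h φ : E → ℝ) : Prop where
  scale_pos : ∀ i, 0 < ρ i
  error_nonneg : ∀ i, 0 ≤ Er i
  error_le : ∃ M, ∀ i, Er i ≤ M
  pos : ∀ i, 0 < h (pt i)
  lt : ∀ i, h (pt i) < D
  symbol : IsSymbol pt ρ ρ (fun _ => h)
  hessian : IsSymbol pt ρ (fun i => Er i / ρ i) (fun _ => fderiv ℝ (fderiv ℝ h))
  eikonal : ∃ C, ∀ i, |‖fderiv ℝ h (pt i)‖ ^ 2 - 1| ≤ C * Er i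
  symbol_bump : IsSymbol pt ρ (fun _ => 1) (fun _ => φ)
  fderiv_bump : IsSymbol pt ρ (fun i => Er i / ρ i) (fun _ => fderiv ℝ φ)

/-- Quantities depending on a chain `f` which expand as `∑ i ≤ n, f i (h) * r i` near the base
points, with coefficients of relative size `Er`. -/
def IsErrorTerm (pt : ι → E) (ρ Er : ι → ℝ) (D : ℝ) (h : E → ℝ) (n : ℕ)
    (R : (ℕ → ℝ → ℝ) → E → ℝ) : Prop :=
  ∃ r : ℕ → E → ℝ,
    (∀ i ∈ Finset.range (n + 1), IsSymbol pt ρ (fun k => Er k * ρ k ^ i / ρ k ^ n) (fun _ => r i)) ∧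
    ∀ f, IsChain D f → ∀ k,
      R f =ᶠ[nhds (pt k)] fun y => ∑ i ∈ Finset.range (n + 1), f i (h y) * r i y

namespace IsErrorTerm

theorem congr {n : ℕ} {R R' : (ℕ → ℝ → ℝ) → E → ℝ} (hR : IsErrorTerm pt ρ Er D h n R)
    (hRR : ∀ f, IsChain D f → ∀ k, R' f =ᶠ[nhds (pt k)] R f) : IsErrorTerm pt ρ Er D h n R' := by
  obtain ⟨r, h1, h2⟩ := hR
  exact ⟨r, h1, fun f hf k => (hRR f hf k).trans (h2 f hf k)⟩

theorem add {n : ℕ} {R R' : (ℕ → ℝ → ℝ) → E → ℝ} (hR : IsErrorTerm pt ρ Er D h n R)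
    (hR' : IsErrorTerm pt ρ Er D h n R') :
    IsErrorTerm pt ρ Er D h n (fun f y => R f y + R' f y) := by
  obtain ⟨r, h1, h2⟩ := hR
  obtain ⟨r', h1', h2'⟩ := hR'
  refine ⟨fun i y => r i y + r' i y, fun i hi => (h1 i hi).add (h1' i hi), fun f hf k => ?_⟩
  filter_upwards [h2 f hf k, h2' f hf k] with y hy hy'
  rw [hy, hy', ← Finset.sum_add_distrib]
  exact Finset.sum_congr rfl fun i _ => by ring

theorem zero (n : ℕ) : IsErrorTerm pt ρ Er D h n (fun _ _ => 0) :=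
  ⟨fun _ _ => 0, fun _ _ => IsSymbol.zero, fun f hf k => by simp⟩

theorem sum {n : ℕ} {κ : Type} (s : Finset κ) {R : κ → (ℕ → ℝ → ℝ) → E → ℝ}
    (hR : ∀ j ∈ s, IsErrorTerm pt ρ Er D h n (R j)) :
    IsErrorTerm pt ρ Er D h n (fun f y => ∑ j ∈ s, R j f y) := by
  classical
  induction s using Finset.induction_on with
  | empty => simpa using zero n
  | insert j s hj ih =>
    simp only [Finset.sum_insert hj]
    exact (hR j (Finset.mem_insert_self _ _)).add
      (ih fun i hi => hR i (Finset.mem_insert_of_mem hi))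

theorem single {n i : ℕ} (hi : i ≤ n) {a : E → ℝ}
    (ha : IsSymbol pt ρ (fun k => Er k * ρ k ^ i / ρ k ^ n) (fun _ => a)) :
    IsErrorTerm pt ρ Er D h n (fun f y => f i (h y) * a y) := by
  refine ⟨fun j y => if j = i then a y else 0, fun j _ => ?_, fun f _ k =>
    Filter.Eventually.of_forall fun y => ?_⟩
  · by_cases hj : j = i
    · subst hj; simpa using ha
    · simp only [if_neg hj]; exact IsSymbol.zero
  · simp only [mul_ite, mul_zero]
    rw [Finset.sum_ite_eq' , if_pos (Finset.mem_range.2 (by omega))]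

theorem contDiffAt {n : ℕ} {R : (ℕ → ℝ → ℝ) → E → ℝ} (hA : IsAlmostDistance pt ρ Er D h φ)
    (hR : IsErrorTerm pt ρ Er D h n R) {f : ℕ → ℝ → ℝ} (hf : IsChain D f) (k : ι) :
    ContDiffAt ℝ ∞ (R f) (pt k) := by
  obtain ⟨r, h1, h2⟩ := hR
  refine ContDiffAt.congr_of_eventuallyEq ?_ (h2 f hf k)
  exact ContDiffAt.sum fun i hi => hf.contDiffAt_comp_mul i (hA.symbol.smooth k) (hA.pos k)
    (hA.lt k) ((h1 i hi).smooth k)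

/-- A derivative either falls on `f i (h)`, raising `i` by one, or on the coefficient, costing
`1/ρ`. Both fit the weights `Er ρ^(i - n - 1)` of order `n + 1`. -/
theorem partialDeriv {n : ℕ} {R : (ℕ → ℝ → ℝ) → E → ℝ} (hA : IsAlmostDistance pt ρ Er D h φ)
    (hR : IsErrorTerm pt ρ Er D h n R) (v : E) :
    IsErrorTerm pt ρ Er D h (n + 1) (fun f y => fderiv ℝ (R f) y v) := by
  obtain ⟨r, h1, h2⟩ := hR
  have hρ := hA.scale_pos
  have hw : ∀ i k, 0 ≤ Er k * ρ k ^ i / ρ k ^ n := fun i k =>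
    div_nonneg (mul_nonneg (hA.error_nonneg k) (pow_nonneg (hρ k).le _)) (pow_nonneg (hρ k).le _)
  have hsum : IsErrorTerm pt ρ Er D h (n + 1) (fun f y => ∑ i ∈ Finset.range (n + 1),
      (f (i + 1) (h y) * (fderiv ℝ h y v * r i y) + f i (h y) * fderiv ℝ (r i) y v)) := by
    refine sum _ fun i hi => (single ?_ ?_).add (single ?_ ?_)
    · have := Finset.mem_range.1 hi; omega
    · refine ((hA.symbol.partialDeriv v).mul (h1 i hi)).mono hρ (fun k =>
        mul_nonneg (div_nonneg (hρ k).le (hρ k).le) (hw i k)) 1 fun k => le_of_eq ?_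
      have := (hρ k).ne'
      field_simp
      ring
    · have := Finset.mem_range.1 hi; omega
    · refine ((h1 i hi).partialDeriv v).mono hρ (fun k => div_nonneg (hw i k) (hρ k).le) 1
        fun k => le_of_eq ?_
      have := (hρ k).ne'
      field_simp
      ring
  refine hsum.congr fun f hf k => ?_
  have h3 := (h2 f hf k).fderiv (𝕜 := ℝ)
  have h4 : ∀ i ∈ Finset.range (n + 1), ∀ᶠ y in nhds (pt k),
      DifferentiableAt ℝ (fun y => f i (h y) * r i y) y ∧
      fderiv ℝ (fun y => f i (h y) * r i y) y v =
        f (i + 1) (h y) * (fderiv ℝ h y v * r i y) + f i (h y) * fderiv ℝ (r i) y v := by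
    intro i hi
    filter_upwards [hf.partialDeriv_comp_mul i (hA.symbol.smooth k) (hA.pos k) (hA.lt k)
      ((h1 i hi).smooth k) v, eventually_differentiableAt (hf.contDiffAt_comp_mul i
      (hA.symbol.smooth k) (hA.pos k) (hA.lt k) ((h1 i hi).smooth k))] with y hy hy'
    exact ⟨hy', hy⟩
  filter_upwards [h3, (Filter.eventually_all_finset _).2 h4] with y hy hy'
  rw [hy, fderiv_fun_sum fun i hi => (hy' i hi).1, sum_apply]
  exact Finset.sum_congr rfl fun i hi => (hy' i hi).2

/-- The coefficients do not depend on the chain, hence neither does the constant; this gives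
uniformity in the cut-off index of the test functions. -/
theorem exists_abs_le {n : ℕ} {R : (ℕ → ℝ → ℝ) → E → ℝ} (hρ : ∀ k, 0 < ρ k) (hEr : ∀ k, 0 ≤ Er k)
    (hR : IsErrorTerm pt ρ Er D h n R) : ∃ C, 0 ≤ C ∧ ∀ f, IsChain D f → ∀ k,
      |R f (pt k)| ≤ C * Er k *
        ∑ i ∈ Finset.range (n + 1), |f i (h (pt k))| * (ρ k ^ i / ρ k ^ n) := by
  obtain ⟨r, h1, h2⟩ := hR
  choose C hC using fun i : Finset.range (n + 1) => (h1 i i.2).value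
  refine ⟨∑ i, |C i|, Finset.sum_nonneg fun _ _ => abs_nonneg _, fun f hf k => ?_⟩
  rw [(h2 f hf k).eq_of_nhds, Finset.mul_sum]
  refine (Finset.abs_sum_le_sum_abs _ _).trans (Finset.sum_le_sum fun i hi => ?_)
  have e1 : |C ⟨i, hi⟩| ≤ ∑ i, |C i| :=
    Finset.single_le_sum (f := fun i => |C i|) (fun _ _ => abs_nonneg _) (Finset.mem_univ _)
  have hp : 0 ≤ Er k * ρ k ^ i / ρ k ^ n :=
    div_nonneg (mul_nonneg (hEr k) (pow_nonneg (hρ k).le _)) (pow_nonneg (hρ k).le _)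
  have e2 : |r i (pt k)| ≤ (∑ i, |C i|) * (Er k * ρ k ^ i / ρ k ^ n) :=
    (hC ⟨i, hi⟩ k).trans (mul_le_mul_of_nonneg_right ((le_abs_self _).trans e1) hp)
  rw [abs_mul]
  calc |f i (h (pt k))| * |r i (pt k)|
      ≤ |f i (h (pt k))| * ((∑ i, |C i|) * (Er k * ρ k ^ i / ρ k ^ n)) :=
        mul_le_mul_of_nonneg_left e2 (abs_nonneg _)
    _ = _ := by ring

end IsErrorTerm

end Expansion

/-! ### Iterated Laplacians of functions of an almost distance -/

section EnergyExpansion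

set_option linter.unusedSectionVars false

variable {E : Type} [NormedAddCommGroup E] [InnerProductSpace ℝ E] [FiniteDimensional ℝ E]
  {ι : Type} {pt : ι → E} {ρ Er : ι → ℝ} {h φ : E → ℝ} {D : ℝ}

theorem two_le_infty : (2 : WithTop ℕ∞) ≤ ∞ := by
  exact ENat.LEInfty.out

namespace IsAlmostDistance

theorem isSymbol_partialDeriv (hA : IsAlmostDistance pt ρ Er D h φ) (v : E) :
    IsSymbol pt ρ (fun _ => 1) (fun _ y => fderiv ℝ h y v) :=
  (hA.symbol.partialDeriv v).mono hA.scale_pos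
    (fun k => div_nonneg (hA.scale_pos k).le (hA.scale_pos k).le) 1
    fun k => by rw [div_self (hA.scale_pos k).ne', mul_one]

theorem isSymbol_fderiv_partialDeriv (hA : IsAlmostDistance pt ρ Er D h φ) (v : E) :
    IsSymbol pt ρ (fun k => Er k / ρ k) (fun _ => fderiv ℝ fun y => fderiv ℝ h y v) := by
  refine (hA.hessian.clm (ContinuousLinearMap.compL ℝ E (E →L[ℝ] ℝ) ℝ
    (ContinuousLinearMap.apply ℝ ℝ v))).congr fun k => ?_
  filter_upwards [eventually_differentiableAt ((hA.symbol.smooth k).fderiv_right (m := ∞)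
    (by simp))] with y hy
  exact ((ContinuousLinearMap.apply ℝ ℝ v).hasFDerivAt.comp y hy.hasFDerivAt).fderiv.symm

/-- The value is small by hypothesis, and all derivatives contain a factor `D²h`, which is of weight
`Er / ρ`. -/
theorem isSymbol_eikonal {κ : Type} [Fintype κ] (b : OrthonormalBasis κ ℝ E)
    (hA : IsAlmostDistance pt ρ Er D h φ) :
    IsSymbol pt ρ Er (fun _ y => ∑ j, fderiv ℝ h y (b j) ^ 2 - 1) := by
  obtain ⟨C, hC⟩ := hA.eikonal
  have hp := fun j => hA.isSymbol_partialDeriv (b j)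
  have hs : ∀ k, ContDiffAt ℝ ∞ (fun y => ∑ j, fderiv ℝ h y (b j) ^ 2) (pt k) := fun k =>
    ContDiffAt.sum fun j _ => ((hp j).smooth k).pow 2
  refine IsSymbol.of_fderiv (fun k => (hs k).sub contDiffAt_const) C (fun k => ?_) ?_
  · rw [sum_sq_apply_orthonormalBasis b]; exact hC k
  · have h1 := IsSymbol.sum Finset.univ fun j _ =>
      ((hp j).const_mul 2).smul (hA.isSymbol_fderiv_partialDeriv (b j))
    simp only [one_mul] at h1
    refine h1.congr fun k => ?_
    have h2 : ∀ j ∈ Finset.univ, ∀ᶠ y in nhds (pt k),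
        DifferentiableAt ℝ (fun y => fderiv ℝ h y (b j)) y := fun j _ =>
      eventually_differentiableAt ((hp j).smooth k)
    filter_upwards [(Filter.eventually_all_finset _).2 h2] with y hy
    rw [fderiv_sub_const, fderiv_fun_sum (A := fun j y => fderiv ℝ h y (b j) ^ 2)
      fun j hj => (hy j hj).fun_pow 2]
    refine Finset.sum_congr rfl fun j hj => ?_
    rw [fderiv_fun_pow _ (hy j hj)]
    simp

theorem isErrorTerm_partialDeriv (hA : IsAlmostDistance pt ρ Er D h φ) (n : ℕ) (v : E) :
    IsErrorTerm pt ρ Er D h (n + 1) (fun f y => fderiv ℝ (fun z => f n (h z) * φ z) y v -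
      f (n + 1) (h y) * (fderiv ℝ h y v * φ y)) := by
  have hρ := hA.scale_pos
  refine (IsErrorTerm.single (i := n) (by omega) ((hA.fderiv_bump.clm
    (ContinuousLinearMap.apply ℝ ℝ v)).mono hρ
    (fun k => div_nonneg (hA.error_nonneg k) (hρ k).le) 1 fun k => le_of_eq ?_)).congr
    fun f hf k => ?_
  · have := (hρ k).ne'
    field_simp
    ring
  · filter_upwards [hf.partialDeriv_comp_mul n (hA.symbol.smooth k) (hA.pos k) (hA.lt k)
      (hA.symbol_bump.smooth k) v] with y hy
    rw [hy, add_sub_cancel_left]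
    rfl

/-- The first-order expansion is differentiated again. Besides the main term this creates the
derivative of `∂_v h · φ`, which is small because `D²h` and `Dφ` both have weight `Er / ρ`. -/
theorem isErrorTerm_partialDeriv_sq (hA : IsAlmostDistance pt ρ Er D h φ) (n : ℕ) (v : E) :
    IsErrorTerm pt ρ Er D h (n + 2) (fun f y =>
      fderiv ℝ (fun z => fderiv ℝ (fun z => f n (h z) * φ z) z v) y v -
      f (n + 2) (h y) * (fderiv ℝ h y v ^ 2 * φ y)) := by
  have hρ := hA.scale_pos
  have hp := hA.isSymbol_partialDeriv v
  have hpφ := hp.mul hA.symbol_bump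
  have h1 := (hA.isErrorTerm_partialDeriv n v).partialDeriv hA v
  have h2 : IsErrorTerm pt ρ Er D h (n + 2) (fun f y => f (n + 1) (h y) *
      fderiv ℝ (fun z => fderiv ℝ h z v * φ z) y v) := by
    refine IsErrorTerm.single (by omega) ?_
    have e1 := hp.mul (hA.fderiv_bump.clm (ContinuousLinearMap.apply ℝ ℝ v))
    have e2 := hA.symbol_bump.mul ((hA.isSymbol_fderiv_partialDeriv v).clm
      (ContinuousLinearMap.apply ℝ ℝ v))
    refine ((e1.add e2).mono hρ (fun k => mul_nonneg zero_le_one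
      (div_nonneg (hA.error_nonneg k) (hρ k).le)) 1 fun k => le_of_eq ?_).congr fun k => ?_
    · have := (hρ k).ne'
      field_simp
      ring
    · filter_upwards [eventually_differentiableAt (hp.smooth k),
        eventually_differentiableAt (hA.symbol_bump.smooth k)] with y h1 h2
      rw [fderiv_fun_mul h1 h2]
      rfl
  refine (h1.add h2).congr fun f hf k => ?_
  have s1 := hf.contDiffAt_comp_mul n (hA.symbol.smooth k) (hA.pos k) (hA.lt k)
    (hA.symbol_bump.smooth k)
  have s2 : ContDiffAt ℝ ∞ (fun z => fderiv ℝ (fun z => f n (h z) * φ z) z v) (pt k) :=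
    (s1.fderiv_right (m := ∞) (by simp)).clm_apply contDiffAt_const
  have s3 := hf.contDiffAt_comp_mul (n + 1) (hA.symbol.smooth k) (hA.pos k) (hA.lt k)
    (hpφ.smooth k)
  filter_upwards [hf.partialDeriv_comp_mul (n + 1) (hA.symbol.smooth k) (hA.pos k) (hA.lt k)
    (hpφ.smooth k) v, eventually_differentiableAt s2, eventually_differentiableAt s3] with y h1 h2 h3
  rw [fderiv_fun_sub h2 h3, sub_apply, h1]
  ring

/-- Summing over a basis, the main terms add up to `f_{n+2}(h) |∇h|² φ`, and `|∇h|² - 1` is an error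
of weight `Er`. -/
theorem isErrorTerm_laplacian {κ : Type} [Fintype κ] (b : OrthonormalBasis κ ℝ E)
    (hA : IsAlmostDistance pt ρ Er D h φ) (n : ℕ) :
    IsErrorTerm pt ρ Er D h (n + 2) (fun f y =>
      Laplacian.laplacian (fun z => f n (h z) * φ z) y - f (n + 2) (h y) * φ y) := by
  have hρ := hA.scale_pos
  have h1 := IsErrorTerm.sum Finset.univ fun j _ => hA.isErrorTerm_partialDeriv_sq n (b j)
  have h2 : IsErrorTerm pt ρ Er D h (n + 2) (fun f y => f (n + 2) (h y) *
      ((∑ j, fderiv ℝ h y (b j) ^ 2 - 1) * φ y)) := by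
    refine IsErrorTerm.single le_rfl (((hA.isSymbol_eikonal b).mul hA.symbol_bump).mono hρ
      (fun k => mul_nonneg (hA.error_nonneg k) zero_le_one) 1 fun k => le_of_eq ?_)
    have := (hρ k).ne'
    field_simp
  refine (h1.add h2).congr fun f hf k => ?_
  filter_upwards [laplacian_eventuallyEq b (hf.contDiffAt_comp_mul n (hA.symbol.smooth k)
    (hA.pos k) (hA.lt k) (hA.symbol_bump.smooth k))] with y hy
  rw [hy, Finset.sum_sub_distrib, ← Finset.mul_sum, ← Finset.sum_mul]
  ring

theorem isErrorTerm_laplacian_errorTerm {κ : Type} [Fintype κ] (b : OrthonormalBasis κ ℝ E)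
    (hA : IsAlmostDistance pt ρ Er D h φ) {n : ℕ} {R : (ℕ → ℝ → ℝ) → E → ℝ}
    (hR : IsErrorTerm pt ρ Er D h n R) :
    IsErrorTerm pt ρ Er D h (n + 2) (fun f => Laplacian.laplacian (R f)) := by
  refine (IsErrorTerm.sum Finset.univ fun j _ =>
    (hR.partialDeriv hA (b j)).partialDeriv hA (b j)).congr fun f hf k => ?_
  exact laplacian_eventuallyEq b (hR.contDiffAt hA hf k)

/-- The iterated Laplacian of a function of the almost distance. -/
theorem isErrorTerm_iterate_laplacian {κ : Type} [Fintype κ] (b : OrthonormalBasis κ ℝ E)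
    (hA : IsAlmostDistance pt ρ Er D h φ) (n : ℕ) :
    IsErrorTerm pt ρ Er D h (2 * n) (fun f y =>
      (fun v : E → ℝ => Laplacian.laplacian v)^[n] (fun z => f 0 (h z) * φ z) y -
        f (2 * n) (h y) * φ y) := by
  induction n with
  | zero => exact (IsErrorTerm.zero _).congr fun f hf k => by simp
  | succ n ih =>
    refine ((hA.isErrorTerm_laplacian_errorTerm b ih).add
      (hA.isErrorTerm_laplacian b (2 * n))).congr fun f hf k => ?_
    have s1 := ih.contDiffAt hA hf k
    have s2 := hf.contDiffAt_comp_mul (2 * n) (hA.symbol.smooth k) (hA.pos k)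
      (hA.lt k) (hA.symbol_bump.smooth k)
    have e1 := (s1.of_le two_le_infty).laplacian_add_nhds
      (s2.of_le two_le_infty)
    filter_upwards [e1] with y hy
    rw [Function.iterate_succ_apply']
    have e2 : ((fun y => (fun v : E → ℝ => Laplacian.laplacian v)^[n]
        (fun z => f 0 (h z) * φ z) y - f (2 * n) (h y) * φ y) + fun y => f (2 * n) (h y) * φ y) =
        (fun v : E → ℝ => Laplacian.laplacian v)^[n] (fun z => f 0 (h z) * φ z) := by
      funext z
      simp
    rw [e2] at hy
    simp only [Pi.add_apply] at hy
    rw [hy]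
    ring_nf

theorem isErrorTerm_partialDeriv_iterate {κ : Type} [Fintype κ] (b : OrthonormalBasis κ ℝ E)
    (hA : IsAlmostDistance pt ρ Er D h φ) (n : ℕ) (v : E) :
    IsErrorTerm pt ρ Er D h (2 * n + 1) (fun f y =>
      fderiv ℝ ((fun v : E → ℝ => Laplacian.laplacian v)^[n] (fun z => f 0 (h z) * φ z)) y v -
        f (2 * n + 1) (h y) * (fderiv ℝ h y v * φ y)) := by
  have ih := hA.isErrorTerm_iterate_laplacian b n
  refine ((ih.partialDeriv hA v).add (hA.isErrorTerm_partialDeriv (2 * n) v)).congr fun f hf k => ?_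
  have s1 := ih.contDiffAt hA hf k
  have s2 := hf.contDiffAt_comp_mul (2 * n) (hA.symbol.smooth k) (hA.pos k)
    (hA.lt k) (hA.symbol_bump.smooth k)
  filter_upwards [eventually_differentiableAt s1, eventually_differentiableAt s2] with y h1 h2
  have e1 := fderiv_fun_add h1 h2
  simp only [sub_add_cancel] at e1
  rw [e1, add_apply]
  ring

end IsAlmostDistance

theorem iterate_laplacian_congr {u v : E → ℝ} {x : E} (h : u =ᶠ[nhds x] v) (n : ℕ) :
    (fun v : E → ℝ => Laplacian.laplacian v)^[n] u =ᶠ[nhds x]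
      (fun v : E → ℝ => Laplacian.laplacian v)^[n] v := by
  induction n with
  | zero => exact h
  | succ n ih =>
    rw [Function.iterate_succ_apply', Function.iterate_succ_apply']
    exact InnerProductSpace.laplacian_congr_nhds ih

end EnergyExpansion

/-! ### The energy density of a function of an almost distance -/

section EnergyBound

theorem sq_add_le_of_abs_le {A R a c ε S M : ℝ} (hS : 0 ≤ S) (ha : 0 ≤ a) (hc : 0 ≤ c) (hε : 0 ≤ ε)
    (hεM : ε ≤ M) (hA : |A| ≤ a * S) (hR : |R| ≤ c * ε * S) :
    (A + R) ^ 2 ≤ A ^ 2 + (2 * a * c + c ^ 2 * M) * (ε * S ^ 2) := by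
  have h1 : |A| * |R| ≤ a * S * (c * ε * S) := mul_le_mul hA hR (abs_nonneg _) (by positivity)
  have h2 : |R| ^ 2 ≤ (c * ε * S) ^ 2 := pow_le_pow_left₀ (abs_nonneg _) hR 2
  have h3 : A * R ≤ |A| * |R| := by rw [← abs_mul]; exact le_abs_self _
  have h4 : c ^ 2 * (ε * ε) * S ^ 2 ≤ c ^ 2 * (M * ε) * S ^ 2 := by gcongr
  rw [sq_abs] at h2
  nlinarith

variable {N : ℕ} {ι : Type} {pt : ι → EuclideanSpace ℝ (Fin N)} {ρ Er : ι → ℝ}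
  {h φ : EuclideanSpace ℝ (Fin N) → ℝ} {D : ℝ}

/-- Squaring main term plus error leaves a cross term linear in `Er`, and the squared error is no
larger since `Er` is bounded. For odd `m` the squares of the partial derivatives are summed and
`|∇h|² ≤ 1 + O(Er)` is used once more. -/
theorem IsAlmostDistance.exists_energyDensity_le (hA : IsAlmostDistance pt ρ Er D h φ) (m : ℕ) :
    ∃ C, 0 ≤ C ∧ ∀ f, IsChain D f → ∀ (u : EuclideanSpace ℝ (Fin N) → ℝ) (k : ι),
      u =ᶠ[nhds (pt k)] (fun y => f 0 (h y) * φ y) →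
      energyDensity m u (pt k) ≤ (f m (h (pt k)) * φ (pt k)) ^ 2 +
        C * (Er k * (∑ i ∈ Finset.range (m + 1), |f i (h (pt k))| * (ρ k ^ i / ρ k ^ m)) ^ 2) := by
  have hρ := hA.scale_pos
  have hE := hA.error_nonneg
  obtain ⟨M, hM⟩ := hA.error_le
  obtain ⟨Cφ, hCφ⟩ := hA.symbol_bump.value
  have hφ : ∀ k, |φ (pt k)| ≤ |Cφ| := fun k => by
    have := hCφ k
    rw [mul_one] at this
    exact this.trans (le_abs_self _)
  let b := EuclideanSpace.basisFun (Fin N) ℝ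
  have hS0 : ∀ (f : ℕ → ℝ → ℝ) k, 0 ≤ ∑ i ∈ Finset.range (m + 1),
      |f i (h (pt k))| * (ρ k ^ i / ρ k ^ m) := fun f k => Finset.sum_nonneg fun i _ =>
    mul_nonneg (abs_nonneg _) (div_nonneg (pow_nonneg (hρ k).le _) (pow_nonneg (hρ k).le _))
  have hSm : ∀ (f : ℕ → ℝ → ℝ) k, |f m (h (pt k))| ≤ ∑ i ∈ Finset.range (m + 1),
      |f i (h (pt k))| * (ρ k ^ i / ρ k ^ m) := fun f k => by
    have := Finset.single_le_sum (f := fun i => |f i (h (pt k))| * (ρ k ^ i / ρ k ^ m))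
      (fun i _ => mul_nonneg (abs_nonneg _)
        (div_nonneg (pow_nonneg (hρ k).le _) (pow_nonneg (hρ k).le _)))
      (Finset.mem_range.2 (Nat.lt_succ_self m))
    simpa [div_self (pow_ne_zero m (hρ k).ne')] using this
  have hfφ : ∀ (f : ℕ → ℝ → ℝ) k, |f m (h (pt k)) * φ (pt k)| ≤ |Cφ| *
      ∑ i ∈ Finset.range (m + 1), |f i (h (pt k))| * (ρ k ^ i / ρ k ^ m) := fun f k => by
    rw [abs_mul, mul_comm |Cφ|]
    exact mul_le_mul (hSm f k) (hφ k) (abs_nonneg _) (hS0 f k)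
  have hM' : ∀ k, Er k ≤ |M| := fun k => (hM k).trans (le_abs_self M)
  rcases Nat.even_or_odd m with hm | hm
  · obtain ⟨n, hn⟩ := hm
    have hn' : m = 2 * n := by omega
    obtain ⟨C, hC0, hC⟩ := (hA.isErrorTerm_iterate_laplacian b n).exists_abs_le hρ hE
    refine ⟨2 * |Cφ| * C + C ^ 2 * |M|, by positivity, fun f hf u k hu => ?_⟩
    have e1 : energyDensity m u (pt k) = ((fun v : EuclideanSpace ℝ (Fin N) → ℝ =>
        Laplacian.laplacian v)^[n] (fun z => f 0 (h z) * φ z) (pt k)) ^ 2 := by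
      rw [energyDensity, if_pos ⟨n, hn⟩, iterLaplacian, show m / 2 = n by omega,
        (iterate_laplacian_congr hu n).eq_of_nhds]
    have e2 := hC f hf k
    rw [← hn'] at e2
    have e3 := sq_add_le_of_abs_le (hS0 f k) (abs_nonneg Cφ) hC0 (hE k) (hM' k) (hfφ f k) e2
    rw [add_sub_cancel] at e3
    rw [e1]
    exact e3
  · obtain ⟨n, hn⟩ := hm
    choose C hC0 hC using fun j => (hA.isErrorTerm_partialDeriv_iterate b n (b j)).exists_abs_le hρ hE
    choose P hP using fun j => (hA.isSymbol_partialDeriv (b j)).value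
    have hP' : ∀ j k, |fderiv ℝ h (pt k) (b j)| ≤ |P j| := fun j k => by
      have := hP j k
      rw [mul_one] at this
      exact this.trans (le_abs_self _)
    obtain ⟨G, hG⟩ := hA.eikonal
    refine ⟨∑ j, (2 * (|Cφ| * |P j|) * C j + C j ^ 2 * |M|) + |G| * |Cφ| ^ 2,
      add_nonneg (Finset.sum_nonneg fun j _ => by have := hC0 j; positivity) (by positivity),
      fun f hf u k hu => ?_⟩
    have e1 : energyDensity m u (pt k) = ∑ j, fderiv ℝ ((fun v : EuclideanSpace ℝ (Fin N) → ℝ =>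
        Laplacian.laplacian v)^[n] (fun z => f 0 (h z) * φ z)) (pt k) (b j) ^ 2 := by
      rw [energyDensity, if_neg (Nat.not_even_iff_odd.2 ⟨n, hn⟩), iterLaplacian,
        show (m - 1) / 2 = n by omega, norm_gradient_sq b]
      rw [(iterate_laplacian_congr hu n).fderiv_eq]
    set S := ∑ i ∈ Finset.range (m + 1), |f i (h (pt k))| * (ρ k ^ i / ρ k ^ m) with hS
    have hSk : 0 ≤ S := hS0 f k
    have e2 : ∀ j, fderiv ℝ ((fun v : EuclideanSpace ℝ (Fin N) → ℝ =>
        Laplacian.laplacian v)^[n] (fun z => f 0 (h z) * φ z)) (pt k) (b j) ^ 2 ≤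
        (f m (h (pt k)) * (fderiv ℝ h (pt k) (b j) * φ (pt k))) ^ 2 +
        (2 * (|Cφ| * |P j|) * C j + C j ^ 2 * |M|) * (Er k * S ^ 2) := by
      intro j
      have e3 := hC j f hf k
      rw [← hn] at e3
      have e4 : |f m (h (pt k)) * (fderiv ℝ h (pt k) (b j) * φ (pt k))| ≤ |Cφ| * |P j| * S := by
        rw [mul_left_comm, abs_mul, mul_comm |Cφ|, mul_assoc]
        exact mul_le_mul (hP' j k) (hfφ f k) (abs_nonneg _) (abs_nonneg _)
      have e5 := sq_add_le_of_abs_le hSk (by positivity) (hC0 j) (hE k) (hM' k) e4 e3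
      rwa [add_sub_cancel] at e5
    have e6 : ∑ j, (f m (h (pt k)) * (fderiv ℝ h (pt k) (b j) * φ (pt k))) ^ 2 ≤
        (f m (h (pt k)) * φ (pt k)) ^ 2 + |G| * |Cφ| ^ 2 * (Er k * S ^ 2) := by
      have e7 : ∑ j, (f m (h (pt k)) * (fderiv ℝ h (pt k) (b j) * φ (pt k))) ^ 2 =
          (f m (h (pt k)) * φ (pt k)) ^ 2 * ‖fderiv ℝ h (pt k)‖ ^ 2 := by
        rw [← sum_sq_apply_orthonormalBasis b, Finset.mul_sum]
        exact Finset.sum_congr rfl fun j _ => by ring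
      have e8 : ‖fderiv ℝ h (pt k)‖ ^ 2 ≤ 1 + |G| * Er k := by
        have := (le_abs_self _).trans (hG k)
        have := mul_le_mul_of_nonneg_right (le_abs_self G) (hE k)
        linarith
      have e9 : (f m (h (pt k)) * φ (pt k)) ^ 2 ≤ (|Cφ| * S) ^ 2 := by
        rw [← sq_abs]; exact pow_le_pow_left₀ (abs_nonneg _) (hfφ f k) 2
      have hg : 0 ≤ |G| * Er k := mul_nonneg (abs_nonneg _) (hE k)
      calc ∑ j, (f m (h (pt k)) * (fderiv ℝ h (pt k) (b j) * φ (pt k))) ^ 2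
          ≤ (f m (h (pt k)) * φ (pt k)) ^ 2 * (1 + |G| * Er k) := by rw [e7]; gcongr
        _ = (f m (h (pt k)) * φ (pt k)) ^ 2 + (f m (h (pt k)) * φ (pt k)) ^ 2 * (|G| * Er k) := by
          ring
        _ ≤ (f m (h (pt k)) * φ (pt k)) ^ 2 + (|Cφ| * S) ^ 2 * (|G| * Er k) := by gcongr
        _ = _ := by ring
    rw [e1]
    refine (Finset.sum_le_sum fun j _ => e2 j).trans ?_
    rw [Finset.sum_add_distrib, ← Finset.sum_mul, add_mul]
    linarith

end EnergyBound

/-! ### Crude bounds for reciprocals of iterated logarithms -/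

section IteratedLogarithms

theorem X_succ' (i : ℕ) (s : ℝ) : X (i + 1) s = X i (X 1 s) := by
  induction i with
  | zero => rfl
  | succ i ih => rw [X_succ (i + 1) s, ih, X_succ i (X 1 s)]

theorem Xprod_succ' (i : ℕ) (s : ℝ) : Xprod (i + 1) s = X 1 s * Xprod i (X 1 s) := by
  induction i with
  | zero => simp [Xprod]
  | succ i ih => rw [Xprod_succ (i + 1) s, ih, Xprod_succ i (X 1 s), X_succ' (i + 1) s, mul_assoc]

theorem exists_inv_Xprod_le (r : ℕ) :
    ∃ C, 0 ≤ C ∧ ∀ s, 0 < s → s ≤ 1 → (Xprod r s)⁻¹ ≤ C * s ^ (-(1 / 2) : ℝ) := by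
  rcases Nat.eq_zero_or_pos r with rfl | hr
  · refine ⟨1, zero_le_one, fun s h0 h1 => ?_⟩
    rw [Xprod_zero, inv_one, one_mul]
    exact Real.one_le_rpow_of_pos_of_le_one_of_nonpos h0 h1 (by norm_num)
  · have hr' : (0 : ℝ) < r := by exact_mod_cast hr
    -- Each of the `r` factors may cost `s^(-ε)`, and `r ε = 1/2`.
    set ε : ℝ := 1 / (2 * r) with hε
    have hε0 : 0 < ε := by positivity
    refine ⟨(1 + 1 / ε) ^ r, by positivity, fun s h0 h1 => ?_⟩
    have hX := X_pos 1 h0 h1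
    have e1 : (X 1 s)⁻¹ ≤ (1 + 1 / ε) * s⁻¹ ^ ε := by
      have h2 : (X 1 s)⁻¹ = 1 + Real.log s⁻¹ := by simp [X, Real.log_inv, sub_eq_add_neg]
      have h3 := Real.log_le_rpow_div (inv_nonneg.2 h0.le) hε0
      have h4 : 1 ≤ s⁻¹ ^ ε := Real.one_le_rpow ((one_le_inv₀ h0).2 h1) hε0.le
      rw [h2, add_mul, one_div, inv_mul_eq_div, one_mul]
      linarith
    have e2 : (s⁻¹ ^ ε) ^ r = s ^ (-(1 / 2) : ℝ) := by
      rw [← Real.rpow_natCast, ← Real.rpow_mul (inv_nonneg.2 h0.le), Real.inv_rpow h0.le,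
        ← Real.rpow_neg h0.le]
      congr 1
      rw [hε]
      field_simp
    calc (Xprod r s)⁻¹ ≤ (X 1 s ^ r)⁻¹ :=
          inv_anti₀ (pow_pos hX r) (X_one_pow_le_Xprod r h0 h1)
      _ = (X 1 s)⁻¹ ^ r := (inv_pow _ _).symm
      _ ≤ ((1 + 1 / ε) * s⁻¹ ^ ε) ^ r := pow_le_pow_left₀ (inv_nonneg.2 hX.le) e1 r
      _ = _ := by rw [mul_pow, e2]

/-- Since `Y_r(s) = X_1(s) Y_{r-1}(X_1(s))`, the power bound applied at `X_1(s)` gives `Y_r⁻¹ ≤ C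
X_1^(-3/2)`. -/
theorem exists_inv_Xprod_mul_X_one_le {r : ℕ} (hr : 1 ≤ r) :
    ∃ C, 0 ≤ C ∧ ∀ s, 0 < s → s ≤ 1 →
      (Xprod r s)⁻¹ * X 1 s ^ 3 ≤ C * X 1 s ^ (3 / 2 : ℝ) := by
  obtain ⟨k, rfl⟩ : ∃ k, r = k + 1 := ⟨r - 1, by omega⟩
  obtain ⟨C, hC0, hC⟩ := exists_inv_Xprod_le k
  refine ⟨C, hC0, fun s h0 h1 => ?_⟩
  have hX := X_pos 1 h0 h1
  have h2 := hC _ hX (X_le_one 1 h0 h1)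
  have e1 : X 1 s ^ (3 / 2 : ℝ) = X 1 s ^ (-(1 / 2) : ℝ) * X 1 s ^ 2 := by
    rw [← Real.rpow_natCast, ← Real.rpow_add hX]; norm_num
  rw [Xprod_succ', mul_inv, e1, ← mul_assoc]
  calc (X 1 s)⁻¹ * (Xprod k (X 1 s))⁻¹ * X 1 s ^ 3 = (Xprod k (X 1 s))⁻¹ * X 1 s ^ 2 := by
        field_simp
    _ ≤ _ := mul_le_mul_of_nonneg_right h2 (by positivity)

end IteratedLogarithms

/-! ### The one-dimensional test function and its derivatives -/

section TestChain

/-- The derivatives of the one-dimensional test function `s ^ (m - 1/2) * v (-log (s / D))`, where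
`v` is a truncated profile. -/
def testChain (m r : ℕ) (D : ℝ) (M i : ℕ) (s : ℝ) : ℝ :=
  s ^ halfInt m i * opApply (halfInt m) (fun j => iteratedDeriv j (profile r M)) i
    (-Real.log (s / D))

variable {m r : ℕ} {D : ℝ}

theorem neg_log_div_pos {s : ℝ} (hs : 0 < s) (hsD : s < D) : 0 < -Real.log (s / D) := by
  have hD : 0 < D := hs.trans hsD
  have := Real.log_neg (div_pos hs hD) ((div_lt_one hD).2 hsD)
  linarith

theorem logX_neg_log (i : ℕ) {s : ℝ} (hs : 0 < s) : logX i (-Real.log s) = X i s := by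
  rw [logX, neg_neg, Real.exp_log hs]

theorem logXprod_neg_log (i : ℕ) {s : ℝ} (hs : 0 < s) : logXprod i (-Real.log s) = Xprod i s := by
  rw [logXprod, neg_neg, Real.exp_log hs]

theorem hasDerivAt_neg_log_div {s : ℝ} (hs : 0 < s) (hD : 0 < D) :
    HasDerivAt (fun s => -Real.log (s / D)) (-s⁻¹) s := by
  have := (((hasDerivAt_id s).div_const D).log (div_pos hs hD).ne').neg
  refine this.congr_deriv ?_
  simp only [id]
  field_simp

/-- `s d/ds` maps `s^β w(-log (s/D))` to `s^β (β w - w')`; with `β = halfInt m i` this is the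
recursion of `opApply`. -/
theorem isChain_testChain (hr : 1 ≤ r) (M : ℕ) : IsChain D (testChain m r D M) := by
  intro i s hs hsD
  have hD : 0 < D := hs.trans hsD
  have ht := neg_log_div_pos hs hsD
  have h1 := hasDerivAt_opApply (halfInt m)
    (fun j => hasDerivAt_iteratedDeriv_profile hr M j ht) i
  have h2 := h1.comp s (hasDerivAt_neg_log_div hs hD)
  have h3 := (Real.hasDerivAt_rpow_const (p := halfInt m i) (Or.inl hs.ne')).mul h2
  refine h3.congr_deriv ?_
  have e1 : halfInt m (i + 1) = halfInt m i - 1 := by unfold halfInt; push_cast; ring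
  rw [testChain, e1, Real.rpow_sub_one hs.ne', Function.comp_apply]
  field_simp
  ring

theorem exists_abs_testChain_le (hr : 1 ≤ r) :
    ∃ C, 0 ≤ C ∧ ∀ M i s, i ≤ m → 0 < s → s < D →
      |testChain m r D M i s| ≤ C * s ^ halfInt m i * Xprod r (s / D) ^ (-(1 / 2) : ℝ) := by
  choose K hK0 hK using fun j => exists_iteratedDeriv_profile_le hr j
  let C : ℕ → ℝ := fun i => ∑ j ∈ Finset.range (i + 1), |opCoeff (halfInt m) i j| * K j
  have hC0 : ∀ i, 0 ≤ C i := fun i => Finset.sum_nonneg fun j _ =>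
    mul_nonneg (abs_nonneg _) (hK0 j)
  refine ⟨∑ i ∈ Finset.range (m + 1), C i, Finset.sum_nonneg fun i _ => hC0 i,
    fun M i s hi hs hsD => ?_⟩
  have hD : 0 < D := hs.trans hsD
  have ht := neg_log_div_pos hs hsD
  set t := -Real.log (s / D) with htdef
  have hY : logXprod r t = Xprod r (s / D) := logXprod_neg_log r (div_pos hs hD)
  have hY0 := logXprod_pos r ht
  have e1 : |opApply (halfInt m) (fun j => iteratedDeriv j (profile r M)) i t| ≤
      C i * logXprod r t ^ (-(1 / 2) : ℝ) := by
    rw [opApply, Finset.sum_mul]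
    refine (Finset.abs_sum_le_sum_abs _ _).trans (Finset.sum_le_sum fun j _ => ?_)
    rw [abs_mul, mul_assoc]
    refine mul_le_mul_of_nonneg_left ((hK j M t ht).trans ?_) (abs_nonneg _)
    refine mul_le_mul_of_nonneg_left (div_le_self (Real.rpow_nonneg hY0.le _) ?_) (hK0 j)
    exact one_le_pow₀ (by linarith)
  have e2 : C i ≤ ∑ i ∈ Finset.range (m + 1), C i :=
    Finset.single_le_sum (f := C) (fun i _ => hC0 i) (Finset.mem_range.2 (by omega))
  rw [testChain, abs_mul, abs_of_nonneg (Real.rpow_nonneg hs.le _), ← hY, ← htdef]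
  calc s ^ halfInt m i * |opApply (halfInt m) (fun j => iteratedDeriv j (profile r M)) i t|
      ≤ s ^ halfInt m i * ((∑ i ∈ Finset.range (m + 1), C i) * logXprod r t ^ (-(1 / 2) : ℝ)) := by
        refine mul_le_mul_of_nonneg_left (e1.trans ?_) (Real.rpow_nonneg hs.le _)
        exact mul_le_mul_of_nonneg_right e2 (Real.rpow_nonneg hY0.le _)
    _ = _ := by ring

theorem testChain_sq (M : ℕ) {s : ℝ} (hs : 0 < s) :
    testChain m r D M m s ^ 2 = s⁻¹ *
      opApply (halfInt m) (fun j => iteratedDeriv j (profile r M)) m (-Real.log (s / D)) ^ 2 := by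
  have : (s ^ halfInt m m) ^ 2 = s⁻¹ := by
    rw [← Real.rpow_natCast, ← Real.rpow_mul hs.le, ← Real.rpow_neg_one]
    congr 1
    unfold halfInt
    push_cast
    ring
  rw [testChain, mul_pow, this]

theorem testChain_zero_sq (M : ℕ) {s : ℝ} (hs : 0 < s) :
    testChain m r D M 0 s ^ 2 / s ^ (2 * m) = s⁻¹ * profile r M (-Real.log (s / D)) ^ 2 := by
  have h1 : (s ^ halfInt m 0) ^ 2 = s⁻¹ * s ^ (2 * m) := by
    rw [← Real.rpow_natCast, ← Real.rpow_mul hs.le, ← Real.rpow_natCast, ← Real.rpow_neg_one,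
      ← Real.rpow_add hs]
    congr 1
    unfold halfInt
    push_cast
    ring
  have h2 : s ^ (2 * m) ≠ 0 := (pow_pos hs _).ne'
  rw [testChain, mul_pow, h1]
  simp only [opApply, opCoeff]
  simp
  field_simp

theorem exists_testChain_eq_zero (hD : 0 < D) (M : ℕ) : ∃ s₀, 0 < s₀ ∧ ∀ s, 0 < s → s < s₀ →
    (M : ℝ) + 1 < -Real.log (X r (s / D)) := by
  have h1 : Filter.Tendsto (fun s => -Real.log (X r (s / D))) (nhdsWithin 0 (Set.Ioi 0))
      Filter.atTop := Filter.tendsto_neg_atBot_atTop.comp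
    (Real.tendsto_log_nhdsGT_zero.comp (tendsto_X_div_zero r hD))
  obtain ⟨s₀, hs₀, h2⟩ := mem_nhdsGT_iff_exists_Ioo_subset.1 (h1.eventually_gt_atTop ((M : ℝ) + 1))
  exact ⟨s₀, hs₀, fun s hs hss => h2 ⟨hs, hss⟩⟩

/-- Where the step equals one, `v² = Y_r⁻¹`. The excess term is therefore the non-integrable `Y_r /
s`. -/
theorem profile_sq_mul (M : ℕ) {s : ℝ} (hs : 0 < s) (hsD : s < D)
    (hM : -Real.log (X r (s / D)) ≤ M) :
    profile r M (-Real.log (s / D)) ^ 2 * Xprod r (s / D) ^ 2 = Xprod r (s / D) := by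
  have hD : 0 < D := hs.trans hsD
  have h1 : 0 < s / D := div_pos hs hD
  have hY := Xprod_pos r h1 ((div_lt_one hD).2 hsD).le
  rw [profile, logXprod_neg_log r h1, logX_neg_log r h1, cutoff_zero_of_nonpos (by linarith),
    mul_one, ← Real.rpow_natCast, ← Real.rpow_mul hY.le, ← Real.rpow_natCast,
    ← Real.rpow_add hY]
  norm_num

end TestChain

/-! ### Regularity of the energy density and the divergence theorem -/

section EnergyRegularity

variable {N : ℕ}

theorem contDiff_laplacian {E : Type} [NormedAddCommGroup E] [InnerProductSpace ℝ E]
    [FiniteDimensional ℝ E] {u : E → ℝ} (hu : ContDiff ℝ ∞ u) :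
    ContDiff ℝ ∞ (Laplacian.laplacian u) := by
  refine contDiff_iff_contDiffAt.2 fun x => ContDiffAt.congr_of_eventuallyEq ?_
    (laplacian_eventuallyEq (stdOrthonormalBasis ℝ E) hu.contDiffAt)
  refine ContDiffAt.sum fun j _ => ?_
  have h1 : ContDiff ℝ ∞ fun z => fderiv ℝ u z (stdOrthonormalBasis ℝ E j) :=
    (hu.fderiv_right (m := ∞) (by simp)).clm_apply contDiff_const
  exact ((h1.fderiv_right (m := ∞) (by simp)).clm_apply contDiff_const).contDiffAt

theorem contDiff_iterLaplacian {u : EuclideanSpace ℝ (Fin N) → ℝ} (hu : ContDiff ℝ ∞ u) (n : ℕ) :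
    ContDiff ℝ ∞ (iterLaplacian n u) := by
  unfold iterLaplacian
  induction n with
  | zero => exact hu
  | succ n ih => rw [Function.iterate_succ_apply']; exact contDiff_laplacian ih

theorem continuous_energyDensity {u : EuclideanSpace ℝ (Fin N) → ℝ} (hu : ContDiff ℝ ∞ u) (m : ℕ) :
    Continuous (energyDensity m u) := by
  unfold energyDensity
  split_ifs with hm
  · exact (contDiff_iterLaplacian hu _).continuous.pow 2
  · have h1 := (contDiff_iterLaplacian hu ((m - 1) / 2)).continuous_fderiv (by simp)
    simp only [gradient, LinearIsometryEquiv.norm_map]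
    exact h1.norm.pow 2

theorem iterLaplacian_zero (n : ℕ) : iterLaplacian n (fun _ : EuclideanSpace ℝ (Fin N) => (0 : ℝ)) =
    fun _ => 0 := by
  unfold iterLaplacian
  induction n with
  | zero => rfl
  | succ n ih =>
    rw [Function.iterate_succ_apply', ih]
    exact InnerProductSpace.laplacian_const

theorem energyDensity_eq_zero {u : EuclideanSpace ℝ (Fin N) → ℝ} (m : ℕ)
    {x : EuclideanSpace ℝ (Fin N)} (hx : x ∉ tsupport u) : energyDensity m u x = 0 := by
  have h1 : u =ᶠ[nhds x] fun _ => 0 := notMem_tsupport_iff_eventuallyEq.1 hx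
  have h2 : ∀ n, iterLaplacian n u =ᶠ[nhds x] fun _ => 0 := fun n => by
    rw [← iterLaplacian_zero n]
    exact iterate_laplacian_congr h1 n
  unfold energyDensity
  split_ifs with hm
  · rw [(h2 _).eq_of_nhds]; ring
  · simp only [gradient, LinearIsometryEquiv.norm_map]
    rw [(h2 _).fderiv_eq]
    simp

theorem integrable_energyDensity {u : EuclideanSpace ℝ (Fin N) → ℝ} (hu : ContDiff ℝ ∞ u)
    (hc : HasCompactSupport u) (m : ℕ) : Integrable (energyDensity m u) := by
  refine (continuous_energyDensity hu m).integrable_of_hasCompactSupport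
    (HasCompactSupport.intro hc fun x hx => energyDensity_eq_zero m hx)

/-- A product of a test function with a function continuous near its support. -/
theorem integrable_mul_of_continuousOn {E : Type} [NormedAddCommGroup E]
    [MeasurableSpace E] [BorelSpace E] [NormedSpace ℝ E] [FiniteDimensional ℝ E]
    {μ : Measure E} [IsFiniteMeasureOnCompacts μ] {u w : E → ℝ} {Ω : Set E} (hΩ : IsOpen Ω)
    (hu : Continuous u) (hc : HasCompactSupport u) (hs : tsupport u ⊆ Ω) (hw : ContinuousOn w Ω) :
    Integrable (fun x => u x * w x) μ := by
  refine Continuous.integrable_of_hasCompactSupport ?_ hc.mul_right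
  refine continuous_iff_continuousAt.2 fun x => ?_
  by_cases hx : x ∈ tsupport u
  · exact hu.continuousAt.mul (hw.continuousAt (hΩ.mem_nhds (hs hx)))
  · have h1 : u =ᶠ[nhds x] fun _ => 0 := notMem_tsupport_iff_eventuallyEq.1 hx
    have h2 : (fun x => u x * w x) =ᶠ[nhds x] fun _ => 0 := by
      filter_upwards [h1] with y hy
      rw [hy, zero_mul]
    exact continuousAt_const.congr h2.symm

/-- The divergence theorem for one component of a compactly supported vector field. -/
theorem integral_fderiv_eq_zero {E : Type} [NormedAddCommGroup E] [MeasurableSpace E] [BorelSpace E]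
    [NormedSpace ℝ E] [FiniteDimensional ℝ E] {μ : Measure E} [μ.IsAddHaarMeasure] {q : E → ℝ}
    (hq : ContDiff ℝ 1 q) (hc : HasCompactSupport q) (v : E) : ∫ x, fderiv ℝ q x v ∂μ = 0 := by
  have hqd : Continuous fun x => fderiv ℝ q x v :=
    (hq.continuous_fderiv (by simp)).clm_apply continuous_const
  have h1 := integral_mul_fderiv_eq_neg_fderiv_mul_of_integrable (μ := μ) (f := fun _ => (1 : ℝ))
    (g := q) (v := v) (by simp)
    (by simpa using hqd.integrable_of_hasCompactSupport (hc.fderiv_apply ℝ v))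
    (by simpa using hq.continuous.integrable_of_hasCompactSupport hc)
    (fun _ _ => differentiableAt_const _) (fun x _ => hq.differentiable (by simp) x)
  simpa using h1

end EnergyRegularity

/-! ### Almost monotonicity of the Hardy weights -/

section Weights

theorem exists_X_div_lt (i : ℕ) {D ε : ℝ} (hD : 0 < D) (hε : 0 < ε) :
    ∃ η, 0 < η ∧ ∀ s, 0 < s → s < η → X i (s / D) < ε := by
  have h1 : Filter.Tendsto (fun s => X i (s / D)) (nhdsWithin 0 (Set.Ioi 0)) (nhds 0) :=
    (tendsto_X_div_zero i hD).mono_right nhdsWithin_le_nhds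
  obtain ⟨η, hη, h2⟩ := mem_nhdsGT_iff_exists_Ioo_subset.1 (h1.eventually (gt_mem_nhds hε))
  exact ⟨η, hη, fun s hs hss => h2 ⟨hs, hss⟩⟩

theorem rpow_mul_Xprod_le (i : ℕ) {s κ : ℝ} (h0 : 0 < s) (h1 : s ≤ 1) (hκ : 0 < κ) (hκ1 : κ ≤ 1) :
    κ ^ (∑ j ∈ Finset.Icc 1 i, Xprod j s) * Xprod i s ≤ Xprod i (κ * s) := by
  rw [Real.rpow_sum_of_pos hκ, Xprod, Xprod, ← Finset.prod_mul_distrib]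
  exact Finset.prod_le_prod (fun j _ => mul_nonneg (Real.rpow_nonneg hκ.le _) (X_pos j h0 h1).le)
    fun j _ => rpow_mul_X_le j h0 h1 hκ hκ1

/-- Near the boundary the scaling exponents sum to at most `r X_1 ≤ 1`, so the whole product loses
at most one power of `κ`, whatever the number of factors. -/
theorem mul_Xprod_le_of_small {i r : ℕ} (hir : i ≤ r) {s κ : ℝ} (h0 : 0 < s) (h1 : s ≤ 1)
    (hκ : 0 < κ) (hκ1 : κ ≤ 1) (hs : r * X 1 s ≤ 1) : κ * Xprod i s ≤ Xprod i (κ * s) := by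
  refine le_trans ?_ (rpow_mul_Xprod_le i h0 h1 hκ hκ1)
  refine mul_le_mul_of_nonneg_right ?_ (Xprod_pos i h0 h1).le
  have h2 : ∑ j ∈ Finset.Icc 1 i, Xprod j s ≤ 1 := by
    calc ∑ j ∈ Finset.Icc 1 i, Xprod j s ≤ ∑ j ∈ Finset.Icc 1 i, X 1 s :=
          Finset.sum_le_sum fun j hj => Xprod_le_X_one (Finset.mem_Icc.1 hj).1 h0 h1
      _ = i * X 1 s := by simp
      _ ≤ r * X 1 s := by
        have := (X_pos 1 h0 h1).le
        gcongr
      _ ≤ 1 := hs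
  calc κ = κ ^ (1 : ℝ) := (Real.rpow_one κ).symm
    _ ≤ _ := Real.rpow_le_rpow_of_exponent_ge hκ hκ1 h2

/-- Almost monotonicity of the singular weights. -/
theorem weight_comparison {m i r : ℕ} (hm : 1 ≤ m) (hir : i ≤ r) {D s t q : ℝ} (hs : 0 < s)
    (hsD : s ≤ D) (ht : 0 < t) (htD : t ≤ D) (hq0 : 0 < q) (hq1 : q ≤ 1) (hqs : q * t ≤ s)
    (hsmall : r * X 1 (s / D) ≤ 1) :
    q ^ (2 * m) * (Xprod i (s / D) ^ 2 / s ^ (2 * m)) ≤ Xprod i (t / D) ^ 2 / t ^ (2 * m) := by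
  have hD : 0 < D := hs.trans_le hsD
  have hs1 : 0 < s / D := div_pos hs hD
  have hs2 : s / D ≤ 1 := (div_le_one hD).2 hsD
  have ht1 : 0 < t / D := div_pos ht hD
  have ht2 : t / D ≤ 1 := (div_le_one hD).2 htD
  have hX := Xprod_pos i hs1 hs2
  rcases le_total s t with h | h
  · have e1 : Xprod i (s / D) ≤ Xprod i (t / D) :=
      Finset.prod_le_prod (fun j _ => (X_pos j hs1 hs2).le)
        fun j _ => X_mono j hs1 (div_le_div_of_nonneg_right h hD.le) ht2
    rw [mul_div_assoc', div_le_div_iff₀ (pow_pos hs _) (pow_pos ht _)]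
    calc q ^ (2 * m) * Xprod i (s / D) ^ 2 * t ^ (2 * m)
        = Xprod i (s / D) ^ 2 * (q * t) ^ (2 * m) := by rw [mul_pow]; ring
      _ ≤ Xprod i (t / D) ^ 2 * s ^ (2 * m) := by gcongr
  -- For `t ≤ s` the logarithmic factor may shrink, but by no more than `t/s`; its square is
  -- absorbed by two of the `2m` powers, which needs `m ≥ 1`.
  · have hκ1 : t / s ≤ 1 := (div_le_one hs).2 h
    have e1 := mul_Xprod_le_of_small hir hs1 hs2 (div_pos ht hs) hκ1 hsmall
    rw [show t / s * (s / D) = t / D by field_simp] at e1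
    have e2 : q ^ (2 * m) ≤ 1 := pow_le_one₀ hq0.le hq1
    obtain ⟨k, rfl⟩ : ∃ k, m = k + 1 := ⟨m - 1, by omega⟩
    calc q ^ (2 * (k + 1)) * (Xprod i (s / D) ^ 2 / s ^ (2 * (k + 1)))
        ≤ Xprod i (s / D) ^ 2 / s ^ (2 * (k + 1)) := mul_le_of_le_one_left (by positivity) e2
      _ = (t / s * Xprod i (s / D)) ^ 2 / (s ^ (2 * k) * t ^ 2) := by
        field_simp
        ring
      _ ≤ Xprod i (t / D) ^ 2 / (s ^ (2 * k) * t ^ 2) := by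
        have : 0 ≤ t / s * Xprod i (s / D) := by positivity
        gcongr
      _ ≤ Xprod i (t / D) ^ 2 / (t ^ (2 * k) * t ^ 2) := by gcongr
      _ = _ := by rw [← pow_add]; ring_nf

/-- The negated conclusion as a gain `κ`. If `θ < 2`, then `X_r^(2-θ) → 0` and even `κ = 1` works
near the boundary; if `θ = 2` and `C > B`, take `κ = C - B`. -/
theorem exists_rpow_X_ge {r : ℕ} {C θ D B : ℝ} (hD : 0 < D) (hC : 0 < C) (hB : 0 ≤ B)
    (hneg : ¬(2 ≤ θ ∧ (θ = 2 → C ≤ B))) : ∃ κ η, 0 < κ ∧ 0 < η ∧ ∀ s, 0 < s → s < η → s ≤ D →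
      (B + κ) * X r (s / D) ^ 2 ≤ C * X r (s / D) ^ θ := by
  by_cases hθ : θ < 2
  · have hε : 0 < C / (B + 1) := by positivity
    obtain ⟨η, hη, h⟩ := exists_X_div_lt r hD (Real.rpow_pos_of_pos hε (1 / (2 - θ)))
    refine ⟨1, η, one_pos, hη, fun s hs hsη hsD => ?_⟩
    have hX := X_pos r (div_pos hs hD) ((div_le_one hD).2 hsD)
    have h1 : X r (s / D) ^ (2 - θ) ≤ C / (B + 1) := by
      have h2 := Real.rpow_le_rpow hX.le (h s hs hsη).le (by linarith : 0 ≤ 2 - θ)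
      rwa [← Real.rpow_mul hε.le, one_div_mul_cancel (by linarith), Real.rpow_one] at h2
    have h2 : X r (s / D) ^ 2 = X r (s / D) ^ θ * X r (s / D) ^ (2 - θ) := by
      rw [← Real.rpow_add hX, ← Real.rpow_natCast]
      norm_num
    rw [le_div_iff₀ (by positivity)] at h1
    have h3 := Real.rpow_nonneg hX.le θ
    rw [h2]
    nlinarith
  · have hθ2 : θ = 2 := by
      by_contra hne
      exact hneg ⟨not_lt.1 hθ, fun h => absurd h hne⟩
    have hCB : B < C := by
      by_contra hle
      exact hneg ⟨not_lt.1 hθ, fun _ => not_lt.1 hle⟩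
    refine ⟨C - B, 1, by linarith, one_pos, fun s hs _ _ => ?_⟩
    rw [hθ2, Real.rpow_two]
    linarith

end Weights

/-! ### The flux identity in the variable `s` -/

section TestFlux

variable {m r : ℕ} {D : ℝ}

theorem exists_inv_Xprod_div_le (r : ℕ) (hD : 0 < D) :
    ∃ C, 0 ≤ C ∧ ∀ s, 0 < s → s ≤ D → (Xprod r (s / D))⁻¹ ≤ C * s ^ (-(1 / 2) : ℝ) := by
  obtain ⟨C, hC0, hC⟩ := exists_inv_Xprod_le r
  refine ⟨C * (D ^ (-(1 / 2) : ℝ))⁻¹, by positivity, fun s hs hsD => ?_⟩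
  refine (hC _ (div_pos hs hD) ((div_le_one hD).2 hsD)).trans (le_of_eq ?_)
  rw [Real.div_rpow hs.le hD.le]
  ring

theorem testChain_eq_zero (M i : ℕ) {s : ℝ} (hs : 0 < s) (hsD : s < D)
    (h : (M : ℝ) + 1 < -Real.log (X r (s / D))) : testChain m r D M i s = 0 := by
  have hD : 0 < D := hs.trans hsD
  have ht := neg_log_div_pos hs hsD
  rw [← logX_neg_log r (div_pos hs hD)] at h
  have : opApply (halfInt m) (fun j => iteratedDeriv j (profile r M)) i (-Real.log (s / D)) = 0 :=
    Finset.sum_eq_zero fun j _ => by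
      have h0 : iteratedDeriv j (profile r M) (-Real.log (s / D)) = 0 :=
        iteratedDeriv_profile_eq_zero j ht h
      beta_reduce
      rw [h0, mul_zero]
  rw [testChain, this, mul_zero]

/-- The quantity multiplying `Er` in the energy bound, with `s = h` and `τ = g`. Each summand scales
like `s^(-1/2) Y_r^(-1/2)`; trading `Y_r⁻¹` for `s^(-1/2)` gives `s^(-3/2)`, the weight against
which the non-flatness is integrable. -/
theorem exists_testChain_sum_sq_le (hr : 1 ≤ r) (hD : 0 < D) : ∃ C, 0 ≤ C ∧ ∀ (M : ℕ) (s τ : ℝ),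
    0 < s → s < D → s ≤ τ →
    (∑ i ∈ Finset.range (m + 1), |testChain m r D M i s| * (τ ^ i / τ ^ m)) ^ 2 ≤
      C * (s⁻¹ * s ^ (-(1 / 2) : ℝ)) := by
  obtain ⟨C₁, hC₁, h₁⟩ := exists_abs_testChain_le (m := m) (D := D) hr
  obtain ⟨C₂, hC₂, h₂⟩ := exists_inv_Xprod_div_le r hD
  refine ⟨((m + 1) * C₁) ^ 2 * C₂, by positivity, fun M s τ hs hsD hτ => ?_⟩
  have hτ0 : 0 < τ := hs.trans_le hτ
  have hY := Xprod_pos r (div_pos hs hD) ((div_lt_one hD).2 hsD).le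
  set y := Xprod r (s / D) ^ (-(1 / 2) : ℝ) with hy
  have hy0 : 0 ≤ y := Real.rpow_nonneg hY.le _
  have e1 : ∀ i ∈ Finset.range (m + 1), |testChain m r D M i s| * (τ ^ i / τ ^ m) ≤
      C₁ * (s ^ (-(1 / 2) : ℝ) * y) := by
    intro i hi
    have him : i ≤ m := by have := Finset.mem_range.1 hi; omega
    have e2 : τ ^ i / τ ^ m ≤ s ^ i / s ^ m := by
      obtain ⟨k, rfl⟩ := Nat.exists_eq_add_of_le him
      rw [pow_add, pow_add, ← div_div, ← div_div, div_self (pow_pos hτ0 i).ne',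
        div_self (pow_pos hs i).ne']
      exact one_div_le_one_div_of_le (pow_pos hs k) (pow_le_pow_left₀ hs.le hτ k)
    have e3 : s ^ halfInt m i * (s ^ i / s ^ m) = s ^ (-(1 / 2) : ℝ) := by
      rw [← Real.rpow_natCast, ← Real.rpow_natCast, ← Real.rpow_sub hs, ← Real.rpow_add hs]
      congr 1
      unfold halfInt
      ring
    calc |testChain m r D M i s| * (τ ^ i / τ ^ m)
        ≤ (C₁ * s ^ halfInt m i * y) * (s ^ i / s ^ m) :=
          mul_le_mul (h₁ M i s him hs hsD) e2 (by positivity)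
            (mul_nonneg (mul_nonneg hC₁ (Real.rpow_nonneg hs.le _)) hy0)
      _ = C₁ * ((s ^ halfInt m i * (s ^ i / s ^ m)) * y) := by ring
      _ = _ := by rw [e3]
  have e2 : ∑ i ∈ Finset.range (m + 1), |testChain m r D M i s| * (τ ^ i / τ ^ m) ≤
      (m + 1) * C₁ * (s ^ (-(1 / 2) : ℝ) * y) := by
    refine (Finset.sum_le_sum e1).trans (le_of_eq ?_)
    simp
    ring
  have e3 : 0 ≤ ∑ i ∈ Finset.range (m + 1), |testChain m r D M i s| * (τ ^ i / τ ^ m) :=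
    Finset.sum_nonneg fun i _ => by positivity
  have e4 : (s ^ (-(1 / 2) : ℝ)) ^ 2 = s⁻¹ := by
    rw [← Real.rpow_natCast, ← Real.rpow_mul hs.le, ← Real.rpow_neg_one]; norm_num
  have e5 : y ^ 2 = (Xprod r (s / D))⁻¹ := by
    rw [hy, ← Real.rpow_natCast, ← Real.rpow_mul hY.le, ← Real.rpow_neg_one]; norm_num
  calc (∑ i ∈ Finset.range (m + 1), |testChain m r D M i s| * (τ ^ i / τ ^ m)) ^ 2
      ≤ ((m + 1) * C₁ * (s ^ (-(1 / 2) : ℝ) * y)) ^ 2 := pow_le_pow_left₀ e3 e2 2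
    _ = ((m + 1) * C₁) ^ 2 * (s⁻¹ * (Xprod r (s / D))⁻¹) := by
      rw [mul_pow, mul_pow (s ^ (-(1 / 2) : ℝ)), e4, e5]
    _ ≤ ((m + 1) * C₁) ^ 2 * (s⁻¹ * (C₂ * s ^ (-(1 / 2) : ℝ))) := by
      have := h₂ s hs hsD.le
      gcongr
    _ = _ := by ring

/-- `exists_profile_flux` under `t = -log (s/D)`. Only the main inequality retains the sharp
logarithmic error `s⁻¹ X_1^(3/2)`; the bounds on the flux need no more than `s^(-1/2)`, as they will
be multiplied by small errors. -/
theorem exists_testFlux (hr : 1 ≤ r) (hD : 0 < D) :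
    ∃ (P P' : ℕ → ℝ → ℝ) (C : ℝ), 0 ≤ C ∧ ∀ (M : ℕ) (s : ℝ), 0 < s → s < D →
      ContDiffAt ℝ 1 (P M) s ∧ HasDerivAt (P M) (-(s⁻¹ * P' M s)) s ∧
      |P M s| ≤ C * s ^ (-(1 / 2) : ℝ) ∧ |P' M s| ≤ C * s ^ (-(1 / 2) : ℝ) ∧
      ((M : ℝ) + 1 < -Real.log (X r (s / D)) → P M s = 0) ∧
      testChain m r D M m s ^ 2 ≤ testChain m r D M 0 s ^ 2 / s ^ (2 * m) *
        (A m + B m * ∑ j ∈ Finset.Icc 1 r, Xprod j (s / D) ^ 2) + s⁻¹ * P' M s +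
        C * (s⁻¹ * X 1 (s / D) ^ (3 / 2 : ℝ)) := by
  obtain ⟨p, p', C, hC, hp⟩ := exists_profile_flux (m := m) hr
  obtain ⟨C₁, hC₁, h₁⟩ := exists_inv_Xprod_div_le r hD
  obtain ⟨C₂, hC₂, h₂⟩ := exists_inv_Xprod_mul_X_one_le hr
  refine ⟨fun M s => p M (-Real.log (s / D)), fun M s => p' M (-Real.log (s / D)),
    C * C₁ + C * C₂, by positivity, fun M s hs hsD => ?_⟩
  have ht := neg_log_div_pos hs hsD
  have hs1 := div_pos hs hD
  have hs2 := ((div_lt_one hD).2 hsD).le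
  obtain ⟨c1, c2, c3, c4, c5, c6⟩ := hp M _ ht
  rw [logXprod_neg_log r hs1] at c3 c4 c6
  rw [logX_neg_log r hs1] at c5
  have hY := h₁ s hs hsD.le
  have hY2 : C * (Xprod r (s / D))⁻¹ ≤ (C * C₁ + C * C₂) * s ^ (-(1 / 2) : ℝ) := by
    have := Real.rpow_nonneg hs.le (-(1 / 2))
    have h3 : 0 ≤ C * C₂ * s ^ (-(1 / 2) : ℝ) := by positivity
    nlinarith [mul_le_mul_of_nonneg_left hY hC]
  refine ⟨?_, ?_, c3.trans hY2, c4.trans hY2, c5, ?_⟩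
  · refine ContDiffAt.comp s c1 ?_
    exact ((contDiffAt_id.div_const D).log hs1.ne').neg
  · exact (c2.comp s (hasDerivAt_neg_log_div hs hD)).congr_deriv (by ring)
  · rw [testChain_sq M hs, testChain_zero_sq M hs]
    have hX1 : (Xprod r (s / D))⁻¹ / (1 + -Real.log (s / D)) ^ 3 =
        (Xprod r (s / D))⁻¹ * X 1 (s / D) ^ 3 := by
      simp only [X, sub_eq_add_neg, inv_pow, div_eq_mul_inv]
    have h3 := h₂ _ hs1 hs2
    have h4 := (le_abs_self _).trans c6
    simp only [logXprod_neg_log _ hs1] at h4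
    rw [hX1] at h4
    have h5 := Real.rpow_nonneg (X_pos 1 hs1 hs2).le (3 / 2)
    have h6 : opApply (halfInt m) (fun j => iteratedDeriv j (profile r M)) m
        (-Real.log (s / D)) ^ 2 ≤ profile r M (-Real.log (s / D)) ^ 2 *
        (A m + B m * ∑ j ∈ Finset.Icc 1 r, Xprod j (s / D) ^ 2) + p' M (-Real.log (s / D)) +
        (C * C₁ + C * C₂) * X 1 (s / D) ^ (3 / 2 : ℝ) := by
      have h7 : 0 ≤ C * C₁ * X 1 (s / D) ^ (3 / 2 : ℝ) := by positivity
      nlinarith [mul_le_mul_of_nonneg_left h3 hC]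
    have h8 := mul_le_mul_of_nonneg_left h6 (inv_nonneg.2 hs.le)
    refine h8.trans (le_of_eq ?_)
    ring

end TestFlux

/-! ### Fixed smooth functions as symbols -/

section FixedSymbols

variable {ι : Type} {E : Type} [NormedAddCommGroup E] [NormedSpace ℝ E] {pt : ι → E} {ρ : ι → ℝ}

/-- All derivatives are bounded, and for `ρ ≤ 1` a factor `1/ρ` per derivative is allowed. -/
theorem IsSymbol.of_contDiff (hρ : ∀ i, 0 < ρ i) (hρ1 : ∀ i, ρ i ≤ 1) {F : Type}
    [NormedAddCommGroup F] [NormedSpace ℝ F] {a : E → F} (ha : ContDiff ℝ ∞ a)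
    (hc : HasCompactSupport a) : IsSymbol pt ρ (fun _ => 1) (fun _ => a) := by
  refine ⟨fun i => ha.contDiffAt, fun n => ?_⟩
  induction n generalizing F with
  | zero =>
    obtain ⟨C, hC⟩ := hc.exists_bound_of_continuous ha.continuous
    exact ⟨C, fun i => by simpa using hC (pt i)⟩
  | succ n ih =>
    obtain ⟨C, hC⟩ := hc.exists_bound_of_continuous ha.continuous
    refine ⟨⟨C, fun i => by simpa using hC (pt i)⟩, ?_⟩
    refine (ih (ha.fderiv_right (m := ∞) (by simp)) (hc.fderiv (𝕜 := ℝ))).mono hρ (K := 1)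
      (fun _ => zero_le_one) fun i => ?_
    rw [one_mul, le_div_iff₀ (hρ i), one_mul]
    exact hρ1 i

end FixedSymbols

/-! ### The geometric data near a boundary point -/

section BoundaryModel

variable {N : ℕ}

/-- A boundary point `p` of `Ω` with a graph function `g`, a smooth almost distance `h` and a
cut-off function `φ`, all of them adapted to a ball around `p`. -/
structure IsBoundaryModel (Ω : Set (EuclideanSpace ℝ (Fin N))) (D η : ℝ)
    (p e : EuclideanSpace ℝ (Fin N)) (K R c L : ℝ) (g h φ : EuclideanSpace ℝ (Fin N) → ℝ) :
    Prop where
  graph : IsGraphFunction e K g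
  apply_center : g p = 0
  radius_pos : 0 < R
  mem_iff : ∀ x ∈ Metric.ball p R, (x ∈ Ω ↔ 0 < g x)
  lt : ∀ x ∈ Metric.ball p R, g x < η
  lt_D : ∀ x ∈ Metric.ball p R, g x < D
  lt_one : ∀ x ∈ Metric.ball p R, g x < 1
  const_pos : 0 < c
  const_nonneg : 0 ≤ L
  lower : ∀ x, 0 < g x → c * g x ≤ h x
  upper : ∀ x, 0 < g x → h x ≤ g x
  smooth : ∀ x, 0 < g x → ContDiffAt ℝ ∞ h x
  dist_le : ∀ x ∈ Metric.ball p R, 0 < g x → d Ω x ≤ g x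
  dist_le' : ∀ x ∈ Metric.ball p R, 0 < g x → d Ω x ≤ h x * (1 + L * nonflat g x)
  bump_smooth : ContDiff ℝ ∞ φ
  bump_compact : HasCompactSupport φ
  bump_support : tsupport φ ⊆ Metric.ball p R
  bump_one : ∀ x ∈ Metric.ball p (R / 3), φ x = 1
  bump_nonneg : ∀ x, 0 ≤ φ x
  bump_le_one : ∀ x, φ x ≤ 1
  almost : IsAlmostDistance
    (fun x : {x : EuclideanSpace ℝ (Fin N) // x ∈ Metric.ball p R ∧ 0 < g x} => x.1)
    (fun x => g x.1) (fun x => nonflat g x.1 + g x.1) D h φ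

/-- The scale is `g`. The error is `nonflat g + g`, where the summand `g` is what the fixed bump
needs: its gradient is bounded, hence of weight `g / g`. -/
theorem exists_isBoundaryModel {Ω : Set (EuclideanSpace ℝ (Fin N))} (hΩo : IsOpen Ω)
    (hΩc : Convex ℝ Ω) (hΩne : Ω.Nonempty) (hΩu : Ω ≠ Set.univ) {D η : ℝ} (hD : 0 < D)
    (hη : 0 < η) : ∃ p e K R c L g h φ, IsBoundaryModel Ω D η p e K R c L g h φ := by
  obtain ⟨p, e, K, ρ, g, hg, hρ, hgp, hmem⟩ := exists_graphFunction hΩo hΩc hΩne hΩu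
  obtain ⟨h, c, L, hc, hL, hhg, hsym, hhess, heik, hdist⟩ := hg.exists_regularDistance
  have hK := hg.one_le_K
  -- With `R = δ/K` the Lipschitz bound gives `g < δ` on the ball. The bound `δ ≤ ρ/2` keeps the
  -- foot points, at distance at most `g`, in the ball of radius `ρ` where `Ω = {0 < g}`.
  set δ := min (min η D) (min 1 (ρ / 2)) with hδ
  have hδ0 : 0 < δ := lt_min (lt_min hη hD) (lt_min one_pos (by linarith))
  have hδη : δ ≤ η := (min_le_left _ _).trans (min_le_left _ _)
  have hδD : δ ≤ D := (min_le_left _ _).trans (min_le_right _ _)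
  have hδ1 : δ ≤ 1 := (min_le_right _ _).trans (min_le_left _ _)
  have hδρ : δ ≤ ρ / 2 := (min_le_right _ _).trans (min_le_right _ _)
  set R := δ / K with hR
  have hR0 : 0 < R := div_pos hδ0 (by linarith)
  have hRδ : R ≤ δ := div_le_self hδ0.le hK
  have hlt : ∀ x ∈ Metric.ball p R, g x < δ := fun x hx => by
    have h1 := (le_abs_self _).trans (hg.lip x p)
    rw [hgp, sub_zero] at h1
    rw [Metric.mem_ball, dist_eq_norm, hR, lt_div_iff₀ (by linarith), mul_comm] at hx
    exact h1.trans_lt hx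
  have hmem' : ∀ x ∈ Metric.ball p R, (x ∈ Ω ↔ 0 < g x) := fun x hx =>
    hmem x (Metric.ball_subset_ball (by linarith) hx)
  have hdist' : ∀ x ∈ Metric.ball p R, 0 < g x →
      d Ω x ≤ g x ∧ d Ω x ≤ h x * (1 + L * nonflat g x) := fun x hx hgx => by
    obtain ⟨y, hy0, hy1, hy2⟩ := hdist x hgx
    have hyb : y ∈ Metric.ball p ρ := by
      rw [Metric.mem_ball] at hx ⊢
      have h1 := dist_triangle_left y p x
      rw [dist_eq_norm x y] at h1
      have := hlt x hx
      linarith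
    have hyΩ : y ∉ Ω := fun hyΩ => not_lt.2 hy0 ((hmem y hyb).1 hyΩ)
    have h1 := infDist_frontier_le ((hmem' x hx).2 hgx) hyΩ
    exact ⟨h1.trans hy1, h1.trans hy2⟩
  let b : ContDiffBump p := ⟨R / 3, R / 2, by positivity, by linarith⟩
  have hb : ContDiff ℝ ∞ b := b.contDiff
  have hball : ∀ x : {x // x ∈ Metric.ball p R ∧ 0 < g x}, g x.1 ≤ 1 := fun x =>
    (hlt _ x.2.1).le.trans hδ1
  have hθ : ∀ x : {x // x ∈ Metric.ball p R ∧ 0 < g x}, 0 ≤ nonflat g x.1 := fun x =>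
    IsGraphFunction.nonflat_nonneg x.2.2
  refine ⟨p, e, K, R, c, L, g, h, b, hg, hgp, hR0, hmem', fun x hx => (hlt x hx).trans_le hδη,
    fun x hx => (hlt x hx).trans_le hδD, fun x hx => (hlt x hx).trans_le hδ1, hc, hL,
    fun x hx => (hhg x hx).1, fun x hx => (hhg x hx).2, fun x hx => hsym.smooth ⟨x, hx⟩,
    fun x hx hgx => (hdist' x hx hgx).1, fun x hx hgx => (hdist' x hx hgx).2, b.contDiff,
    b.hasCompactSupport, ?_, fun x hx => b.one_of_mem_closedBall (Metric.ball_subset_closedBall hx),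
    fun x => b.nonneg, fun x => b.le_one, ?_⟩
  · rw [b.tsupport_eq]
    exact Metric.closedBall_subset_ball (show R / 2 < R by linarith)
  · obtain ⟨C, hC0, hC⟩ := hg.exists_nonflat_le
    refine ⟨fun x => x.2.2, fun x => add_nonneg (hθ x) x.2.2.le, ⟨C + 1, fun x =>
      add_le_add (hC _ x.2.2) (hball x)⟩, fun x => (mul_pos hc x.2.2).trans_le (hhg _ x.2.2).1,
      fun x => (hhg _ x.2.2).2.trans_lt ((hlt _ x.2.1).trans_le hδD), ?_, ?_, ?_, ?_, ?_⟩
    · exact hsym.reindex fun x : {x // x ∈ Metric.ball p R ∧ 0 < g x} => ⟨x.1, x.2.2⟩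
    · refine (hhess.reindex fun x : {x // x ∈ Metric.ball p R ∧ 0 < g x} =>
        (⟨x.1, x.2.2⟩ : {x // 0 < g x})).mono (fun x => x.2.2)
        (fun x => div_nonneg (hθ x) x.2.2.le) 1 fun x => ?_
      rw [one_mul]
      exact div_le_div_of_nonneg_right (le_add_of_nonneg_right x.2.2.le) x.2.2.le
    · exact ⟨L, fun x => (heik _ x.2.2).trans
        (mul_le_mul_of_nonneg_left (le_add_of_nonneg_right x.2.2.le) hL)⟩
    · exact IsSymbol.of_contDiff (fun x => x.2.2) hball b.contDiff b.hasCompactSupport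
    · refine (IsSymbol.of_contDiff (fun x => x.2.2) hball
        (hb.fderiv_right (m := ∞) (by simp)) (b.hasCompactSupport.fderiv (𝕜 := ℝ))).mono
        (fun x => x.2.2) (fun _ => zero_le_one) 1 fun x => ?_
      rw [one_mul, le_div_iff₀ x.2.2, one_mul]
      exact le_add_of_nonneg_left (hθ x)

end BoundaryModel

/-! ### Extension by zero across the graph -/

section ExtendByZero

/-- Extension by zero from `{0 < g}` of a function vanishing near `{g = 0}`. -/
theorem contDiff_ite_pos {E : Type} [NormedAddCommGroup E] [NormedSpace ℝ E] {n : WithTop ℕ∞}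
    {g F : E → ℝ} {s₀ : ℝ} (hg : Continuous g) (hs₀ : 0 < s₀)
    (hF : ∀ x, 0 < g x → ContDiffAt ℝ n F x) (h0 : ∀ x, 0 < g x → g x < s₀ → F x = 0) :
    ContDiff ℝ n fun x => if 0 < g x then F x else 0 := by
  refine contDiff_iff_contDiffAt.2 fun x => ?_
  by_cases hx : 0 < g x
  · refine (hF x hx).congr_of_eventuallyEq ?_
    filter_upwards [hg.continuousAt.eventually (lt_mem_nhds hx)] with y hy
    rw [if_pos hy]
  · refine (contDiffAt_const (c := (0 : ℝ))).congr_of_eventuallyEq ?_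
    filter_upwards [hg.continuousAt.eventually (gt_mem_nhds (lt_of_le_of_lt (not_lt.1 hx) hs₀))]
      with y hy
    split_ifs with hy0
    · exact h0 y hy0 hy
    · rfl

theorem tsupport_ite_pos_subset {E : Type} [TopologicalSpace E] {g F φ : E → ℝ} {s₀ : ℝ}
    (hg : Continuous g)
    (h0 : ∀ x, 0 < g x → g x < s₀ → F x = 0) (hφ : ∀ x, φ x = 0 → F x = 0) :
    tsupport (fun x => if 0 < g x then F x else 0) ⊆ tsupport φ ∩ {x | s₀ ≤ g x} := by
  refine closure_minimal (fun x hx => ?_)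
    ((isClosed_tsupport φ).inter (isClosed_le continuous_const hg))
  have hx1 : 0 < g x := by
    by_contra hne
    exact hx (if_neg hne)
  have hx2 : F x ≠ 0 := fun h => hx (by simp only [if_pos hx1, h])
  exact ⟨subset_tsupport φ fun h => hx2 (hφ x h), not_lt.1 fun h => hx2 (h0 x hx1 h)⟩

end ExtendByZero

/-! ### Comparing the critical weight at `h` with the Hardy weight at `d` -/

section HardyWeight

/-- The weight in front of `u ^ 2` in the Hardy–Rellich inequality with remainder, as a function of
the distance to the boundary. -/
def hardyWeight (m r : ℕ) (D C θ t : ℝ) : ℝ :=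
  (A m + B m * ∑ i ∈ Finset.Icc 1 (r - 1), Xprod i (t / D) ^ 2 +
    C * (Xprod (r - 1) (t / D) ^ 2 * X r (t / D) ^ θ)) / t ^ (2 * m)

/-- The critical weight with constant `B m + κ` in front of the last term. -/
def criticalWeight (m r : ℕ) (D κ s : ℝ) : ℝ :=
  A m + B m * ∑ j ∈ Finset.Icc 1 r, Xprod j (s / D) ^ 2 + κ * Xprod r (s / D) ^ 2

variable {m r : ℕ} {D C θ κ s t q : ℝ}

theorem criticalWeight_nonneg (hκ : 0 ≤ κ) : 0 ≤ criticalWeight m r D κ s := by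
  have := A_nonneg m
  have := B_nonneg m
  unfold criticalWeight
  have : 0 ≤ ∑ j ∈ Finset.Icc 1 r, Xprod j (s / D) ^ 2 := Finset.sum_nonneg fun _ _ => sq_nonneg _
  positivity

theorem criticalWeight_le (hκ : 0 ≤ κ) (hs : 0 < s) (hsD : s ≤ D) :
    criticalWeight m r D κ s ≤ A m + B m * r + κ := by
  have hD := hs.trans_le hsD
  have h1 : ∀ j, Xprod j (s / D) ^ 2 ≤ 1 := fun j =>
    pow_le_one₀ (Xprod_pos j (div_pos hs hD) ((div_le_one hD).2 hsD)).le
      (Xprod_le_one j (div_pos hs hD) ((div_le_one hD).2 hsD))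
  have h2 : ∑ j ∈ Finset.Icc 1 r, Xprod j (s / D) ^ 2 ≤ r := by
    refine (Finset.sum_le_sum fun j _ => h1 j).trans (by simp)
  have := B_nonneg m
  unfold criticalWeight
  nlinarith [mul_le_mul_of_nonneg_left h2 this, mul_le_mul_of_nonneg_left (h1 r) hκ]

/-- Almost monotonicity is applied to each term separately. In the last one `(B + κ) X_r²` is
replaced by `C X_r^θ`, evaluated at `t`. -/
theorem criticalWeight_div_le (hm : 1 ≤ m) (hr : 1 ≤ r) (hκ : 0 ≤ κ) (hs : 0 < s) (hsD : s ≤ D)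
    (ht : 0 < t) (htD : t ≤ D) (hq0 : 0 < q) (hq1 : q ≤ 1) (hqs : q * t ≤ s)
    (hsmall : r * X 1 (s / D) ≤ 1) (hX : (B m + κ) * X r (t / D) ^ 2 ≤ C * X r (t / D) ^ θ) :
    q ^ (2 * m) * (criticalWeight m r D κ s / s ^ (2 * m)) ≤ hardyWeight m r D C θ t := by
  obtain ⟨k, rfl⟩ : ∃ k, r = k + 1 := ⟨r - 1, by omega⟩
  have h := fun i (hi : i ≤ k + 1) => weight_comparison hm hi hs hsD ht htD hq0 hq1 hqs hsmall
  have h0 := mul_le_mul_of_nonneg_left (h 0 (by omega)) (A_nonneg m)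
  have h1 := mul_le_mul_of_nonneg_left (Finset.sum_le_sum fun i (hi : i ∈ Finset.Icc 1 k) =>
    h i (by have := (Finset.mem_Icc.1 hi).2; omega)) (B_nonneg m)
  have hBκ : 0 ≤ B m + κ := add_nonneg (B_nonneg m) hκ
  have h2 := mul_le_mul_of_nonneg_left (h (k + 1) le_rfl) hBκ
  have h3 : (B m + κ) * (Xprod (k + 1) (t / D) ^ 2 / t ^ (2 * m)) ≤
      C * (Xprod k (t / D) ^ 2 * X (k + 1) (t / D) ^ θ) / t ^ (2 * m) := by
    rw [mul_div_assoc']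
    refine div_le_div_of_nonneg_right ?_ (pow_pos ht _).le
    rw [Xprod_succ, mul_pow]
    nlinarith [mul_le_mul_of_nonneg_left hX (sq_nonneg (Xprod k (t / D)))]
  simp only [Xprod_zero] at h0
  unfold criticalWeight hardyWeight
  rw [Finset.sum_Icc_succ_top (by omega), Nat.add_sub_cancel]
  rw [← Finset.mul_sum, ← Finset.sum_div, ← Finset.sum_div] at h1
  have e1 : q ^ (2 * m) * ((A m + B m * (∑ j ∈ Finset.Icc 1 k, Xprod j (s / D) ^ 2 +
      Xprod (k + 1) (s / D) ^ 2) + κ * Xprod (k + 1) (s / D) ^ 2) / s ^ (2 * m)) =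
      A m * (q ^ (2 * m) * (1 ^ 2 / s ^ (2 * m))) +
      B m * (q ^ (2 * m) * ((∑ j ∈ Finset.Icc 1 k, Xprod j (s / D) ^ 2) / s ^ (2 * m))) +
      (B m + κ) * (q ^ (2 * m) * (Xprod (k + 1) (s / D) ^ 2 / s ^ (2 * m))) := by ring
  rw [e1, add_div, add_div]
  have e2 : A m / t ^ (2 * m) = A m * (1 ^ 2 / t ^ (2 * m)) := by ring
  have e3 : B m * (∑ j ∈ Finset.Icc 1 k, Xprod j (t / D) ^ 2) / t ^ (2 * m) =
    B m * ((∑ j ∈ Finset.Icc 1 k, Xprod j (t / D) ^ 2) / t ^ (2 * m)) := by ring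
  rw [e2, e3]
  linarith

/-- The critical weight at `s` is controlled by the weight at the slightly larger `t`. -/
theorem criticalWeight_div_le_add (hm : 1 ≤ m) (hr : 1 ≤ r) (hκ : 0 ≤ κ) (hs : 0 < s)
    (hsD : s ≤ D) (ht : 0 < t) (htD : t ≤ D) {ε : ℝ} (hε : 0 ≤ ε) (hts : t ≤ s * (1 + ε))
    (hsmall : r * X 1 (s / D) ≤ 1) (hX : (B m + κ) * X r (t / D) ^ 2 ≤ C * X r (t / D) ^ θ) :
    criticalWeight m r D κ s / s ^ (2 * m) ≤ hardyWeight m r D C θ t +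
      2 * m * ε * (A m + B m * r + κ) / s ^ (2 * m) := by
  have hq : 0 < (1 + ε)⁻¹ := by positivity
  have h1 := criticalWeight_div_le (C := C) (θ := θ) hm hr hκ hs hsD ht htD hq
    (inv_le_one_of_one_le₀ (by linarith)) ((inv_mul_le_iff₀ (by positivity)).2 (by linarith))
    hsmall hX
  -- Bernoulli: with `q = 1/(1 + ε)` the factor `q^(2m)` is at least `1 - 2mε`.
  have h2 := one_add_mul_le_pow (a := (1 + ε)⁻¹ - 1) (by linarith) (2 * m)
  have h3 : -ε ≤ (1 + ε)⁻¹ - 1 := by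
    have : (1 + ε)⁻¹ - 1 = -ε * (1 + ε)⁻¹ := by field_simp; ring
    rw [this]
    nlinarith [inv_le_one_of_one_le₀ (by linarith : 1 ≤ 1 + ε)]
  have h4 : 1 - 2 * m * ε ≤ (1 + ε)⁻¹ ^ (2 * m) := by
    have h5 := mul_le_mul_of_nonneg_left h3 (by positivity : 0 ≤ ((2 * m : ℕ) : ℝ))
    rw [add_sub_cancel] at h2
    push_cast at h2 h5
    linarith
  have h5 : 0 ≤ criticalWeight m r D κ s / s ^ (2 * m) :=
    div_nonneg (criticalWeight_nonneg hκ) (by positivity)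
  have h6 : criticalWeight m r D κ s / s ^ (2 * m) ≤ (A m + B m * r + κ) / s ^ (2 * m) :=
    div_le_div_of_nonneg_right (criticalWeight_le hκ hs hsD) (by positivity)
  have h7 := mul_le_mul_of_nonneg_right h4 h5
  have h8 := mul_le_mul_of_nonneg_left h6 (by positivity : 0 ≤ 2 * m * ε)
  rw [mul_div_assoc]
  nlinarith

end HardyWeight

/-! ### The divergence of the flux -/

section Flux

variable {E : Type} [NormedAddCommGroup E] [InnerProductSpace ℝ E] [FiniteDimensional ℝ E]
  {ι : Type} {pt : ι → E} {ρ Er : ι → ℝ} {h φ : E → ℝ} {D : ℝ}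

/-- By the product rule every term contains `Dφ` or `D²h`, both of weight `Er / ρ`. -/
theorem IsAlmostDistance.exists_fderiv_bump_sq_le (hA : IsAlmostDistance pt ρ Er D h φ) (v : E) :
    ∃ C, 0 ≤ C ∧ ∀ k,
      |fderiv ℝ (fun y => φ y * φ y * fderiv ℝ h y v) (pt k) v| ≤ C * (Er k / ρ k) := by
  have hp := hA.isSymbol_partialDeriv v
  have hb := hA.symbol_bump
  obtain ⟨C₁, h1⟩ :=
    ((hb.mul (hA.fderiv_bump.clm (ContinuousLinearMap.apply ℝ ℝ v))).mul hp).value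
  obtain ⟨C₂, h2⟩ := ((hb.mul hb).mul ((hA.isSymbol_fderiv_partialDeriv v).clm
    (ContinuousLinearMap.apply ℝ ℝ v))).value
  refine ⟨2 * |C₁| + |C₂|, by positivity, fun k => ?_⟩
  have hW : 0 ≤ Er k / ρ k := div_nonneg (hA.error_nonneg k) (hA.scale_pos k).le
  have d1 := (hb.smooth k).differentiableAt (by simp)
  have d2 := (hp.smooth k).differentiableAt (by simp)
  have h1k := h1 k
  have h2k := h2 k
  simp only [one_mul, mul_one, ContinuousLinearMap.apply_apply, Real.norm_eq_abs] at h1k h2k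
  have e1 : fderiv ℝ (fun y => φ y * φ y * fderiv ℝ h y v) (pt k) v =
      2 * (φ (pt k) * fderiv ℝ φ (pt k) v * fderiv ℝ h (pt k) v) +
        φ (pt k) * φ (pt k) * fderiv ℝ (fun y => fderiv ℝ h y v) (pt k) v := by
    rw [fderiv_fun_mul (d1.fun_mul d1) d2, fderiv_fun_mul d1 d1]
    simp
    ring
  rw [e1]
  have a1 := mul_le_mul_of_nonneg_right (le_abs_self C₁) hW
  have a2 := mul_le_mul_of_nonneg_right (le_abs_self C₂) hW
  refine (abs_add_le _ _).trans ?_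
  rw [abs_mul, abs_two]
  linarith

/-- The divergence of the flux `P(h) φ² ∇h`. -/
theorem IsAlmostDistance.exists_flux_le (hA : IsAlmostDistance pt ρ Er D h φ) {κ : Type} [Fintype κ]
    (b : OrthonormalBasis κ ℝ E) : ∃ C, 0 ≤ C ∧ ∀ (P : ℝ → ℝ) (a : ℝ) (k : ι) (Q : κ → E → ℝ),
      HasDerivAt P (-a) (h (pt k)) →
      (∀ j, Q j =ᶠ[nhds (pt k)] fun y => P (h y) * (φ y * φ y * fderiv ℝ h y (b j))) →
      φ (pt k) ^ 2 * a ≤ -∑ j, fderiv ℝ (Q j) (pt k) (b j) +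
        C * (Er k * ((ρ k)⁻¹ * |P (h (pt k))| + |a|)) := by
  choose c hc0 hc using fun j => hA.exists_fderiv_bump_sq_le (b j)
  obtain ⟨C₁, hC₁⟩ := hA.eikonal
  obtain ⟨C₂, hC₂⟩ := hA.symbol_bump.value
  have hC₂' : ∀ k, φ (pt k) ^ 2 ≤ C₂ ^ 2 := fun k => by
    have := hC₂ k
    rw [mul_one, Real.norm_eq_abs] at this
    exact sq_le_sq.2 (this.trans (le_abs_self _))
  refine ⟨∑ j, c j + C₂ ^ 2 * |C₁|, add_nonneg (Finset.sum_nonneg fun j _ => hc0 j) (by positivity),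
    fun P a k Q hP hQ => ?_⟩
  have hh := (hA.symbol.smooth k).differentiableAt (by simp)
  have hEr := hA.error_nonneg k
  have hρ := hA.scale_pos k
  have e1 : ∀ j, fderiv ℝ (Q j) (pt k) (b j) =
      P (h (pt k)) * fderiv ℝ (fun y => φ y * φ y * fderiv ℝ h y (b j)) (pt k) (b j) -
      a * φ (pt k) ^ 2 * fderiv ℝ h (pt k) (b j) ^ 2 := fun j => by
    have hd : DifferentiableAt ℝ (fun y => φ y * φ y * fderiv ℝ h y (b j)) (pt k) :=
      (((hA.symbol_bump.smooth k).mul (hA.symbol_bump.smooth k)).mul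
        ((hA.isSymbol_partialDeriv (b j)).smooth k)).differentiableAt (by simp)
    have h1 := (hP.comp_hasFDerivAt (pt k) hh.hasFDerivAt).mul hd.hasFDerivAt
    rw [(hQ j).fderiv_eq]
    change (fderiv ℝ ((P ∘ h) * _) (pt k)) (b j) = _
    rw [h1.fderiv]
    simp
    ring
  -- `div (P(h) φ² ∇h) = P(h) div (φ² ∇h) - a φ² |∇h|²`, since `P' = -a`; the first term is small,
  -- and in the second `|∇h|²` is nearly one.
  have e2 : ∑ j, fderiv ℝ (Q j) (pt k) (b j) = P (h (pt k)) *
      ∑ j, fderiv ℝ (fun y => φ y * φ y * fderiv ℝ h y (b j)) (pt k) (b j) -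
      a * φ (pt k) ^ 2 * ‖fderiv ℝ h (pt k)‖ ^ 2 := by
    rw [Finset.sum_congr rfl fun j _ => e1 j, Finset.sum_sub_distrib, ← Finset.mul_sum,
      ← Finset.mul_sum, sum_sq_apply_orthonormalBasis]
  set S := ∑ j, fderiv ℝ (fun y => φ y * φ y * fderiv ℝ h y (b j)) (pt k) (b j) with hS
  have e3 : |S| ≤ (∑ j, c j) * (Er k / ρ k) := by
    rw [Finset.sum_mul]
    exact (Finset.abs_sum_le_sum_abs _ _).trans (Finset.sum_le_sum fun j _ => hc j k)
  have e4 : P (h (pt k)) * S ≤ |P (h (pt k))| * ((∑ j, c j) * (Er k / ρ k)) := by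
    refine (le_abs_self _).trans ?_
    rw [abs_mul]
    exact mul_le_mul_of_nonneg_left e3 (abs_nonneg _)
  have e5 : a * φ (pt k) ^ 2 * (1 - ‖fderiv ℝ h (pt k)‖ ^ 2) ≤ |a| * C₂ ^ 2 * (|C₁| * Er k) := by
    refine (le_abs_self _).trans ?_
    rw [abs_mul, abs_mul, abs_of_nonneg (sq_nonneg (φ (pt k))), abs_sub_comm]
    have h1 : |‖fderiv ℝ h (pt k)‖ ^ 2 - 1| ≤ |C₁| * Er k :=
      (hC₁ k).trans (mul_le_mul_of_nonneg_right (le_abs_self _) hEr)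
    exact mul_le_mul (mul_le_mul_of_nonneg_left (hC₂' k) (abs_nonneg _)) h1 (abs_nonneg _)
      (by positivity)
  have hc1 : 0 ≤ ∑ j, c j := Finset.sum_nonneg fun j _ => hc0 j
  have e6 : 0 ≤ (∑ j, c j) * (Er k * |a|) + C₂ ^ 2 * |C₁| * (Er k * ((ρ k)⁻¹ * |P (h (pt k))|)) := by
    positivity
  rw [e2]
  calc φ (pt k) ^ 2 * a = -(P (h (pt k)) * S - a * φ (pt k) ^ 2 * ‖fderiv ℝ h (pt k)‖ ^ 2) +
        P (h (pt k)) * S + a * φ (pt k) ^ 2 * (1 - ‖fderiv ℝ h (pt k)‖ ^ 2) := by ring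
    _ ≤ -(P (h (pt k)) * S - a * φ (pt k) ^ 2 * ‖fderiv ℝ h (pt k)‖ ^ 2) +
        |P (h (pt k))| * ((∑ j, c j) * (Er k / ρ k)) + |a| * C₂ ^ 2 * (|C₁| * Er k) := by linarith
    _ ≤ _ := by
      rw [div_eq_mul_inv]
      linarith

end Flux

/-! ### Test functions near the boundary -/

section BoundaryExtend

variable {N : ℕ}

/-- The product of `G` with the cut-off function `φ`, extended by zero from `{0 < g}`. -/
def boundaryExtend (g φ G : EuclideanSpace ℝ (Fin N) → ℝ) (x : EuclideanSpace ℝ (Fin N)) : ℝ :=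
  if 0 < g x then G x * φ x else 0

/-- The size of the error terms near the boundary. -/
def boundaryError (D : ℝ) (g : EuclideanSpace ℝ (Fin N) → ℝ) (x : EuclideanSpace ℝ (Fin N)) : ℝ :=
  g x ^ (-(3 / 2) : ℝ) * (nonflat g x + g x) + (g x)⁻¹ * X 1 (g x / D) ^ (3 / 2 : ℝ)

namespace IsBoundaryModel

variable {Ω : Set (EuclideanSpace ℝ (Fin N))} {D η : ℝ} {p e : EuclideanSpace ℝ (Fin N)}
  {K R c L : ℝ} {g h φ G : EuclideanSpace ℝ (Fin N) → ℝ} {s₀ : ℝ}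

theorem boundaryExtend_eventuallyEq (hM : IsBoundaryModel Ω D η p e K R c L g h φ)
    {x : EuclideanSpace ℝ (Fin N)} (hx : 0 < g x) :
    boundaryExtend g φ G =ᶠ[nhds x] fun y => G y * φ y := by
  filter_upwards [hM.graph.continuous.continuousAt.eventually (lt_mem_nhds hx)] with y hy
  exact if_pos hy

theorem contDiff_boundaryExtend (hM : IsBoundaryModel Ω D η p e K R c L g h φ) {n : WithTop ℕ∞}
    (hn : n ≤ ∞) (hs₀ : 0 < s₀) (hG : ∀ x ∈ Metric.ball p R, 0 < g x → ContDiffAt ℝ n G x)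
    (h0 : ∀ x ∈ Metric.ball p R, 0 < g x → g x < s₀ → G x = 0) :
    ContDiff ℝ n (boundaryExtend g φ G) := by
  refine contDiff_ite_pos hM.graph.continuous hs₀ (fun x hx => ?_) fun x hx hxs => ?_
  · by_cases hxφ : x ∈ tsupport φ
    · exact (hG x (hM.bump_support hxφ) hx).mul (hM.bump_smooth.contDiffAt.of_le hn)
    · refine (contDiffAt_const (c := (0 : ℝ))).congr_of_eventuallyEq ?_
      filter_upwards [notMem_tsupport_iff_eventuallyEq.1 hxφ] with y hy
      rw [hy, Pi.zero_apply, mul_zero]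
  · by_cases hxφ : x ∈ tsupport φ
    · rw [h0 x (hM.bump_support hxφ) hx hxs, zero_mul]
    · rw [image_eq_zero_of_notMem_tsupport hxφ, mul_zero]

theorem tsupport_boundaryExtend_subset (hM : IsBoundaryModel Ω D η p e K R c L g h φ)
    (h0 : ∀ x ∈ Metric.ball p R, 0 < g x → g x < s₀ → G x = 0) :
    tsupport (boundaryExtend g φ G) ⊆ tsupport φ ∩ {x | s₀ ≤ g x} := by
  refine tsupport_ite_pos_subset hM.graph.continuous (fun x hx hxs => ?_) fun x hx => ?_
  · by_cases hxφ : x ∈ tsupport φ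
    · rw [h0 x (hM.bump_support hxφ) hx hxs, zero_mul]
    · rw [image_eq_zero_of_notMem_tsupport hxφ, mul_zero]
  · rw [hx, mul_zero]

theorem hasCompactSupport_boundaryExtend (hM : IsBoundaryModel Ω D η p e K R c L g h φ)
    (h0 : ∀ x ∈ Metric.ball p R, 0 < g x → g x < s₀ → G x = 0) :
    HasCompactSupport (boundaryExtend g φ G) :=
  hM.bump_compact.of_isClosed_subset (isClosed_tsupport _)
    fun _ hx => (hM.tsupport_boundaryExtend_subset h0 hx).1

theorem tsupport_boundaryExtend_subset' (hM : IsBoundaryModel Ω D η p e K R c L g h φ)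
    (hs₀ : 0 < s₀) (h0 : ∀ x ∈ Metric.ball p R, 0 < g x → g x < s₀ → G x = 0) :
    tsupport (boundaryExtend g φ G) ⊆ Metric.ball p R ∩ {x | 0 < g x} := fun _ hx =>
  ⟨hM.bump_support (hM.tsupport_boundaryExtend_subset h0 hx).1,
    hs₀.trans_le (hM.tsupport_boundaryExtend_subset h0 hx).2⟩

theorem const_le_one (hM : IsBoundaryModel Ω D η p e K R c L g h φ)
    {x : EuclideanSpace ℝ (Fin N)} (hx : 0 < g x) : c ≤ 1 := by
  have := (hM.lower x hx).trans (hM.upper x hx)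
  exact le_of_mul_le_mul_right (by linarith) hx

/-- Test functions concentrated near the boundary, which satisfy a pointwise reverse inequality up
to a divergence and to an error of controlled size. -/
theorem exists_testFunction (hM : IsBoundaryModel Ω D η p e K R c L g h φ) {m r : ℕ} (hm : 1 ≤ m)
    (hr : 1 ≤ r) {C θ κ : ℝ} (hD : 0 < D) (hκ : 0 ≤ κ) (hd : ∀ x ∈ Ω, 0 < d Ω x)
    (hsmall : ∀ s, 0 < s → s < η → r * X 1 (s / D) ≤ 1)
    (hX : ∀ s, 0 < s → s < η → s ≤ D → (B m + κ) * X r (s / D) ^ 2 ≤ C * X r (s / D) ^ θ) :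
    ∃ C₀, 0 ≤ C₀ ∧ ∀ M : ℕ, ∃ (u : EuclideanSpace ℝ (Fin N) → ℝ)
      (Q : Fin N → EuclideanSpace ℝ (Fin N) → ℝ), ContDiff ℝ ∞ u ∧ HasCompactSupport u ∧
      tsupport u ⊆ Metric.ball p R ∩ {x | 0 < g x} ∧
      (∀ j, ContDiff ℝ 1 (Q j) ∧ HasCompactSupport (Q j) ∧
        tsupport (Q j) ⊆ Metric.ball p R ∩ {x | 0 < g x}) ∧
      (∀ x ∈ Metric.ball p R, 0 < g x →
        energyDensity m u x + κ * (u x ^ 2 / h x ^ (2 * m) * Xprod r (h x / D) ^ 2) ≤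
          u x ^ 2 * hardyWeight m r D C θ (d Ω x) -
            ∑ j, fderiv ℝ (Q j) x (EuclideanSpace.basisFun (Fin N) ℝ j) +
            C₀ * boundaryError D g x) ∧
      ∀ x ∈ Metric.ball p (R / 3), 0 < g x → h x < D → -Real.log (X r (h x / D)) ≤ M →
        u x ^ 2 / h x ^ (2 * m) * Xprod r (h x / D) ^ 2 = (h x)⁻¹ * Xprod r (h x / D) := by
  obtain ⟨C₁, hC₁, hE⟩ := hM.almost.exists_energyDensity_le m
  obtain ⟨C₂, hC₂, hS⟩ := exists_testChain_sum_sq_le (m := m) (D := D) hr hD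
  obtain ⟨P, P', C₃, hC₃, hP⟩ := exists_testFlux (m := m) (D := D) hr hD
  obtain ⟨C₄, hC₄, hF⟩ := hM.almost.exists_flux_le (EuclideanSpace.basisFun (Fin N) ℝ)
  set T₀ := A m + B m * r + κ with hT₀
  have hT₀0 : 0 ≤ T₀ := by
    have := A_nonneg m
    have := B_nonneg m
    positivity
  have hL := hM.const_nonneg
  have hc := hM.const_pos
  set C₅ := C₁ * C₂ + 2 * m * L * T₀ * C₂ + 2 * C₄ * C₃ with hC₅
  have hC₅0 : 0 ≤ C₅ := by positivity
  refine ⟨C₅ * c ^ (-(3 / 2) : ℝ) + C₃ * c⁻¹, by positivity, fun M => ?_⟩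
  obtain ⟨s₁, hs₁, hz⟩ := exists_testChain_eq_zero (r := r) hD M
  have hvan : ∀ x ∈ Metric.ball p R, 0 < g x → g x < s₁ →
      0 < h x ∧ h x < D ∧ (M : ℝ) + 1 < -Real.log (X r (h x / D)) := fun x hx hgx hxs => by
    have h1 := (mul_pos hc hgx).trans_le (hM.lower x hgx)
    exact ⟨h1, (hM.upper x hgx).trans_lt (hM.lt_D x hx), hz _ h1 ((hM.upper x hgx).trans_lt hxs)⟩
  have hG0 : ∀ x ∈ Metric.ball p R, 0 < g x → g x < s₁ → testChain m r D M 0 (h x) = 0 :=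
    fun x hx hgx hxs => by
      obtain ⟨h1, h2, h3⟩ := hvan x hx hgx hxs
      exact testChain_eq_zero M 0 h1 h2 h3
  -- Only one factor `φ` is put here; `boundaryExtend` supplies the second one of `P(h) φ² ∇h`.
  let q : Fin N → EuclideanSpace ℝ (Fin N) → ℝ := fun j y =>
    P M (h y) * (φ y * fderiv ℝ h y (EuclideanSpace.basisFun (Fin N) ℝ j))
  have hq0 : ∀ j, ∀ x ∈ Metric.ball p R, 0 < g x → g x < s₁ → q j x = 0 := fun j x hx hgx hxs => by
    obtain ⟨h1, h2, h3⟩ := hvan x hx hgx hxs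
    simp only [q, (hP M _ h1 h2).2.2.2.2.1 h3, zero_mul]
  refine ⟨boundaryExtend g φ fun x => testChain m r D M 0 (h x), fun j => boundaryExtend g φ (q j),
    hM.contDiff_boundaryExtend le_rfl hs₁ (fun x hx hgx => ?_) hG0,
    hM.hasCompactSupport_boundaryExtend hG0, hM.tsupport_boundaryExtend_subset' hs₁ hG0,
    fun j => ⟨hM.contDiff_boundaryExtend (by simp) hs₁ (fun x hx hgx => ?_) (hq0 j),
      hM.hasCompactSupport_boundaryExtend (hq0 j), hM.tsupport_boundaryExtend_subset' hs₁ (hq0 j)⟩,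
    fun x hx hgx => ?_, fun x hx hgx hhD hxM => ?_⟩
  · exact ((isChain_testChain hr M).contDiffAt 0 ((mul_pos hc hgx).trans_le (hM.lower x hgx))
      ((hM.upper x hgx).trans_lt (hM.lt_D x hx))).comp x (hM.smooth x hgx)
  · have hh := hM.smooth x hgx
    have h1 := (hP M _ ((mul_pos hc hgx).trans_le (hM.lower x hgx))
      ((hM.upper x hgx).trans_lt (hM.lt_D x hx))).1
    refine (h1.comp x (hh.of_le (by simp))).mul ((hM.bump_smooth.contDiffAt.of_le (by simp)).mul ?_)
    exact ((hh.fderiv_right (m := ∞) (by simp)).clm_apply contDiffAt_const).of_le (by simp)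
  · have hsτ := hM.upper x hgx
    have hcs := hM.lower x hgx
    have hs0 : 0 < h x := (mul_pos hc hgx).trans_le hcs
    have hτD := hM.lt_D x hx
    have hsD : h x < D := hsτ.trans_lt hτD
    have hxΩ := (hM.mem_iff x hx).2 hgx
    have hdg := hM.dist_le x hx hgx
    have hθ : 0 ≤ nonflat g x := IsGraphFunction.nonflat_nonneg hgx
    obtain ⟨-, f1, f2, f3, -, f4⟩ := hP M (h x) hs0 hsD
    -- The ingredients: the energy in terms of `f^(m)(h)` (`a1`), bounds for the chain at the scales
    -- `g` and `h` (`a2`, `a3`), the passage from the weight at `h` to the weight at `d` (`a4`), and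
    -- the flux (`a5`). The one-dimensional inequality `f4` links `a1` to `a4` and `a5`.
    have a1 := hE _ (isChain_testChain hr M) (boundaryExtend g φ fun x => testChain m r D M 0 (h x))
      ⟨x, hx, hgx⟩ (hM.boundaryExtend_eventuallyEq hgx)
    have a2 := hS M (h x) (g x) hs0 hsD hsτ
    have a3 := hS M (h x) (h x) hs0 hsD le_rfl
    have a4 := criticalWeight_div_le_add (C := C) (θ := θ) hm hr hκ hs0 hsD.le (hd x hxΩ)
      (hdg.trans hτD.le) (mul_nonneg hL hθ) (hM.dist_le' x hx hgx)
      (hsmall _ hs0 (hsτ.trans_lt (hM.lt x hx)))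
      (hX _ (hd x hxΩ) (hdg.trans_lt (hM.lt x hx)) (hdg.trans hτD.le))
    have a5 := hF (P M) ((h x)⁻¹ * P' M (h x)) ⟨x, hx, hgx⟩ (fun j => boundaryExtend g φ (q j)) f1
      fun j => (hM.boundaryExtend_eventuallyEq hgx).trans
        (Filter.Eventually.of_forall fun y => by simp only [q]; ring)
    rw [← hT₀] at a4
    simp only at a1 a5
    have hu : boundaryExtend g φ (fun x => testChain m r D M 0 (h x)) x =
      testChain m r D M 0 (h x) * φ x := if_pos hgx
    rw [hu]
    set s := h x with hs
    set τ := g x with hτ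
    set w := s⁻¹ * s ^ (-(1 / 2) : ℝ) with hw
    set a := s⁻¹ * P' M s with ha
    set Er := nonflat g x + τ with hEr
    set f₀ := testChain m r D M 0 s with hf₀
    set Sm := ∑ i ∈ Finset.range (m + 1), |testChain m r D M i s| * (τ ^ i / τ ^ m) with hSm
    have hw0 : 0 ≤ w := by positivity
    have hEr0 : 0 ≤ Er := by positivity
    -- This is the summand `i = 0` of the chain bound at the scale `τ = s`.
    have hF1 : f₀ ^ 2 / s ^ (2 * m) ≤ C₂ * w := by
      refine le_trans ?_ a3
      have h1 : |f₀| * (s ^ 0 / s ^ m) ≤ ∑ i ∈ Finset.range (m + 1),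
          |testChain m r D M i s| * (s ^ i / s ^ m) :=
        Finset.single_le_sum (f := fun i => |testChain m r D M i s| * (s ^ i / s ^ m))
          (fun i _ => by positivity) (Finset.mem_range.2 (by omega))
      refine (le_of_eq ?_).trans (pow_le_pow_left₀ (by positivity) h1 2)
      rw [mul_pow, sq_abs, pow_zero, div_pow, one_pow, ← pow_mul, mul_comm m 2, mul_one_div]
    have hP1 : τ⁻¹ * |P M s| ≤ C₃ * w := by
      calc τ⁻¹ * |P M s| ≤ s⁻¹ * (C₃ * s ^ (-(1 / 2) : ℝ)) := by
            have := inv_anti₀ hs0 hsτ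
            gcongr
        _ = _ := by rw [hw]; ring
    have ha1 : |a| ≤ C₃ * w := by
      rw [ha, abs_mul, abs_of_pos (inv_pos.2 hs0)]
      calc s⁻¹ * |P' M s| ≤ s⁻¹ * (C₃ * s ^ (-(1 / 2) : ℝ)) := by gcongr
        _ = _ := by rw [hw]; ring
    have hφ0 := hM.bump_nonneg x
    have hφ1 : φ x ^ 2 ≤ 1 := pow_le_one₀ hφ0 (hM.bump_le_one x)
    have hw1 : w ≤ c ^ (-(3 / 2) : ℝ) * τ ^ (-(3 / 2) : ℝ) := by
      rw [hw, ← Real.rpow_neg_one, ← Real.rpow_add hs0, ← Real.mul_rpow hc.le hgx.le]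
      norm_num only
      exact Real.rpow_le_rpow_of_nonpos (mul_pos hc hgx) hcs (by norm_num)
    have hx1 : s⁻¹ * X 1 (s / D) ^ (3 / 2 : ℝ) ≤ c⁻¹ * (τ⁻¹ * X 1 (τ / D) ^ (3 / 2 : ℝ)) := by
      rw [← mul_assoc, ← mul_inv]
      have h1 := inv_anti₀ (mul_pos hc hgx) hcs
      have h2 := X_mono 1 (div_pos hs0 hD) (div_le_div_of_nonneg_right hsτ hD.le)
        ((div_le_one hD).2 hτD.le)
      have h3 := Real.rpow_le_rpow (X_pos 1 (div_pos hs0 hD) ((div_le_one hD).2 hsD.le)).le h2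
        (by norm_num : (0 : ℝ) ≤ 3 / 2)
      exact mul_le_mul h1 h3 (Real.rpow_nonneg
        (X_pos 1 (div_pos hs0 hD) ((div_le_one hD).2 hsD.le)).le _)
        (inv_nonneg.2 (mul_pos hc hgx).le)
    set x₁ := s⁻¹ * X 1 (s / D) ^ (3 / 2 : ℝ) with hx₁
    have hx₁0 : 0 ≤ x₁ := mul_nonneg (inv_nonneg.2 hs0.le)
      (Real.rpow_nonneg (X_pos 1 (div_pos hs0 hD) ((div_le_one hD).2 hsD.le)).le _)
    set Fq := f₀ ^ 2 / s ^ (2 * m) with hFq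
    have hFq0 : 0 ≤ Fq := by positivity
    set W := hardyWeight m r D C θ (d Ω x) with hW
    set divQ := ∑ j, fderiv ℝ (boundaryExtend g φ (q j)) x (EuclideanSpace.basisFun (Fin N) ℝ j)
    set cw := criticalWeight m r D κ s with hcw
    have b1 : C₁ * (Er * Sm ^ 2) ≤ C₁ * (Er * (C₂ * w)) := by gcongr
    have b2 : φ x ^ 2 * (testChain m r D M m s ^ 2 + κ * (Fq * Xprod r (s / D) ^ 2)) ≤
        φ x ^ 2 * (Fq * cw + a + C₃ * x₁) := by
      refine mul_le_mul_of_nonneg_left ?_ (sq_nonneg _)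
      rw [hcw, criticalWeight]
      linarith
    have b3 : φ x ^ 2 * (Fq * cw) ≤ (f₀ * φ x) ^ 2 * W + 2 * m * L * T₀ * C₂ * (Er * w) := by
      have h1 := mul_le_mul_of_nonneg_left a4 (sq_nonneg (f₀ * φ x))
      have h2 : (f₀ * φ x) ^ 2 * (2 * m * (L * nonflat g x) * T₀ / s ^ (2 * m)) ≤
          2 * m * L * T₀ * C₂ * (Er * w) := by
        calc (f₀ * φ x) ^ 2 * (2 * m * (L * nonflat g x) * T₀ / s ^ (2 * m))
            = 2 * m * L * T₀ * (nonflat g x * (φ x ^ 2 * Fq)) := by rw [hFq]; ring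
          _ ≤ 2 * m * L * T₀ * (Er * (1 * (C₂ * w))) := by
            have : nonflat g x ≤ Er := le_add_of_nonneg_right hgx.le
            gcongr
          _ = _ := by ring
      calc φ x ^ 2 * (Fq * cw) = (f₀ * φ x) ^ 2 * (cw / s ^ (2 * m)) := by rw [hFq]; ring
        _ ≤ _ := by linarith
    have b4 : C₄ * (Er * (τ⁻¹ * |P M s| + |a|)) ≤ C₄ * (Er * (C₃ * w + C₃ * w)) := by gcongr
    have b5 : φ x ^ 2 * (C₃ * x₁) ≤ C₃ * x₁ :=
      mul_le_of_le_one_left (by positivity) hφ1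
    have b6 : C₅ * (Er * w) ≤ C₅ * (Er * (c ^ (-(3 / 2) : ℝ) * τ ^ (-(3 / 2) : ℝ))) := by gcongr
    have b7 : C₃ * x₁ ≤ C₃ * (c⁻¹ * (τ⁻¹ * X 1 (τ / D) ^ (3 / 2 : ℝ))) := by gcongr
    have b8 : (C₅ * c ^ (-(3 / 2) : ℝ) + C₃ * c⁻¹) * boundaryError D g x =
        C₅ * (Er * (c ^ (-(3 / 2) : ℝ) * τ ^ (-(3 / 2) : ℝ))) +
        C₃ * (c⁻¹ * (τ⁻¹ * X 1 (τ / D) ^ (3 / 2 : ℝ))) +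
        (C₃ * c⁻¹ * (τ ^ (-(3 / 2) : ℝ) * Er) +
          C₅ * c ^ (-(3 / 2) : ℝ) * (τ⁻¹ * X 1 (τ / D) ^ (3 / 2 : ℝ))) := by
      rw [boundaryError]
      ring
    have b9 : 0 ≤ C₃ * c⁻¹ * (τ ^ (-(3 / 2) : ℝ) * Er) +
        C₅ * c ^ (-(3 / 2) : ℝ) * (τ⁻¹ * X 1 (τ / D) ^ (3 / 2 : ℝ)) := by
      have := Real.rpow_nonneg (X_pos 1 (div_pos hgx hD) ((div_le_one hD).2 hτD.le)).le (3 / 2)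
      positivity
    have b10 : κ * ((f₀ * φ x) ^ 2 / s ^ (2 * m) * Xprod r (s / D) ^ 2) =
        φ x ^ 2 * (κ * (Fq * Xprod r (s / D) ^ 2)) := by rw [hFq]; ring
    have b11 : C₅ * (Er * w) = C₁ * (Er * (C₂ * w)) + 2 * m * L * T₀ * C₂ * (Er * w) +
      C₄ * (Er * (C₃ * w + C₃ * w)) := by rw [hC₅]; ring
    rw [b10, b8]
    rw [mul_pow] at a1
    linarith
  · have hs0 : 0 < h x := (mul_pos hc hgx).trans_le (hM.lower x hgx)
    have h1 : boundaryExtend g φ (fun x => testChain m r D M 0 (h x)) x =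
      testChain m r D M 0 (h x) := by
      rw [boundaryExtend, if_pos hgx, hM.bump_one x hx, mul_one]
    rw [h1, testChain_zero_sq M hs0, mul_assoc, profile_sq_mul M hs0 hhD hxM]

end IsBoundaryModel
end BoundaryExtend

/-! ### The assumed inequality with a single weight -/

section Inequality

variable {N : ℕ} {Ω : Set (EuclideanSpace ℝ (Fin N))} {D : ℝ}

theorem continuous_d : Continuous (d Ω) := Metric.continuous_infDist_pt _

theorem continuousOn_X_d (hD : 0 < D) (hd : ∀ x ∈ Ω, 0 < d Ω x) (hdD : ∀ x ∈ Ω, d Ω x ≤ D) (i : ℕ) :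
    ContinuousOn (fun x => X i (d Ω x / D)) Ω := fun x hx =>
  ((hasDerivAt_X_div i hD (hd x hx) (hdD x hx)).continuousAt.comp
    (f := d Ω) continuous_d.continuousAt).continuousWithinAt

theorem continuousOn_Xprod_d (hD : 0 < D) (hd : ∀ x ∈ Ω, 0 < d Ω x) (hdD : ∀ x ∈ Ω, d Ω x ≤ D)
    (i : ℕ) : ContinuousOn (fun x => Xprod i (d Ω x / D)) Ω :=
  continuousOn_finsetProd _ fun j _ => continuousOn_X_d hD hd hdD j

/-- The Hardy–Rellich inequality in terms of a single weight. -/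
theorem integral_mul_hardyWeight_le {m r : ℕ} {C θ : ℝ} (hΩ : IsOpen Ω) (hD : 0 < D)
    (hd : ∀ x ∈ Ω, 0 < d Ω x) (hdD : ∀ x ∈ Ω, d Ω x ≤ D) {u : EuclideanSpace ℝ (Fin N) → ℝ}
    (hu : IsTestFunction Ω u)
    (hineq : C * (∫ x in Ω, u x ^ 2 / d Ω x ^ (2 * m) *
      (∏ j ∈ Finset.Icc 1 (r - 1), X j (d Ω x / D) ^ 2) * X r (d Ω x / D) ^ θ) ≤
      I m Ω D (r - 1) u) :
    IntegrableOn (fun x => u x ^ 2 * hardyWeight m r D C θ (d Ω x)) Ω ∧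
    ∫ x in Ω, u x ^ 2 * hardyWeight m r D C θ (d Ω x) ≤ ∫ x in Ω, energyDensity m u x := by
  obtain ⟨hu1, hu2, hu3⟩ := hu
  -- `u²` is compactly supported in `Ω`, where `d > 0` and all weights are continuous; no
  -- integrability up to the boundary is involved.
  have hint : ∀ w : EuclideanSpace ℝ (Fin N) → ℝ, ContinuousOn w Ω →
      IntegrableOn (fun x => u x ^ 2 * w x) Ω := fun w hw =>
    (integrable_mul_of_continuousOn (u := fun x => u x ^ 2) hΩ (hu1.continuous.pow 2)
      (hu2.comp_left (g := fun t : ℝ => t ^ 2) (by norm_num))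
      ((closure_mono (show Function.support (fun x => u x ^ 2) ⊆ Function.support u from
        fun x hx h => hx (by simp [h]))).trans hu3) hw).integrableOn
  have hdp : ContinuousOn (fun x => (d Ω x ^ (2 * m))⁻¹) Ω :=
    (continuous_d.continuousOn.pow _).inv₀ fun x hx => (pow_pos (hd x hx) _).ne'
  have hY := fun i => continuousOn_Xprod_d hD hd hdD i
  have hXθ : ContinuousOn (fun x => X r (d Ω x / D) ^ θ) Ω :=
    (continuousOn_X_d hD hd hdD r).rpow_const fun x hx => Or.inl
      (X_pos r (div_pos (hd x hx) hD) ((div_le_one hD).2 (hdD x hx))).ne'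
  have i0 : IntegrableOn (fun x => u x ^ 2 * (d Ω x ^ (2 * m))⁻¹) Ω := hint _ hdp
  have i1 : ∀ i, IntegrableOn
      (fun x => u x ^ 2 * ((d Ω x ^ (2 * m))⁻¹ * Xprod i (d Ω x / D) ^ 2)) Ω := fun i =>
    hint _ (hdp.mul ((hY i).pow 2))
  have i2 : IntegrableOn (fun x => u x ^ 2 * ((d Ω x ^ (2 * m))⁻¹ *
      (Xprod (r - 1) (d Ω x / D) ^ 2 * X r (d Ω x / D) ^ θ))) Ω :=
    hint _ (hdp.mul (((hY (r - 1)).pow 2).mul hXθ))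
  have e1 : ∀ x, u x ^ 2 * hardyWeight m r D C θ (d Ω x) =
      A m * (u x ^ 2 * (d Ω x ^ (2 * m))⁻¹) +
      B m * ∑ i ∈ Finset.Icc 1 (r - 1), u x ^ 2 * ((d Ω x ^ (2 * m))⁻¹ * Xprod i (d Ω x / D) ^ 2) +
      C * (u x ^ 2 * ((d Ω x ^ (2 * m))⁻¹ *
        (Xprod (r - 1) (d Ω x / D) ^ 2 * X r (d Ω x / D) ^ θ))) := fun x => by
    rw [← Finset.mul_sum, ← Finset.mul_sum, hardyWeight]
    ring
  have j1 : IntegrableOn (fun x => B m * ∑ i ∈ Finset.Icc 1 (r - 1),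
      u x ^ 2 * ((d Ω x ^ (2 * m))⁻¹ * Xprod i (d Ω x / D) ^ 2)) Ω :=
    (integrable_finsetSum _ fun i _ => i1 i).const_mul _
  have j0 : IntegrableOn (fun x => A m * (u x ^ 2 * (d Ω x ^ (2 * m))⁻¹)) Ω :=
    Integrable.const_mul i0 (A m)
  have j2 : IntegrableOn (fun x => C * (u x ^ 2 * ((d Ω x ^ (2 * m))⁻¹ *
      (Xprod (r - 1) (d Ω x / D) ^ 2 * X r (d Ω x / D) ^ θ)))) Ω := Integrable.const_mul i2 C
  have j01 : IntegrableOn (fun x => A m * (u x ^ 2 * (d Ω x ^ (2 * m))⁻¹) +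
      B m * ∑ i ∈ Finset.Icc 1 (r - 1),
        u x ^ 2 * ((d Ω x ^ (2 * m))⁻¹ * Xprod i (d Ω x / D) ^ 2)) Ω := j0.add j1
  have hW : IntegrableOn (fun x => u x ^ 2 * hardyWeight m r D C θ (d Ω x)) Ω := by
    simp only [e1]
    exact j01.add j2
  refine ⟨hW, ?_⟩
  simp only [e1]
  rw [integral_add j01 j2, integral_add j0 j1, integral_const_mul, integral_const_mul,
    integral_const_mul, integral_finsetSum _ fun i _ => i1 i]
  unfold I at hineq
  have k2 : ∫ x in Ω, u x ^ 2 / d Ω x ^ (2 * m) *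
      (∏ j ∈ Finset.Icc 1 (r - 1), X j (d Ω x / D) ^ 2) * X r (d Ω x / D) ^ θ =
      ∫ x in Ω, u x ^ 2 * ((d Ω x ^ (2 * m))⁻¹ *
        (Xprod (r - 1) (d Ω x / D) ^ 2 * X r (d Ω x / D) ^ θ)) := by
    refine integral_congr_ae (Filter.Eventually.of_forall fun x => ?_)
    simp only [Xprod, Finset.prod_pow]
    ring
  have k1 : ∀ i, ∫ x in Ω, u x ^ 2 / d Ω x ^ (2 * m) *
      ∏ j ∈ Finset.Icc 1 i, X j (d Ω x / D) ^ 2 =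
      ∫ x in Ω, u x ^ 2 * ((d Ω x ^ (2 * m))⁻¹ * Xprod i (d Ω x / D) ^ 2) := fun i => by
    refine integral_congr_ae (Filter.Eventually.of_forall fun x => ?_)
    simp only [Xprod, Finset.prod_pow]
    ring
  rw [k2] at hineq
  simp only [k1] at hineq
  simp only [div_eq_mul_inv (u _ ^ 2)] at hineq
  linarith

end Inequality

/-! ### Integration over the collar and the contradiction -/

namespace IsBoundaryModel

open scoped ENNReal

variable {N : ℕ} {Ω : Set (EuclideanSpace ℝ (Fin N))} {D η : ℝ} {p e : EuclideanSpace ℝ (Fin N)}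
  {K R c L : ℝ} {g h φ : EuclideanSpace ℝ (Fin N) → ℝ}

theorem isOpen_collar (hM : IsBoundaryModel Ω D η p e K R c L g h φ) :
    IsOpen (Metric.ball p R ∩ {x | 0 < g x}) :=
  Metric.isOpen_ball.inter (isOpen_lt continuous_const hM.graph.continuous)

theorem setLIntegral_comp_lt_top (hM : IsBoundaryModel Ω D η p e K R c L g h φ) {G : ℝ → ℝ≥0∞}
    (hG : Measurable G) {a : ℝ} (ha : ∀ x ∈ Metric.ball p R, g x < a)
    (hfin : ∫⁻ t in Set.Ioo 0 a, G t < ⊤) :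
    ∫⁻ x in Metric.ball p R ∩ {x | 0 < g x}, G (g x) < ⊤ := by
  obtain ⟨C, hC, h1⟩ := hM.graph.exists_lintegral_comp_le p R
  have h2 := h1 ((Set.Ioo 0 a).indicator G) (hG.indicator measurableSet_Ioo)
  rw [lintegral_indicator measurableSet_Ioo] at h2
  refine lt_of_le_of_lt ?_ (h2.trans_lt (ENNReal.mul_lt_top hC.lt_top hfin))
  refine le_trans (le_of_eq ?_) (lintegral_mono_set (Set.inter_subset_left (t := {x | 0 < g x})))
  refine setLIntegral_congr_fun hM.isOpen_collar.measurableSet fun x hx => ?_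
  exact (Set.indicator_of_mem (show g x ∈ Set.Ioo 0 a from ⟨hx.2, ha x hx.1⟩) G).symm

/-- Three contributions: `g^(-3/2) nonflat` is integrable by concavity, while `g^(-1/2)` and `g⁻¹
X_1^(3/2)` reduce to one-dimensional integrals over the layers of `g`. -/
theorem integrableOn_boundaryError (hM : IsBoundaryModel Ω D η p e K R c L g h φ) (hD : 0 < D) :
    IntegrableOn (boundaryError D g) (Metric.ball p R ∩ {x | 0 < g x}) := by
  have hV := hM.isOpen_collar.measurableSet
  have hgm := hM.graph.continuous.measurable
  have hnm := hM.graph.measurable_nonflat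
  have hXm := measurable_X 1
  have m1 : Measurable fun x => g x ^ (-(3 / 2) : ℝ) * nonflat g x := (hgm.pow_const _).mul hnm
  have m2 : Measurable fun t : ℝ => t ^ (-(1 / 2) : ℝ) := measurable_id.pow_const _
  have m3 : Measurable fun t : ℝ => t⁻¹ * X 1 (t / D) ^ (3 / 2 : ℝ) :=
    measurable_id.inv.mul ((hXm.comp (measurable_id.div_const D)).pow_const _)
  have hpos : ∀ x ∈ Metric.ball p R ∩ {x | 0 < g x}, 0 < X 1 (g x / D) := fun x hx =>
    X_pos 1 (div_pos hx.2 hD) ((div_le_one hD).2 (hM.lt_D x hx.1).le)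
  have aux : ∀ {f : EuclideanSpace ℝ (Fin N) → ℝ}, Measurable f →
      (∀ x ∈ Metric.ball p R ∩ {x | 0 < g x}, 0 ≤ f x) →
      ∫⁻ x in Metric.ball p R ∩ {x | 0 < g x}, ENNReal.ofReal (f x) < ⊤ →
      IntegrableOn f (Metric.ball p R ∩ {x | 0 < g x}) := fun {f} hf h0 hfin => by
    refine ⟨hf.aestronglyMeasurable, ?_⟩
    rw [hasFiniteIntegral_iff_ofReal ((ae_restrict_mem hV).mono h0)]
    exact hfin
  have i1 := aux m1 (fun x hx => mul_nonneg (Real.rpow_nonneg (le_of_lt hx.2) _)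
    (IsGraphFunction.nonflat_nonneg hx.2)) ((lintegral_mono_set
      (show Metric.ball p R ∩ {x | 0 < g x} ⊆ Metric.ball p R ∩ g ⁻¹' Set.Ioo 0 1 from fun x hx =>
        ⟨hx.1, hx.2, hM.lt_one x hx.1⟩)).trans_lt (hM.graph.setLIntegral_nonflat_lt_top p R))
  have i2 := aux (m2.comp hgm) (fun x hx => Real.rpow_nonneg (le_of_lt hx.2) _)
    (hM.setLIntegral_comp_lt_top m2.ennreal_ofReal hM.lt_one
      (IsGraphFunction.setLIntegral_rpow_lt_top (by norm_num)))
  have i3 := aux (m3.comp hgm) (fun x hx => mul_nonneg (inv_nonneg.2 (le_of_lt hx.2))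
    (Real.rpow_nonneg (hpos x hx).le _)) (hM.setLIntegral_comp_lt_top m3.ennreal_ofReal hM.lt_D
      (setLIntegral_X_one_lt_top hD le_rfl))
  refine ((i1.add i2).add i3).congr_fun (fun x hx => ?_) hV
  have hgx : 0 < g x := hx.2
  have h1 : g x ^ (-(1 / 2) : ℝ) = g x ^ (-(3 / 2) : ℝ) * g x := by
    rw [← Real.rpow_add_one hgx.ne']
    norm_num
  simp only [Pi.add_apply, Function.comp_apply, boundaryError, h1]
  ring

/-- The inequality with an improved constant bounds the critical integrals of the test functions. -/
theorem exists_lintegral_le (hM : IsBoundaryModel Ω D η p e K R c L g h φ) {m r : ℕ} (hm : 1 ≤ m)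
    (hr : 1 ≤ r) {C θ κ : ℝ} (hΩ : IsOpen Ω) (hD : 0 < D) (hκ : 0 ≤ κ) (hd : ∀ x ∈ Ω, 0 < d Ω x)
    (hdD : ∀ x ∈ Ω, d Ω x ≤ D) (hsmall : ∀ s, 0 < s → s < η → r * X 1 (s / D) ≤ 1)
    (hX : ∀ s, 0 < s → s < η → s ≤ D → (B m + κ) * X r (s / D) ^ 2 ≤ C * X r (s / D) ^ θ)
    (hineq : ∀ u : EuclideanSpace ℝ (Fin N) → ℝ, IsTestFunction Ω u →
      C * (∫ x in Ω, u x ^ 2 / d Ω x ^ (2 * m) *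
        (∏ j ∈ Finset.Icc 1 (r - 1), X j (d Ω x / D) ^ 2) * X r (d Ω x / D) ^ θ) ≤
        I m Ω D (r - 1) u) :
    ∃ C₀ : ℝ≥0∞, C₀ ≠ ⊤ ∧ ∀ M : ℕ, ∃ G : EuclideanSpace ℝ (Fin N) → ℝ,
      ∫⁻ x in Metric.ball p R ∩ {x | 0 < g x}, ENNReal.ofReal (κ * G x) ≤ C₀ ∧
      ∀ x ∈ Metric.ball p (R / 3), 0 < g x → h x < D → -Real.log (X r (h x / D)) ≤ M →
        G x = (h x)⁻¹ * Xprod r (h x / D) := by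
  obtain ⟨C₀, hC₀, hT⟩ := hM.exists_testFunction hm hr hD hκ hd hsmall hX
  have hV := hM.isOpen_collar.measurableSet
  have hVΩ : Metric.ball p R ∩ {x | 0 < g x} ⊆ Ω := fun x hx => (hM.mem_iff x hx.1).2 hx.2
  have hErr := hM.integrableOn_boundaryError hD
  refine ⟨ENNReal.ofReal (C₀ * ∫ x in Metric.ball p R ∩ {x | 0 < g x}, boundaryError D g x),
    ENNReal.ofReal_ne_top, fun M => ?_⟩
  obtain ⟨u, Q, hu, huc, hus, hQ, hpt, hG⟩ := hT M
  refine ⟨fun x => u x ^ 2 / h x ^ (2 * m) * Xprod r (h x / D) ^ 2, ?_, hG⟩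
  have hut : IsTestFunction Ω u := ⟨hu, huc, hus.trans hVΩ⟩
  obtain ⟨hWi, hWle⟩ := integral_mul_hardyWeight_le hΩ hD hd hdD hut (hineq u hut)
  set V := Metric.ball p R ∩ {x | 0 < g x} with hVdef
  set F : EuclideanSpace ℝ (Fin N) → ℝ := fun x =>
    u x ^ 2 * hardyWeight m r D C θ (d Ω x) - energyDensity m u x with hF
  have hEi := integrable_energyDensity hu huc m
  have hFi : IntegrableOn F Ω := hWi.sub hEi.integrableOn
  -- The assumed inequality applied to `u`, whose support lies in the collar `V`.
  have hFint : ∫ x in V, F x ≤ 0 := by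
    have h1 : ∫ x in V, F x = ∫ x in Ω, F x := by
      refine (setIntegral_eq_of_subset_of_forall_sdiff_eq_zero hΩ.measurableSet hVΩ
        fun x hx => ?_).symm
      have hxu : x ∉ tsupport u := fun h => hx.2 (hus h)
      simp only [hF, energyDensity_eq_zero m hxu, image_eq_zero_of_notMem_tsupport hxu]
      ring
    rw [h1, integral_sub hWi hEi.integrableOn]
    linarith
  have hQc : ∀ j, Continuous fun x => fderiv ℝ (Q j) x (EuclideanSpace.basisFun (Fin N) ℝ j) :=
    fun j => ((hQ j).1.continuous_fderiv (by simp)).clm_apply continuous_const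
  have hQi : ∀ j, Integrable fun x => fderiv ℝ (Q j) x (EuclideanSpace.basisFun (Fin N) ℝ j) :=
    fun j => (hQc j).integrable_of_hasCompactSupport ((hQ j).2.1.fderiv_apply ℝ _)
  have hSi : IntegrableOn (fun x =>
      ∑ j, fderiv ℝ (Q j) x (EuclideanSpace.basisFun (Fin N) ℝ j)) V :=
    (integrable_finsetSum _ fun j _ => hQi j).integrableOn
  -- The flux has compact support in `V`, so its divergence has integral zero and only the boundary
  -- error remains, uniformly in `M`.
  have hSint : ∫ x in V, ∑ j, fderiv ℝ (Q j) x (EuclideanSpace.basisFun (Fin N) ℝ j) = 0 := by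
    rw [integral_finsetSum _ fun j _ => (hQi j).integrableOn]
    refine Finset.sum_eq_zero fun j _ => ?_
    rw [setIntegral_eq_integral_of_forall_compl_eq_zero fun x hx => ?_]
    · exact integral_fderiv_eq_zero (hQ j).1 (hQ j).2.1 _
    · have h1 : x ∉ tsupport (Q j) := fun h => hx ((hQ j).2.2 h)
      rw [(notMem_tsupport_iff_eventuallyEq.1 h1).fderiv_eq]
      simp
  have hle : ∀ x ∈ V, κ * (u x ^ 2 / h x ^ (2 * m) * Xprod r (h x / D) ^ 2) ≤
      F x - ∑ j, fderiv ℝ (Q j) x (EuclideanSpace.basisFun (Fin N) ℝ j) +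
        C₀ * boundaryError D g x := fun x hx => by
    have := hpt x hx.1 hx.2
    simp only [hF]
    linarith
  have hFV : IntegrableOn F V := hFi.mono_set hVΩ
  have hFS : IntegrableOn (fun x => F x -
      ∑ j, fderiv ℝ (Q j) x (EuclideanSpace.basisFun (Fin N) ℝ j)) V := hFV.sub hSi
  have hTi : IntegrableOn (fun x => F x -
      ∑ j, fderiv ℝ (Q j) x (EuclideanSpace.basisFun (Fin N) ℝ j) + C₀ * boundaryError D g x) V :=
    hFS.add (hErr.const_mul C₀)
  have hnn : ∀ x ∈ V, 0 ≤ κ * (u x ^ 2 / h x ^ (2 * m) * Xprod r (h x / D) ^ 2) := fun x hx => by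
    have h1 : 0 ≤ h x ^ (2 * m) := by rw [pow_mul]; positivity
    exact mul_nonneg hκ (mul_nonneg (div_nonneg (sq_nonneg _) h1) (sq_nonneg _))
  calc ∫⁻ x in V, ENNReal.ofReal (κ * (u x ^ 2 / h x ^ (2 * m) * Xprod r (h x / D) ^ 2))
      ≤ ∫⁻ x in V, ENNReal.ofReal (F x -
        ∑ j, fderiv ℝ (Q j) x (EuclideanSpace.basisFun (Fin N) ℝ j) + C₀ * boundaryError D g x) :=
        setLIntegral_mono' hV fun x hx => ENNReal.ofReal_le_ofReal (hle x hx)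
    _ = ENNReal.ofReal (∫ x in V, (F x -
        ∑ j, fderiv ℝ (Q j) x (EuclideanSpace.basisFun (Fin N) ℝ j) +
          C₀ * boundaryError D g x)) := by
        rw [ofReal_integral_eq_lintegral_ofReal hTi]
        filter_upwards [ae_restrict_mem hV] with x hx
        exact (hnn x hx).trans (hle x hx)
    _ ≤ _ := by
      refine ENNReal.ofReal_le_ofReal ?_
      rw [integral_add hFS (hErr.const_mul C₀), integral_sub hFV hSi, hSint,
        integral_const_mul]
      linarith

/-- The critical integral diverges at the boundary. -/
theorem not_forall_lintegral_le (hM : IsBoundaryModel Ω D η p e K R c L g h φ) {r : ℕ} {κ : ℝ}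
    (hD : 0 < D) (hκ : 0 < κ) {C₀ : ℝ≥0∞} (hC₀ : C₀ ≠ ⊤)
    (hG : ∀ M : ℕ, ∃ G : EuclideanSpace ℝ (Fin N) → ℝ,
      ∫⁻ x in Metric.ball p R ∩ {x | 0 < g x}, ENNReal.ofReal (κ * G x) ≤ C₀ ∧
      ∀ x ∈ Metric.ball p (R / 3), 0 < g x → h x < D → -Real.log (X r (h x / D)) ≤ M →
        G x = (h x)⁻¹ * Xprod r (h x / D)) : False := by
  have hR := hM.radius_pos
  obtain ⟨c', δ, hc', hδ, hlow⟩ :=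
    hM.graph.exists_le_lintegral_comp hM.apply_center (by positivity : 0 < R / 3)
  set δ' := min δ D with hδ'
  have hδ'0 : 0 < δ' := lt_min hδ hD
  have hc := hM.const_pos
  -- The condition is imposed at `c t` because `h ≥ c g` and `X_r` is increasing: then it also holds
  -- at `h`.
  let S : ℕ → Set ℝ := fun M => {t | -Real.log (X r (c * t / D)) ≤ M}
  have hS : ∀ M, MeasurableSet (S M) := fun M => by
    have h1 := (measurable_X r).comp ((measurable_const_mul c).div_const D)
    exact measurableSet_le (Real.measurable_log.comp h1).neg measurable_const
  -- The factor `c^r` pays for replacing `h` by `g`: `Y_r(h/D) ≥ Y_r(c g/D) ≥ c^r Y_r(g/D)`.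
  let f : ℝ → ℝ≥0∞ := fun t => ENNReal.ofReal (κ * c ^ r) * ENNReal.ofReal (t⁻¹ * Xprod r (t / D))
  have hf0 : Measurable fun t : ℝ => ENNReal.ofReal (t⁻¹ * Xprod r (t / D)) :=
    (measurable_id.inv.mul ((measurable_Xprod r).comp (measurable_id.div_const D))).ennreal_ofReal
  have hf : Measurable f := hf0.const_mul _
  have hbound : ∀ M, c' * ∫⁻ t in Set.Ioo 0 δ', (S M).indicator f t ≤ C₀ := fun M => by
    obtain ⟨G, hG1, hG2⟩ := hG M
    have hsub : Metric.ball p (R / 3) ∩ g ⁻¹' Set.Ioo 0 δ' ⊆ Metric.ball p R ∩ {x | 0 < g x} :=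
      fun x hx => ⟨Metric.ball_subset_ball (by linarith) hx.1, hx.2.1⟩
    have hmeas : MeasurableSet (Metric.ball p (R / 3) ∩ g ⁻¹' Set.Ioo 0 δ') :=
      measurableSet_ball.inter (hM.graph.continuous.measurable measurableSet_Ioo)
    refine (hlow δ' (min_le_left _ _) _ (hf.indicator (hS M))).trans
      (le_trans ?_ ((lintegral_mono_set hsub).trans hG1))
    refine setLIntegral_mono' hmeas fun x hx => ?_
    by_cases hxS : g x ∈ S M
    · rw [Set.indicator_of_mem hxS]
      have hgx : 0 < g x := hx.2.1
      have hgD : g x ≤ D := hx.2.2.le.trans (min_le_right _ _)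
      have hch := hM.lower x hgx
      have hhg := hM.upper x hgx
      have hcg := mul_pos hc hgx
      have hh0 := hcg.trans_le hch
      have hhD : h x < D := hhg.trans_lt (hx.2.2.trans_le (min_le_right _ _))
      have hh1 : h x / D ≤ 1 := (div_le_one hD).2 hhD.le
      have h1 : -Real.log (X r (h x / D)) ≤ M := by
        refine le_trans (neg_le_neg ?_) hxS
        exact Real.log_le_log (X_pos r (div_pos hcg hD)
          ((div_le_div_of_nonneg_right hch hD.le).trans hh1))
          (X_mono r (div_pos hcg hD) (div_le_div_of_nonneg_right hch hD.le) hh1)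
      rw [hG2 x hx.1 hgx hhD h1]
      simp only [f]
      rw [← ENNReal.ofReal_mul (by positivity)]
      refine ENNReal.ofReal_le_ofReal ?_
      have h2 := pow_mul_Xprod_le r hc (hM.const_le_one hgx) (div_pos hgx hD)
        ((div_le_one hD).2 hgD)
      have h3 : Xprod r (c * (g x / D)) ≤ Xprod r (h x / D) := by
        rw [← mul_div_assoc]
        exact Finset.prod_le_prod (fun j _ => (X_pos j (div_pos hcg hD)
          ((div_le_div_of_nonneg_right hch hD.le).trans hh1)).le) fun j _ =>
          X_mono j (div_pos hcg hD) (div_le_div_of_nonneg_right hch hD.le) hh1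
      have h4 := inv_anti₀ hh0 hhg
      have h5 := (Xprod_pos r (div_pos hgx hD) ((div_le_one hD).2 hgD)).le
      calc κ * c ^ r * ((g x)⁻¹ * Xprod r (g x / D))
          = κ * ((g x)⁻¹ * (c ^ r * Xprod r (g x / D))) := by ring
        _ ≤ κ * ((h x)⁻¹ * Xprod r (h x / D)) := by
          refine mul_le_mul_of_nonneg_left (mul_le_mul h4 (h2.trans h3) (by positivity)
            (inv_nonneg.2 hh0.le)) hκ.le
    · rw [Set.indicator_of_notMem hxS]
      exact zero_le
  have hmono : Monotone fun M : ℕ => (S M).indicator f := fun M M' hMM => by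
    refine Set.indicator_le_indicator_of_subset (fun t ht => ?_) fun _ => zero_le
    exact le_trans (show -Real.log (X r (c * t / D)) ≤ M from ht) (by exact_mod_cast hMM)
  -- Monotone convergence: the sets `S M` exhaust the line, and the full integral of `f` near `0` is
  -- infinite.
  have htop : ⨆ M : ℕ, ∫⁻ t in Set.Ioo 0 δ', (S M).indicator f t = ⊤ := by
    rw [← lintegral_iSup (fun M => hf.indicator (hS M)) hmono, eq_top_iff]
    have h1 : ∫⁻ t in Set.Ioo 0 δ', f t = ⊤ := by
      rw [lintegral_const_mul _ hf0, setLIntegral_Xprod_eq_top r hD hδ'0 (min_le_right _ _)]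
      exact ENNReal.mul_top (ENNReal.ofReal_pos.2 (by positivity)).ne'
    rw [← h1]
    refine lintegral_mono fun t => ?_
    obtain ⟨M, hM'⟩ := exists_nat_ge (-Real.log (X r (c * t / D)))
    refine le_trans ?_ (le_iSup _ M)
    rw [Set.indicator_of_mem (show t ∈ S M from hM')]
  have h1 : c' * ⨆ M : ℕ, ∫⁻ t in Set.Ioo 0 δ', (S M).indicator f t ≤ C₀ := by
    rw [ENNReal.mul_iSup]
    exact iSup_le hbound
  rw [htop, ENNReal.mul_top hc'] at h1
  exact hC₀ (top_le_iff.1 h1)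

end IsBoundaryModel
end HardyRellich

end

theorem theorem3 (N m : ℕ) (hm : 1 ≤ m)
    (Ω : Set (EuclideanSpace ℝ (Fin N))) (hΩo : IsOpen Ω) (hΩc : Convex ℝ Ω)
    (hΩne : Ω.Nonempty) (hΩu : Ω ≠ Set.univ)
    (r : ℕ) (hr : 1 ≤ r) (C θ D : ℝ) (hC : 0 < C)
    (hD : ∀ x ∈ Ω, HardyRellich.d Ω x ≤ D)
    (hineq : ∀ u : EuclideanSpace ℝ (Fin N) → ℝ, HardyRellich.IsTestFunction Ω u →
      C * (∫ x in Ω, u x ^ 2 / HardyRellich.d Ω x ^ (2 * m)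
          * (∏ j ∈ Finset.Icc 1 (r - 1), HardyRellich.X j (HardyRellich.d Ω x / D) ^ 2)
          * HardyRellich.X r (HardyRellich.d Ω x / D) ^ θ)
        ≤ HardyRellich.I m Ω D (r - 1) u) :
    2 ≤ θ ∧ (θ = 2 → C ≤ HardyRellich.B m) := by
  have hd : ∀ x ∈ Ω, 0 < HardyRellich.d Ω x := fun x hx =>
    HardyRellich.infDist_frontier_pos hΩo hΩu hx
  have hD0 : 0 < D := by
    obtain ⟨x, hx⟩ := hΩne
    exact (hd x hx).trans_le (hD x hx)
  by_contra hneg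
  obtain ⟨κ, η₁, hκ, hη₁, hX⟩ :=
    HardyRellich.exists_rpow_X_ge (r := r) hD0 hC (HardyRellich.B_nonneg m) hneg
  have hr0 : (0 : ℝ) < r := by exact_mod_cast hr
  obtain ⟨η₂, hη₂, hsmall⟩ := HardyRellich.exists_X_div_lt 1 hD0 (one_div_pos.2 hr0)
  -- The collar lies where both smallness conditions hold: the gain `κ` below `η₁`, and `r X_1 ≤ 1`
  -- below `η₂`.
  obtain ⟨p, e, K, R, c, L, g, h, φ, hM⟩ :=
    HardyRellich.exists_isBoundaryModel hΩo hΩc hΩne hΩu hD0 (lt_min hη₁ hη₂)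
  obtain ⟨C₀, hC₀, hG⟩ := hM.exists_lintegral_le hm hr hΩo hD0 hκ.le hd hD
    (fun s hs hsη => by
      have h1 := hsmall s hs (hsη.trans_le (min_le_right _ _))
      rw [lt_div_iff₀ hr0, mul_comm] at h1
      exact h1.le)
    (fun s hs hsη => hX s hs (hsη.trans_le (min_le_left _ _))) hineq
  exact hM.not_forall_lintegral_le hD0 hκ hC₀ hG
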